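/- Let $\Omega=\prod_{i=1}^{3}(0,L_i)$ with $L_i>0$, and let $\kappa_2>0$. For $m\in\mathbb N$ let $\mathcal V^m$ be the space of (restrictions to $\Omega$ of) functions in $H^m_{loc}(\mathbb R^3)$ that are $L_i$-periodic in $x_i$ for $i=1,2,3$, and let $\dot{\mathcal V}^m_{div}$ be the space of vector fields $v$ with components in $\mathcal V^m$, $\operatorname{div}v=0$ and $\int_\Omega v\,dx=0$. For $T\in(0,\infty]$ let $\mathcal X(T)$ be the class of all $(v,\omega,b)$ such that $$v\in L^2_{loc}([0,T);\dot{\mathcal V}^3_{div}),\qquad \omega,b\in L^2_{loc}([0,T);\mathcal V^3),$$ and all five components $v_1,v_2,v_3,\omega,b$ belong to $H^1_{loc}([0,T);H^1(\Omega))$. Here "loc in $[0,T)$" means on $(0,S)$ for every finite $0<S<T$. Let $v_0\in\dot{\mathcal V}^2_{div}$ and $\omega_0,b_0\in\mathcal V^2$, and suppose that there are positive numbers $b_{min},\omega_{min},\omega_{max}$ with $b_{min}\le b_0$ and $\omega_{min}\le\omega_0\le\omega_{max}$ on $\Omega$. A solution in $\mathcal X(T)$ of Kolmogorov's two-equation model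 of turbulence (with periodic boundary conditions and all parameters other than $\kappa_2$ normalized) with initial data $(v_0,\omega_0,b_0)$ is a triple $(v,\omega,b)\in\mathcal X(T)$ such that, with $\mu=b/\omega$, $D(v)$ the symmetric part of $\nabla v$, and $(\cdot,\cdot)$ the inner product of $L^2(\Omega)$, for almost all $t\in(0,T)$ $$(v_{,t},w)-(v\otimes v,\nabla w)+(\mu D(v),D(w))=0\quad\text{for all } w\in\dot{\mathcal V}^1_{div},$$ $$(\omega_{,t},z)-(\omega v,\nabla z)+(\mu\nabla\omega,\nabla z)=-\kappa_2(\omega^2,z)\quad\text{for all } z\in\mathcal V^1,$$ $$(b_{,t},q)-(bv,\nabla q)+(\mu\nabla b,\nabla q)=-(b\omega,q)+(\mu|D(v)|^2,q)\quad\text{for all } q\in\mathcal V^1,$$ and $v|_{t=0}=v_0$, $\omega|_{t=0}=\omega_0$, $b|_{t=0}=b_0$. Then, for every $T\in(0,\infty]$, there is at most one solution in $\mathcal X(T)$: any two solutions in $\mathcal X(T)$ with the same initial data $(v_0,\omega_0,b_0)$ coincide almost everywhere on $\Omega\times(0,T)$. -/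

import Mathlib

open MeasureTheory Set Filter Topology

noncomputable section

namespace Kolmogorov

/-- Points of three dimensional space. -/
abbrev Space : Type := Fin 3 → ℝ

/-- The box with side lengths `L 0`, `L 1`, `L 2`. -/
def box (L : Space) : Set Space := Set.univ.pi fun i => Ioo 0 (L i)

/-- The time interval `(0, T)`, where `T` may be infinite. -/
def timeInterval (T : EReal) : Set ℝ := {t : ℝ | 0 < t ∧ (t : EReal) < T}

/-- The `i`-th classical partial derivative. -/
def partialDeriv (i : Fin 3) (φ : Space → ℝ) (x : Space) : ℝ := fderiv ℝ φ x (Pi.single i 1)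

/-- `g` is the weak partial derivative of `f` in direction `i` on the open set `U`. -/
def HasWeakPartial (U : Set Space) (i : Fin 3) (f g : Space → ℝ) : Prop :=
  LocallyIntegrableOn f U ∧ LocallyIntegrableOn g U ∧
    ∀ φ : Space → ℝ, ContDiff ℝ (⊤ : ℕ∞) φ → HasCompactSupport φ → tsupport φ ⊆ U →
      ∫ x in U, f x * partialDeriv i φ x = -∫ x in U, g x * φ x

open Classical in
/-- The weak partial derivative on the whole space (it is unique up to null sets where it exists,
and it is set to `0` where it does not exist). -/
def weakPartial (i : Fin 3) (f : Space → ℝ) : Space → ℝ :=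
  if h : ∃ g, HasWeakPartial univ i f g then Classical.choose h else 0

/-- Periodicity with respect to the box. -/
def IsPeriodic (L : Space) (f : Space → ℝ) : Prop :=
  ∀ (i : Fin 3) (k : ℤ), (fun x => f (x + Pi.single i (k * L i))) =ᵐ[volume] f

/-- The space `L²_loc(ℝ³)`. -/
def MemL2loc (f : Space → ℝ) : Prop :=
  ∀ K : Set Space, IsCompact K → MemLp f 2 (volume.restrict K)

/-- The space `H^m_loc(ℝ³)`. -/
def MemHloc : ℕ → (Space → ℝ) → Prop
  | 0, f => MemL2loc f
  | m + 1, f => MemL2loc f ∧ ∀ i, ∃ g, HasWeakPartial univ i f g ∧ MemHloc m g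

/-- The space `V^m` of periodic functions in `H^m_loc(ℝ³)`. An element, that is the restriction
to the box of such a function, is represented by its periodic extension. -/
def MemV (L : Space) (m : ℕ) (f : Space → ℝ) : Prop :=
  IsPeriodic L f ∧ MemHloc m f

/-- Vector fields with zero weak divergence and zero mean over the box. -/
def DivFreeMeanZero (L : Space) (v : Fin 3 → Space → ℝ) : Prop :=
  (fun x => ∑ i, weakPartial i (v i) x) =ᵐ[volume] 0 ∧ ∀ i, ∫ x in box L, v i x = 0

/-- The space of divergence free vector fields with zero mean and components in `V^m`. -/
def MemVdiv (L : Space) (m : ℕ) (v : Fin 3 → Space → ℝ) : Prop :=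
  (∀ i, MemV L m (v i)) ∧ DivFreeMeanZero L v

/-- The space `L²_loc([0,T); L²(Ω))`: square integrable on `(0,S) × Ω` for every `S < T`. -/
def MemL2locL2 (L : Space) (T : EReal) (u : ℝ → Space → ℝ) : Prop :=
  ∀ S : ℝ, 0 < S → (S : EReal) < T →
    MemLp (fun p : ℝ × Space => u p.1 p.2) 2
      ((volume.restrict (Ioo 0 S)).prod (volume.restrict (box L)))

/-- The space `L²_loc([0,T); V^m)`: for almost every time the function is periodic, and it has weak
space derivatives of all orders up to `m`, all of them in `L²_loc([0,T); L²(Ω))`. -/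
def MemL2locV (L : Space) (T : EReal) : ℕ → (ℝ → Space → ℝ) → Prop
  | 0, u => MemL2locL2 L T u ∧ ∀ᵐ t ∂volume.restrict (timeInterval T), IsPeriodic L (u t)
  | m + 1, u =>
      (MemL2locL2 L T u ∧ ∀ᵐ t ∂volume.restrict (timeInterval T), IsPeriodic L (u t)) ∧
      ∀ i, ∃ g : ℝ → Space → ℝ, MemL2locV L T m g ∧
        ∀ᵐ t ∂volume.restrict (timeInterval T), HasWeakPartial univ i (u t) (g t)

/-- The space `L²_loc([0,T); H¹(Ω))`, without periodicity. -/
def MemL2locH1 (L : Space) (T : EReal) (u : ℝ → Space → ℝ) : Prop :=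
  MemL2locL2 L T u ∧ ∀ i, ∃ g : ℝ → Space → ℝ, MemL2locL2 L T g ∧
    ∀ᵐ t ∂volume.restrict (timeInterval T), HasWeakPartial (box L) i (u t) (g t)

/-- `u'` is the weak time derivative of `u` on `(0,T)`, as functions with values in `L²(Ω)`. -/
def HasWeakTimeDeriv (L : Space) (T : EReal) (u u' : ℝ → Space → ℝ) : Prop :=
  ∀ φ : ℝ → ℝ, ContDiff ℝ (⊤ : ℕ∞) φ → HasCompactSupport φ → tsupport φ ⊆ timeInterval T →
    ∀ᵐ x ∂volume.restrict (box L),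
      ∫ t in timeInterval T, u t x * deriv φ t = -∫ t in timeInterval T, u' t x * φ t

/-- The space `H¹_loc([0,T); H¹(Ω))`. -/
def MemH1locH1 (L : Space) (T : EReal) (u : ℝ → Space → ℝ) : Prop :=
  MemL2locH1 L T u ∧ ∃ u' : ℝ → Space → ℝ, MemL2locH1 L T u' ∧ HasWeakTimeDeriv L T u u'

open Classical in
/-- The weak time derivative of an element of `H¹_loc([0,T); H¹(Ω))` (unique up to null sets of
`(0,T) × Ω`; it is set to `0` where it does not exist). -/
def timeDeriv (L : Space) (T : EReal) (u : ℝ → Space → ℝ) : ℝ → Space → ℝ :=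
  if h : ∃ u' : ℝ → Space → ℝ, MemL2locH1 L T u' ∧ HasWeakTimeDeriv L T u u' then
    Classical.choose h
  else 0

/-- The class `𝒳(T)`. -/
structure MemX (L : Space) (T : EReal) (v : ℝ → Fin 3 → Space → ℝ) (ω b : ℝ → Space → ℝ) :
    Prop where
  v_space : ∀ i, MemL2locV L T 3 (fun t => v t i)
  v_div : ∀ᵐ t ∂volume.restrict (timeInterval T), DivFreeMeanZero L (v t)
  ω_space : MemL2locV L T 3 ω
  b_space : MemL2locV L T 3 b
  v_time : ∀ i, MemH1locH1 L T (fun t => v t i)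
  ω_time : MemH1locH1 L T ω
  b_time : MemH1locH1 L T b

/-- The symmetric part `D(v)` of the gradient. -/
def symGrad (v : Fin 3 → Space → ℝ) (i j : Fin 3) (x : Space) : ℝ :=
  (weakPartial j (v i) x + weakPartial i (v j) x) / 2

/-- The initial condition `u(0) = u₀`: the continuous representative of `u`, with values in
`L²(Ω)`, tends to `u₀` as `t → 0⁺`. Since `u` is only given up to null sets of times, the limit
is taken off such a null set. -/
def HasInitialValue (L : Space) (u : ℝ → Space → ℝ) (u₀ : Space → ℝ) : Prop :=
  Tendsto (fun t => eLpNorm (fun x => u t x - u₀ x) 2 (volume.restrict (box L)))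
    (𝓝[>] (0 : ℝ) ⊓ ae volume) (𝓝 0)

/-- `(v, ω, b)` is a solution in `𝒳(T)` of Kolmogorov's two-equation model with periodic boundary
conditions, parameter `κ₂` and initial data `(v₀, ω₀, b₀)`. -/
structure IsSolution (L : Space) (κ₂ : ℝ) (T : EReal)
    (v₀ : Fin 3 → Space → ℝ) (ω₀ b₀ : Space → ℝ)
    (v : ℝ → Fin 3 → Space → ℝ) (ω b : ℝ → Space → ℝ) : Prop where
  memX : MemX L T v ω b
  eq_v : ∀ᵐ t ∂volume.restrict (timeInterval T), ∀ w : Fin 3 → Space → ℝ, MemVdiv L 1 w →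
    (∫ x in box L, ∑ i, timeDeriv L T (fun s => v s i) t x * w i x)
      - (∫ x in box L, ∑ i, ∑ j, v t i x * v t j x * weakPartial j (w i) x)
      + (∫ x in box L, ∑ i, ∑ j, b t x / ω t x * symGrad (v t) i j x * symGrad w i j x) = 0
  eq_ω : ∀ᵐ t ∂volume.restrict (timeInterval T), ∀ z : Space → ℝ, MemV L 1 z →
    (∫ x in box L, timeDeriv L T ω t x * z x)
      - (∫ x in box L, ∑ j, ω t x * v t j x * weakPartial j z x)
      + (∫ x in box L, ∑ j, b t x / ω t x * weakPartial j (ω t) x * weakPartial j z x)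
    = -κ₂ * ∫ x in box L, ω t x ^ 2 * z x
  eq_b : ∀ᵐ t ∂volume.restrict (timeInterval T), ∀ q : Space → ℝ, MemV L 1 q →
    (∫ x in box L, timeDeriv L T b t x * q x)
      - (∫ x in box L, ∑ j, b t x * v t j x * weakPartial j q x)
      + (∫ x in box L, ∑ j, b t x / ω t x * weakPartial j (b t) x * weakPartial j q x)
    = -(∫ x in box L, b t x * ω t x * q x)
      + ∫ x in box L, b t x / ω t x * (∑ i, ∑ j, symGrad (v t) i j x ^ 2) * q x
  init_v : ∀ i, HasInitialValue L (fun t => v t i) (v₀ i)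
  init_ω : HasInitialValue L ω ω₀
  init_b : HasInitialValue L b b₀

end Kolmogorov

end

open Kolmogorov

/-!
The theorem is proved by an energy estimate for the difference of two solutions. Two facts make
that estimate possible: solutions have representatives that are regular enough to be inserted as
test functions and bounded together with their gradients, and `ω` and `b` stay away from zero, so
that the viscosity `μ = b / ω` is bounded above and below.

*Regularity.* Fix a finite `S < T`. A component `u` of a solution lies in `L²(0,S; H³)`, and its
time derivative in `L²(0,S; H¹)`. By Parseval's identity this is a pair of weighted square sums of
the Fourier coefficients `û(k,t)` and `û'(k,t)`. The one-dimensional Sobolev inequality in time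
(`sq_le_of_primitive`), with a parameter that depends on `k`, bounds `(1+|ξ|²)² |û(k,t)|²` uniformly
in `t` by a summable sequence. Since `∑ (1+|ξ|²)⁻²` converges in dimension three, the Fourier series
converges uniformly on `[0,S] × ℝ³` and defines a continuous representative, which is a primitive
of `u'` in time; for almost every `t` it is continuously differentiable in space, with a gradient
bounded by a function `A(t)` in `L²(0,S)` (`SobolevBounds.exists_regularRep`). The derivative `u'`
is only known to have weak derivatives inside the box; that its Fourier coefficients behave like
those of a periodic function follows from the periodicity of `u` (`WeakTimeDeriv.partial`,
`WeakTimeDeriv.coeff_partial`). For almost every time the equations then hold in a classical form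
(`SliceEq`, `exists_regularSolution`).

*Lower bounds.* As long as `ω` and `b` are positive, the diffusion terms have the good sign, and
testing with truncations of `e^{Mt} ω` and `e^{Mt} b` gives `ω, b ≥ m e^{-Mt}` for `M` large, where
`m` bounds the initial data from below; the convective terms drop out because `v` is solenoidal.
By uniform continuity these bounds propagate to all of `[0,S]` in finitely many steps
(`RegularSolution.exists_lower_bound`).

*Uniqueness.* Let `E(t)` be the squared `L²` norm of the difference of two solutions. Testing the
differences of the equations with the differences of the solutions, one gets quadratic terms in the
gradients of the differences with the good sign, which absorb everything that is linear in these
gradients (`exists_difference_bound`); for the source `μ |D(v)|²` this uses the dissipation in the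
equation for `v`. No Korn inequality is needed, because `v ⊗ v` is symmetric and only sees the
symmetric part of the gradient of the test function. The result is `E' ≤ C (1 + A²) E` with `A²`
integrable, hence `E = 0` by Gronwall's inequality (`RegularSolution.unique`). Taking the union over
rational `S < T` covers the whole time interval.
-/

noncomputable section

namespace Kolmogorov

section

/-! ### Absolutely continuous functions of one real variable -/

theorem ac_comp_lipschitzOn {f G : ℝ → ℝ} {a b : ℝ} {K : NNReal} {s : Set ℝ}
    (hG : LipschitzOnWith K G s) (hf : AbsolutelyContinuousOnInterval f a b)
    (hs : ∀ x ∈ uIcc a b, f x ∈ s) :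
    AbsolutelyContinuousOnInterval (fun x => G (f x)) a b := by
  rw [absolutelyContinuousOnInterval_iff] at hf ⊢
  intro ε hε
  obtain ⟨δ, hδ, h⟩ := hf (ε / (K + 1)) (by positivity)
  refine ⟨δ, hδ, fun E hE hEδ => ?_⟩
  have h1 := h E hE hEδ
  have h2 : ∑ i ∈ Finset.range E.1, dist (G (f (E.2 i).1)) (G (f (E.2 i).2)) ≤
      K * ∑ i ∈ Finset.range E.1, dist (f (E.2 i).1) (f (E.2 i).2) := by
    rw [Finset.mul_sum]
    refine Finset.sum_le_sum fun i hi => ?_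
    have := hE.1 i hi
    exact hG.dist_le_mul _ (hs _ this.1) _ (hs _ this.2)
  have h3 : (0 : ℝ) ≤ ∑ i ∈ Finset.range E.1, dist (f (E.2 i).1) (f (E.2 i).2) :=
    Finset.sum_nonneg fun _ _ => dist_nonneg
  have hK : (0 : ℝ) ≤ K := K.2
  calc _ ≤ _ := h2
    _ ≤ (K + 1) * ∑ i ∈ Finset.range E.1, dist (f (E.2 i).1) (f (E.2 i).2) := by nlinarith
    _ < (K + 1) * (ε / (K + 1)) := by gcongr
    _ = ε := by field_simp

/-- `AbsolutelyContinuousOnInterval` is preserved by composition with a `C¹` function. The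
local Lipschitz bound suffices, as the inner function is bounded. -/
theorem ac_comp_contDiff {f G : ℝ → ℝ} {a b : ℝ} (hG : ContDiff ℝ 1 G)
    (hf : AbsolutelyContinuousOnInterval f a b) :
    AbsolutelyContinuousOnInterval (fun x => G (f x)) a b := by
  obtain ⟨C, hC⟩ := hf.exists_bound
  obtain ⟨K, hK⟩ := hG.contDiffOn.exists_lipschitzOnWith (s := Icc (-C) C) (by decide)
    (convex_Icc _ _) isCompact_Icc
  exact ac_comp_lipschitzOn hK hf fun x hx => abs_le.1 (hC x hx)

/-- The chain rule, in integrated form, for `t ↦ G (exp (M t) f t)` with `f` a primitive of an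
integrable function. -/
theorem comp_exp_mul_primitive {f h G G' : ℝ → ℝ} {t : ℝ} (M : ℝ) (ht : 0 ≤ t)
    (hh : IntervalIntegrable h volume 0 t)
    (hf : ∀ s ∈ Icc 0 t, f s = f 0 + ∫ r in (0 : ℝ)..s, h r)
    (hG : ContDiff ℝ 1 G) (hG' : ∀ y, HasDerivAt G (G' y) y) :
    G (Real.exp (M * t) * f t) - G (f 0) =
      ∫ s in (0 : ℝ)..t,
        G' (Real.exp (M * s) * f s) * (Real.exp (M * s) * (M * f s + h s)) := by
  have hac := hh.absolutelyContinuousOnInterval_intervalIntegral (c := 0) (by simp)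
  have hexp : AbsolutelyContinuousOnInterval (fun s => Real.exp (M * s)) 0 t :=
    ContDiffOn.absolutelyContinuousOnInterval (by fun_prop)
  have hconst : AbsolutelyContinuousOnInterval (fun _ => f 0) 0 t :=
    ContDiffOn.absolutelyContinuousOnInterval (by fun_prop)
  have hF := ac_comp_contDiff hG (hexp.fun_mul (hconst.fun_add hac))
  have key := hF.integral_deriv_eq_sub
  have e1 := hf t ⟨ht, le_rfl⟩
  simp only [intervalIntegral.integral_same, add_zero, mul_zero, Real.exp_zero, one_mul] at key
  rw [← e1] at key
  rw [← key]
  apply intervalIntegral.integral_congr_ae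
  filter_upwards [hh.ae_hasDerivAt_integral] with s hs hst
  have hst' : s ∈ Icc 0 t := by rw [uIoc_of_le ht] at hst; exact ⟨hst.1.le, hst.2⟩
  have h1 := hs (by rwa [uIcc_of_le ht]) 0 (by simp)
  have h2 : HasDerivAt (fun s => Real.exp (M * s)) (Real.exp (M * s) * (M * 1)) s :=
    ((hasDerivAt_id s).const_mul M).exp
  have h3 := (hG' _).comp s (h2.mul (h1.const_add (f 0)))
  simp only [Function.comp_def, Pi.mul_apply] at h3
  rw [h3.deriv, ← hf s hst']
  ring

theorem sq_primitive {f h : ℝ → ℝ} {t : ℝ} (ht : 0 ≤ t)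
    (hh : IntervalIntegrable h volume 0 t)
    (hf : ∀ s ∈ Icc 0 t, f s = f 0 + ∫ r in (0 : ℝ)..s, h r) :
    f t ^ 2 - f 0 ^ 2 = ∫ s in (0 : ℝ)..t, 2 * (f s * h s) := by
  have := comp_exp_mul_primitive (G := fun y => y ^ 2) (G' := fun y => 2 * y) 0 ht hh hf
    (by fun_prop) (fun y => by simpa using hasDerivAt_pow 2 y)
  simpa [mul_assoc] using this

theorem continuousOn_of_primitive {f h : ℝ → ℝ} {S : ℝ} (hS : 0 ≤ S)
    (hh : IntervalIntegrable h volume 0 S)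
    (hf : ∀ s ∈ Icc 0 S, f s = f 0 + ∫ r in (0 : ℝ)..s, h r) : ContinuousOn f (Icc 0 S) := by
  have hac := (hh.absolutelyContinuousOnInterval_intervalIntegral (c := 0) (by simp)).continuousOn
  rw [uIcc_of_le hS] at hac
  exact (continuousOn_const.add hac).congr hf

/-- The one-dimensional Sobolev inequality with a free parameter `w`. -/
theorem sq_le_of_primitive {f h : ℝ → ℝ} {S w : ℝ} (hS : 0 < S) (hw : 0 < w)
    (hh : IntervalIntegrable h volume 0 S)
    (hh2 : IntervalIntegrable (fun s => h s ^ 2) volume 0 S)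
    (hf : ∀ s ∈ Icc 0 S, f s = f 0 + ∫ r in (0 : ℝ)..s, h r) {t : ℝ} (ht : t ∈ Icc 0 S) :
    f t ^ 2 ≤ (S⁻¹ + w) * (∫ s in (0 : ℝ)..S, f s ^ 2) + w⁻¹ * ∫ s in (0 : ℝ)..S, h s ^ 2 := by
  have hc := continuousOn_of_primitive hS.le hh hf
  have hc' : ContinuousOn f (uIcc 0 S) := by rwa [uIcc_of_le hS.le]
  have hf2 : IntervalIntegrable (fun s => f s ^ 2) volume 0 S := (hc'.pow 2).intervalIntegrable
  have hfh : IntervalIntegrable (fun s => f s * h s) volume 0 S := hh.continuousOn_mul hc'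
  have hK : IntervalIntegrable (fun s => w * f s ^ 2 + w⁻¹ * h s ^ 2) volume 0 S :=
    (hf2.const_mul w).add (hh2.const_mul _)
  set K := ∫ s in (0 : ℝ)..S, (w * f s ^ 2 + w⁻¹ * h s ^ 2) with hKdef
  have hKe : K = w * (∫ s in (0 : ℝ)..S, f s ^ 2) + w⁻¹ * ∫ s in (0 : ℝ)..S, h s ^ 2 := by
    rw [hKdef, intervalIntegral.integral_add (hf2.const_mul w) (hh2.const_mul _),
      intervalIntegral.integral_const_mul, intervalIntegral.integral_const_mul]
  have hpt : ∀ s, |2 * (f s * h s)| ≤ w * f s ^ 2 + w⁻¹ * h s ^ 2 := by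
    intro s
    have hw' : w * w⁻¹ = 1 := mul_inv_cancel₀ hw.ne'
    have hwi : 0 < w⁻¹ := inv_pos.2 hw
    rw [abs_le]
    have e1 : w * f s ^ 2 + w⁻¹ * h s ^ 2 - 2 * (f s * h s) = w⁻¹ * (w * f s - h s) ^ 2 := by
      field_simp; ring
    have e2 : w * f s ^ 2 + w⁻¹ * h s ^ 2 + 2 * (f s * h s) = w⁻¹ * (w * f s + h s) ^ 2 := by
      field_simp; ring
    have p1 : 0 ≤ w⁻¹ * (w * f s - h s) ^ 2 := by positivity
    have p2 : 0 ≤ w⁻¹ * (w * f s + h s) ^ 2 := by positivity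
    constructor <;> linarith
  have hsub : ∀ {r}, r ∈ Icc 0 S → uIcc 0 r ⊆ uIcc 0 S := fun hr => by
    rw [uIcc_of_le hr.1, uIcc_of_le hS.le]; exact Icc_subset_Icc_right hr.2
  have hsq : ∀ r ∈ Icc 0 S, f r ^ 2 - f 0 ^ 2 = ∫ s in (0 : ℝ)..r, 2 * (f s * h s) := fun r hr =>
    sq_primitive hr.1 (hh.mono_set (hsub hr)) fun s hs => hf s ⟨hs.1, hs.2.trans hr.2⟩
  have hdiff : ∀ s ∈ Icc 0 S, f t ^ 2 - K ≤ f s ^ 2 := by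
    intro s hs
    have h2 := hfh.const_mul 2
    have e : f t ^ 2 - f s ^ 2 = ∫ r in s..t, 2 * (f r * h r) := by
      rw [← intervalIntegral.integral_interval_sub_left (h2.mono_set (hsub ht))
        (h2.mono_set (hsub hs)), ← hsq t ht, ← hsq s hs]; ring
    -- integrating the resulting bound `f t ^ 2 - K ≤ f s ^ 2` over `s` gives the claim
    have hle : |∫ r in s..t, 2 * (f r * h r)| ≤ K := by
      have a1 : |∫ r in s..t, 2 * (f r * h r)| ≤ ∫ r in uIoc s t, |2 * (f r * h r)| := by
        simpa using intervalIntegral.norm_integral_le_integral_norm_uIoc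
          (f := fun r => 2 * (f r * h r)) (a := s) (b := t) (μ := volume)
      have sub : uIoc s t ⊆ Ioc 0 S := by
        intro r hr
        rcases le_total s t with hst | hst
        · rw [uIoc_of_le hst] at hr; exact ⟨hs.1.trans_lt hr.1, hr.2.trans ht.2⟩
        · rw [uIoc_of_ge hst] at hr; exact ⟨ht.1.trans_lt hr.1, hr.2.trans hs.2⟩
      have hKi := (intervalIntegrable_iff_integrableOn_Ioc_of_le hS.le).1 hK
      have h2i := (intervalIntegrable_iff_integrableOn_Ioc_of_le hS.le).1 h2
      calc _ ≤ _ := a1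
        _ ≤ ∫ r in uIoc s t, (w * f r ^ 2 + w⁻¹ * h r ^ 2) :=
          setIntegral_mono_on (h2i.mono_set sub).abs (hKi.mono_set sub) measurableSet_uIoc
            fun r _ => hpt r
        _ ≤ ∫ r in Ioc 0 S, (w * f r ^ 2 + w⁻¹ * h r ^ 2) :=
          setIntegral_mono_set hKi
            (Eventually.of_forall fun r => by positivity) sub.eventuallyLE
        _ = K := by rw [hKdef, intervalIntegral.integral_of_le hS.le]
    have := (abs_le.1 hle).2
    linarith
  have hint : ∫ _s in (0 : ℝ)..S, (f t ^ 2 - K) ≤ ∫ s in (0 : ℝ)..S, f s ^ 2 :=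
    intervalIntegral.integral_mono_on hS.le (by simp) hf2 hdiff
  rw [intervalIntegral.integral_const, sub_zero, smul_eq_mul] at hint
  have : f t ^ 2 - K ≤ S⁻¹ * ∫ s in (0 : ℝ)..S, f s ^ 2 := by
    rw [inv_mul_eq_div, le_div_iff₀ hS]; linarith
  rw [hKe] at this
  linarith

/-- Gronwall's inequality with an integrable coefficient and vanishing initial value. -/
theorem gronwall_zero {E a : ℝ → ℝ} {S : ℝ} (hS : 0 ≤ S) (hE : ContinuousOn E (Icc 0 S))
    (ha : IntervalIntegrable a volume 0 S) (ha0 : ∀ t, 0 ≤ a t)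
    (h : ∀ t ∈ Icc 0 S, E t ≤ ∫ s in (0 : ℝ)..t, a s * E s) : ∀ t ∈ Icc 0 S, E t ≤ 0 := by
  intro t ht
  have hsub : uIcc 0 t ⊆ uIcc 0 S := by
    rw [uIcc_of_le ht.1, uIcc_of_le hS]; exact Icc_subset_Icc_right ht.2
  have hat := ha.mono_set hsub
  have haE : IntervalIntegrable (fun s => a s * E s) volume 0 t := by
    refine hat.mul_continuousOn (hE.mono ?_)
    rw [uIcc_of_le ht.1]; exact Icc_subset_Icc_right ht.2
  have ac1 := hat.absolutelyContinuousOnInterval_intervalIntegral (c := 0) (by simp)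
  have ac2 := haE.absolutelyContinuousOnInterval_intervalIntegral (c := 0) (by simp)
  -- `exp (-∫₀ˢ a) * ∫₀ˢ a E` vanishes at `0` and has a nonpositive derivative
  have ac3 := ac_comp_contDiff (G := fun y => Real.exp (-y)) (by fun_prop) ac1
  have key := (ac3.fun_mul ac2).integral_deriv_eq_sub
  simp only [intervalIntegral.integral_same, mul_zero, sub_zero] at key
  have hneg : ∫ s in (0 : ℝ)..t, deriv (fun s => Real.exp (-∫ r in (0 : ℝ)..s, a r) *
      ∫ r in (0 : ℝ)..s, a r * E r) s ≤ 0 := by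
    rw [intervalIntegral.integral_of_le ht.1]
    apply integral_nonpos_of_ae
    rw [EventuallyLE, ae_restrict_iff' measurableSet_Ioc]
    filter_upwards [hat.ae_hasDerivAt_integral, haE.ae_hasDerivAt_integral] with s h1 h2 hs
    have hs' : s ∈ uIcc 0 t := by rw [uIcc_of_le ht.1]; exact ⟨hs.1.le, hs.2⟩
    have d1 := (h1 hs' 0 (by simp)).neg.exp
    have d2 := h2 hs' 0 (by simp)
    have d3 := d1.mul d2
    simp only [Pi.mul_def, Pi.neg_apply] at d3
    rw [d3.deriv]
    have := h s ⟨hs.1.le, hs.2.trans ht.2⟩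
    have h3 := mul_le_mul_of_nonneg_left this (ha0 s)
    have h4 := Real.exp_pos (-∫ r in (0 : ℝ)..s, a r)
    simp only [Pi.zero_apply]
    nlinarith
  rw [key] at hneg
  have := h t ht
  have h4 := Real.exp_pos (-∫ r in (0 : ℝ)..t, a r)
  by_contra hcon
  push Not at hcon
  have : 0 < ∫ r in (0 : ℝ)..t, a r * E r := by linarith
  nlinarith [mul_pos h4 this]

/-- The du Bois-Reymond lemma: a function whose weak derivative is integrable is, up to a null set,
a primitive of it. -/
theorem exists_primitive_of_weak_deriv {a a' : ℝ → ℝ} {S : ℝ} (hS : 0 < S)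
    (ha : IntegrableOn a (Ioo 0 S)) (ha' : IntegrableOn a' (Ioo 0 S))
    (h : ∀ φ : ℝ → ℝ, ContDiff ℝ (⊤ : ℕ∞) φ → HasCompactSupport φ → tsupport φ ⊆ Ioo 0 S →
      ∫ t in Ioo 0 S, a t * deriv φ t = -∫ t in Ioo 0 S, a' t * φ t) :
    ∃ c, ∀ᵐ t ∂volume.restrict (Ioo 0 S), a t = c + ∫ s in (0 : ℝ)..t, a' s := by
  have ha'I : IntervalIntegrable a' volume 0 S :=
    (intervalIntegrable_iff_integrableOn_Ioo_of_le hS.le).2 ha'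
  set w : ℝ → ℝ := fun t => ∫ s in (0 : ℝ)..t, a' s with hw
  have hac := ha'I.absolutelyContinuousOnInterval_intervalIntegral (c := 0) (by simp)
  have hwc : ContinuousOn w (Icc 0 S) := by
    have := hac.continuousOn; rwa [uIcc_of_le hS.le] at this
  have hwi : IntegrableOn w (Ioo 0 S) :=
    (hwc.integrableOn_compact isCompact_Icc).mono_set Ioo_subset_Icc_self
  have hdi : IntegrableOn (fun t => a t - w t) (Ioo 0 S) := ha.sub hwi
  have hmulC : ∀ {g ψ : ℝ → ℝ}, IntegrableOn g (Ioo 0 S) → Continuous ψ → HasCompactSupport ψ →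
      IntegrableOn (fun t => g t * ψ t) (Ioo 0 S) := by
    intro g ψ hg hψ hψc
    obtain ⟨C, hC⟩ := hψ.bounded_above_of_compact_support hψc
    exact hg.mul_bdd hψ.aestronglyMeasurable (Eventually.of_forall hC)
  -- the difference has vanishing weak derivative
  have hd : ∀ φ : ℝ → ℝ, ContDiff ℝ (⊤ : ℕ∞) φ → HasCompactSupport φ → tsupport φ ⊆ Ioo 0 S →
      ∫ t in Ioo 0 S, (a t - w t) * deriv φ t = 0 := by
    intro φ hφ hφc hφs
    have hφ1 : Continuous (deriv φ) := hφ.continuous_deriv (by simp)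
    have hφ0 : ∀ t, t ∉ Ioo 0 S → φ t = 0 := fun t ht =>
      image_eq_zero_of_notMem_tsupport fun h => ht (hφs h)
    have hφac : AbsolutelyContinuousOnInterval φ 0 S :=
      ContDiffOn.absolutelyContinuousOnInterval (hφ.contDiffOn.of_le (by simp))
    have ibp := hac.integral_mul_deriv_eq_deriv_mul hφac
    rw [hφ0 S (by simp), hφ0 0 (by simp)] at ibp
    have e2 : ∫ x in (0 : ℝ)..S, deriv (fun t => ∫ s in (0 : ℝ)..t, a' s) x * φ x =
        ∫ x in (0 : ℝ)..S, a' x * φ x := by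
      apply intervalIntegral.integral_congr_ae
      filter_upwards [ha'I.ae_hasDerivAt_integral] with s h1 hs
      rw [uIoc_of_le hS.le] at hs
      rw [(h1 (by rw [uIcc_of_le hS.le]; exact ⟨hs.1.le, hs.2⟩) 0 (by simp)).deriv]
    rw [e2] at ibp
    simp only [mul_zero, sub_self, zero_sub] at ibp
    rw [intervalIntegral.integral_of_le hS.le, intervalIntegral.integral_of_le hS.le,
      integral_Ioc_eq_integral_Ioo, integral_Ioc_eq_integral_Ioo, ← h φ hφ hφc hφs] at ibp
    simp_rw [sub_mul]
    rw [integral_sub (hmulC ha hφ1 hφc.deriv) (hmulC hwi hφ1 hφc.deriv), sub_eq_zero]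
    exact ibp.symm
  -- a bump function of integral one
  let B : ContDiffBump (S / 2) := ⟨S / 8, S / 4, by positivity, by linarith⟩
  set θ : ℝ → ℝ := B.normed volume with hθ
  have hθc : ContDiff ℝ (⊤ : ℕ∞) θ := B.contDiff_normed
  have hθs : HasCompactSupport θ := B.hasCompactSupport_normed
  have hθ1 : ∫ t, θ t = 1 := B.integral_normed
  have hθt : tsupport θ ⊆ Ioo 0 S := by
    rw [hθ, B.tsupport_normed_eq]
    intro t ht
    rw [Metric.mem_closedBall, Real.dist_eq, abs_le] at ht
    change -(S / 4) ≤ t - S / 2 ∧ t - S / 2 ≤ S / 4 at ht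
    constructor <;> linarith [ht.1, ht.2]
  set c := ∫ t in Ioo 0 S, (a t - w t) * θ t with hc
  refine ⟨c, ?_⟩
  have hcI : IntegrableOn (fun _ : ℝ => c) (Ioo 0 S) := by simp
  have hmain : ∀ᵐ t ∂volume, t ∈ Ioo 0 S → a t - w t - c = 0 := by
    apply isOpen_Ioo.ae_eq_zero_of_integral_contDiff_smul_eq_zero
    · exact (hdi.sub hcI).locallyIntegrableOn
    intro ψ hψ hψc hψs
    -- `ψ - I θ` has mean zero, so that its primitive `φ` is a test function
    set I := ∫ t, ψ t with hI
    have hgc : ContDiff ℝ (⊤ : ℕ∞) (fun t => ψ t - I * θ t) :=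
      hψ.sub (contDiff_const.mul hθc)
    have hgcont := hgc.continuous
    have hψi : Integrable ψ := hψ.continuous.integrable_of_hasCompactSupport hψc
    have hθi : Integrable θ := hθc.continuous.integrable_of_hasCompactSupport hθs
    set φ : ℝ → ℝ := fun t => ∫ s in (0 : ℝ)..t, (ψ s - I * θ s) with hφdef
    have hφd : ∀ t, HasDerivAt φ (ψ t - I * θ t) t := fun t =>
      intervalIntegral.integral_hasDerivAt_right (hgcont.intervalIntegrable _ _)
        (hgcont.stronglyMeasurableAtFilter _ _) hgcont.continuousAt
    have hφ' : deriv φ = fun t => ψ t - I * θ t := funext fun t => (hφd t).deriv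
    have hφcd : ContDiff ℝ (⊤ : ℕ∞) φ := by
      rw [contDiff_infty_iff_deriv]
      exact ⟨fun t => (hφd t).differentiableAt, by rw [hφ']; exact hgc⟩
    -- a compact interval containing both supports
    obtain ⟨α, β, hα, hβ, hαβ⟩ : ∃ α β : ℝ, 0 < α ∧ β < S ∧
        tsupport ψ ∪ tsupport θ ⊆ Icc α β := by
      have hK : IsCompact (tsupport ψ ∪ tsupport θ) := hψc.isCompact.union hθs.isCompact
      have hKs : tsupport ψ ∪ tsupport θ ⊆ Ioo 0 S := union_subset hψs hθt
      have hne : (tsupport ψ ∪ tsupport θ).Nonempty := by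
        refine Nonempty.inr ?_
        by_contra hcon
        rw [not_nonempty_iff_eq_empty, tsupport_eq_empty_iff] at hcon
        rw [hcon] at hθ1
        simp at hθ1
      have h1 := hK.sInf_mem hne
      have h2 := hK.sSup_mem hne
      exact ⟨_, _, (hKs h1).1, (hKs h2).2, fun x hx =>
        ⟨csInf_le hK.bddBelow hx, le_csSup hK.bddAbove hx⟩⟩
    have hg0 : ∀ s, s ∉ Icc α β → ψ s - I * θ s = 0 := by
      intro s hs
      rw [image_eq_zero_of_notMem_tsupport fun h => hs (hαβ (Or.inl h)),
        image_eq_zero_of_notMem_tsupport fun h => hs (hαβ (Or.inr h))]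
      simp
    have htot : ∫ s, (ψ s - I * θ s) = 0 := by
      rw [integral_sub hψi (hθi.const_mul I), integral_const_mul, hθ1]; simp [hI]
    have hφ0 : ∀ t, t ∉ Icc α β → φ t = 0 := by
      intro t ht
      rcases lt_or_ge t α with h1 | h1
      · rw [hφdef]
        apply intervalIntegral.integral_zero_ae
        refine Eventually.of_forall fun s hs => hg0 s fun hs' => ?_
        have : s ≤ max 0 t := hs.2
        rcases le_max_iff.1 this with h2 | h2 <;> linarith [hs'.1]
      · have h2 : β < t := by
          by_contra hcon; exact ht ⟨h1, not_lt.1 hcon⟩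
        have h0t : 0 ≤ t := by linarith
        rw [hφdef]
        simp only
        rw [intervalIntegral.integral_of_le h0t, setIntegral_eq_integral_of_forall_compl_eq_zero]
        · exact htot
        · intro s hs
          refine hg0 s fun hs' => hs ⟨by linarith [hs'.1], by linarith [hs'.2]⟩
    have hφs : tsupport φ ⊆ Icc α β := by
      refine closure_minimal (fun t ht => ?_) isClosed_Icc
      by_contra hcon
      exact ht (hφ0 t hcon)
    have hφc : HasCompactSupport φ := isCompact_Icc.of_isClosed_subset (isClosed_tsupport φ) hφs
    have hz := hd φ hφcd hφc fun t ht => ⟨by linarith [(hφs ht).1], by linarith [(hφs ht).2]⟩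
    rw [hφ'] at hz
    simp_rw [mul_sub] at hz
    have e3 : ∀ t, (a t - w t) * (I * θ t) = I * ((a t - w t) * θ t) := fun t => by ring
    simp_rw [e3] at hz
    rw [integral_sub (hmulC hdi hψ.continuous hψc)
      ((hmulC hdi hθc.continuous hθs).const_mul I), integral_const_mul, ← hc] at hz
    have hψI : ∫ t in Ioo 0 S, ψ t = I :=
      setIntegral_eq_integral_of_forall_compl_eq_zero fun t ht =>
        image_eq_zero_of_notMem_tsupport fun h => ht (hψs h)
    have e4 : ∫ t, ψ t • (a t - w t - c) = ∫ t in Ioo 0 S, ((a t - w t) * ψ t - c * ψ t) := by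
      rw [setIntegral_eq_integral_of_forall_compl_eq_zero]
      · congr 1; ext t; simp only [smul_eq_mul]; ring
      · intro t ht
        rw [image_eq_zero_of_notMem_tsupport fun h => ht (hψs h)]; simp
    rw [e4, integral_sub (hmulC hdi hψ.continuous hψc) (hψi.integrableOn.const_mul c),
      integral_const_mul, hψI]
    linarith
  rw [ae_restrict_iff' measurableSet_Ioo]
  filter_upwards [hmain] with t ht hts
  have := ht hts
  change a t = c + w t
  linarith

end

section

/-! ### Fourier series on the box -/

/- The circle carries its normalized Haar measure, for which the Fourier theory of `UnitAddTorus` is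
developed, instead of the measure induced from the real line. -/
local instance instMeasureSpaceCircle : MeasureSpace UnitAddCircle := ⟨AddCircle.haarAddCircle⟩

local instance instIsAddHaarCircle : Measure.IsAddHaarMeasure (volume : Measure UnitAddCircle) :=
  inferInstanceAs (Measure.IsAddHaarMeasure AddCircle.haarAddCircle)

local instance instIsProbabilityCircle : IsProbabilityMeasure (volume : Measure UnitAddCircle) :=
  inferInstanceAs (IsProbabilityMeasure AddCircle.haarAddCircle)

/-- The volume of the box. -/
def boxVol (L : Space) : ℝ := ∏ i, L i

/-- The projection of space onto the unit torus that maps the box onto a fundamental cell. -/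
def toTorus (L : Space) (x : Space) : UnitAddTorus (Fin 3) := fun i => ((x i / L i : ℝ) : UnitAddCircle)

/-- The section of `toTorus` with values in `∏ (0, L i]`. -/
def ofTorus (L : Space) (y : UnitAddTorus (Fin 3)) : Space :=
  fun i => L i * (AddCircle.equivIoc 1 0 (y i)).1

variable {L : Space}

theorem boxVol_pos (hL : ∀ i, 0 < L i) : 0 < boxVol L := Finset.prod_pos fun i _ => hL i

theorem measurableSet_box : MeasurableSet (box L) := MeasurableSet.univ_pi fun _ => measurableSet_Ioo

theorem isOpen_box : IsOpen (box L) := isOpen_set_pi finite_univ fun _ _ => isOpen_Ioo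

theorem volume_box : volume (box L) = ∏ i, ENNReal.ofReal (L i) := by
  rw [box, Real.volume_pi_Ioo]; simp

theorem volume_box_lt_top : volume (box L) < ⊤ := by
  rw [volume_box]; exact ENNReal.prod_lt_top fun _ _ => ENNReal.ofReal_lt_top

instance : IsFiniteMeasure (volume.restrict (box L)) := ⟨by simpa using volume_box_lt_top⟩

theorem measurable_toTorus : Measurable (toTorus L) :=
  measurable_pi_lambda _ fun i =>
    AddCircle.measurable_mk'.comp ((measurable_pi_apply i).div_const _)

theorem measurable_ofTorus : Measurable (ofTorus L) :=
  measurable_pi_lambda _ fun i =>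
    (measurable_subtype_coe.comp ((AddCircle.measurableEquivIoc 1 0).measurable.comp
      (measurable_pi_apply i))).const_mul _

theorem toTorus_ofTorus (hL : ∀ i, 0 < L i) (y : UnitAddTorus (Fin 3)) :
    toTorus L (ofTorus L y) = y := by
  ext i
  rw [toTorus, ofTorus, mul_div_cancel_left₀ _ (hL i).ne', AddCircle.coe_equivIoc]

theorem ofTorus_toTorus (hL : ∀ i, 0 < L i) {x : Space} (hx : x ∈ box L) :
    ofTorus L (toTorus L x) = x := by
  ext i
  have h := hx i (mem_univ i)
  have h1 : x i / L i ∈ Ioc (0 : ℝ) (0 + 1) := by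
    rw [zero_add]
    exact ⟨div_pos h.1 (hL i), (div_le_one (hL i)).2 h.2.le⟩
  rw [ofTorus, toTorus, AddCircle.equivIoc_coe_of_mem h1, mul_div_cancel₀ _ (hL i).ne']

theorem map_circle {l : ℝ} (hl : 0 < l) :
    Measure.map (fun x : ℝ => ((x / l : ℝ) : UnitAddCircle)) (volume.restrict (Ioo 0 l)) =
      ENNReal.ofReal l • (volume : Measure UnitAddCircle) := by
  have h1 : Measure.map (fun x : ℝ => x / l) (volume.restrict (Ioo 0 l)) =
      ENNReal.ofReal l • volume.restrict (Ioo 0 1) := by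
    have e : Ioo 0 l = (fun x : ℝ => x / l) ⁻¹' Ioo 0 1 := by
      ext x; simp only [mem_Ioo, mem_preimage, div_lt_one hl]
      exact ⟨fun h => ⟨div_pos h.1 hl, h.2⟩, fun h => ⟨by
        have := mul_pos h.1 hl; rwa [div_mul_cancel₀ _ hl.ne'] at this, h.2⟩⟩
    rw [e, ← Measure.restrict_map (by fun_prop) measurableSet_Ioo, ← Measure.restrict_smul]
    congr 1
    have := Real.map_volume_mul_right (a := l⁻¹) (by positivity)
    simp only [inv_inv, abs_of_pos hl] at this
    simpa [div_eq_mul_inv] using this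
  have h2 : Measure.map ((↑) : ℝ → UnitAddCircle) (volume.restrict (Ioo 0 1)) =
      (volume : Measure UnitAddCircle) := by
    have := (UnitAddCircle.measurePreserving_mk 0).map_eq
    rw [zero_add, ← restrict_Ioo_eq_restrict_Ioc] at this
    rw [this, AddCircle.volume_eq_smul_haarAddCircle]
    simp [volume]
  have h3 : (fun x : ℝ => ((x / l : ℝ) : UnitAddCircle)) =
      ((↑) : ℝ → UnitAddCircle) ∘ fun x : ℝ => x / l := rfl
  rw [h3, ← Measure.map_map AddCircle.measurable_mk' (by fun_prop), h1, Measure.map_smul, h2]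

/-- `toTorus` maps Lebesgue measure on the box to a multiple of Haar measure on the torus, which
transfers integrals and Fourier series from the torus to the box. -/
theorem map_toTorus (hL : ∀ i, 0 < L i) :
    Measure.map (toTorus L) (volume.restrict (box L)) =
      ENNReal.ofReal (boxVol L) • (volume : Measure (UnitAddTorus (Fin 3))) := by
  have hm : ∀ i, Measurable fun x : ℝ => ((x / L i : ℝ) : UnitAddCircle) := fun i =>
    AddCircle.measurable_mk'.comp (by fun_prop)
  have h0 : (volume : Measure Space).restrict (box L) =
      Measure.pi fun i => volume.restrict (Ioo 0 (L i)) := by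
    rw [volume_pi, box, Measure.restrict_pi_pi]
  have h1 : Measure.map (toTorus L) (volume.restrict (box L)) =
      Measure.pi fun i => ENNReal.ofReal (L i) • (volume : Measure UnitAddCircle) := by
    rw [h0]
    have hs : ∀ i, SigmaFinite (Measure.map (fun x : ℝ => ((x / L i : ℝ) : UnitAddCircle))
        (volume.restrict (Ioo 0 (L i)))) := fun i => by
      rw [map_circle (hL i)]
      exact Measure.smul_finite _ ENNReal.ofReal_ne_top |>.toSigmaFinite
    have := Measure.pi_map_pi (μ := fun i => volume.restrict (Ioo 0 (L i)))
      (f := fun i (x : ℝ) => ((x / L i : ℝ) : UnitAddCircle)) fun i => (hm i).aemeasurable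
    change Measure.map (fun (x : Space) i => ((x i / L i : ℝ) : UnitAddCircle)) _ = _
    rw [this]
    simp_rw [map_circle (hL _)]
  rw [h1]
  have hfin : ∀ i, IsFiniteMeasure (ENNReal.ofReal (L i) • (volume : Measure UnitAddCircle)) :=
    fun i => Measure.smul_finite _ ENNReal.ofReal_ne_top
  refine Measure.pi_eq fun s hs => ?_
  simp only [Measure.smul_apply, smul_eq_mul]
  rw [volume_pi, Measure.pi_pi, Finset.prod_mul_distrib, boxVol,
    ENNReal.ofReal_prod_of_nonneg fun i _ => (hL i).le]

theorem ae_box_of_ae_torus (hL : ∀ i, 0 < L i) {p : UnitAddTorus (Fin 3) → Prop}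
    (h : ∀ᵐ y, p y) : ∀ᵐ x ∂volume.restrict (box L), p (toTorus L x) := by
  refine ae_of_ae_map measurable_toTorus.aemeasurable ?_
  rw [map_toTorus hL]
  exact Measure.ae_smul_measure h _

theorem map_ofTorus (hL : ∀ i, 0 < L i) :
    Measure.map (ofTorus L) (ENNReal.ofReal (boxVol L) • (volume : Measure (UnitAddTorus (Fin 3)))) =
      volume.restrict (box L) := by
  rw [← map_toTorus hL, Measure.map_map measurable_ofTorus measurable_toTorus]
  have : ofTorus L ∘ toTorus L =ᵐ[volume.restrict (box L)] id := by
    filter_upwards [ae_restrict_mem measurableSet_box] with x hx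
    exact ofTorus_toTorus hL hx
  rw [Measure.map_congr this, Measure.map_id]

theorem integral_ofTorus {E : Type*} [NormedAddCommGroup E] [NormedSpace ℝ E]
    (hL : ∀ i, 0 < L i) {h : Space → E} (hh : AEStronglyMeasurable h (volume.restrict (box L))) :
    ∫ y, h (ofTorus L y) = (boxVol L)⁻¹ • ∫ x in box L, h x := by
  have h1 := hh
  rw [← map_ofTorus hL] at h1 ⊢
  rw [integral_map measurable_ofTorus.aemeasurable h1, integral_smul_measure, smul_smul,
    ENNReal.toReal_ofReal (boxVol_pos hL).le, inv_mul_cancel₀ (boxVol_pos hL).ne', one_smul]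

theorem memLp_ofTorus {E : Type*} [NormedAddCommGroup E]
    (hL : ∀ i, 0 < L i) {h : Space → E} (hh : MemLp h 2 (volume.restrict (box L))) :
    MemLp (fun y => h (ofTorus L y)) 2 := by
  rw [← map_ofTorus hL] at hh
  have h2 := hh.comp_of_map measurable_ofTorus.aemeasurable
  have hc : ENNReal.ofReal (boxVol L) ≠ 0 := by simpa using boxVol_pos hL
  have h3 := h2.smul_measure (ENNReal.inv_ne_top.2 hc)
  rwa [smul_smul, ENNReal.inv_mul_cancel hc ENNReal.ofReal_ne_top, one_smul] at h3

/-- The phase `2 π ∑ kᵢ xᵢ / Lᵢ` of the `k`-th character of the lattice, as a linear map. -/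
def phase (L : Space) (k : Fin 3 → ℤ) : Space →L[ℝ] ℝ :=
  ∑ i, (2 * Real.pi * (k i : ℝ) / L i) • ContinuousLinearMap.proj (R := ℝ) i

/-- The `k`-th character of the lattice of periods. -/
def char (L : Space) (k : Fin 3 → ℤ) (x : Space) : ℂ := Complex.exp (phase L k x * Complex.I)

theorem char_eq_mFourier (k : Fin 3 → ℤ) (x : Space) :
    char L k x = UnitAddTorus.mFourier k (toTorus L x) := by
  simp only [char, phase, UnitAddTorus.mFourier, ContinuousMap.coe_mk, toTorus, fourier_coe_apply]
  rw [← Complex.exp_sum]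
  congr 1
  simp only [sum_apply, smul_apply,
    ContinuousLinearMap.proj_apply, smul_eq_mul]
  push_cast
  rw [Finset.sum_mul]
  refine Finset.sum_congr rfl fun i _ => ?_
  ring

theorem norm_char (k : Fin 3 → ℤ) (x : Space) : ‖char L k x‖ = 1 := Complex.norm_exp_ofReal_mul_I _

theorem contDiff_char (k : Fin 3 → ℤ) : ContDiff ℝ (⊤ : ℕ∞) (char L k) := by
  unfold char
  have h1 : ContDiff ℝ (⊤ : ℕ∞) fun x => ((phase L k x : ℝ) : ℂ) :=
    Complex.ofRealCLM.contDiff.comp (phase L k).contDiff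
  exact (h1.mul contDiff_const).cexp

theorem continuous_char (k : Fin 3 → ℤ) : Continuous (char L k) := (contDiff_char k).continuous

/-- The `k`-th Fourier coefficient of a function on the box. -/
def coeff (L : Space) (f : Space → ℝ) (k : Fin 3 → ℤ) : ℂ :=
  (boxVol L)⁻¹ • ∫ x in box L, char L (-k) x * (f x : ℂ)

theorem mFourierCoeff_ofTorus (hL : ∀ i, 0 < L i) {f : Space → ℝ}
    (hf : MemLp f 2 (volume.restrict (box L))) (k : Fin 3 → ℤ) :
    UnitAddTorus.mFourierCoeff (fun y => (f (ofTorus L y) : ℂ)) k = coeff L f k := by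
  have h1 : AEStronglyMeasurable (fun x => char L (-k) x * (f x : ℂ)) (volume.restrict (box L)) :=
    (continuous_char _).aestronglyMeasurable.mul
      (Complex.continuous_ofReal.comp_aestronglyMeasurable hf.1)
  rw [coeff, ← integral_ofTorus hL h1, UnitAddTorus.mFourierCoeff]
  refine integral_congr_ae (Eventually.of_forall fun y => ?_)
  simp only [smul_eq_mul]
  rw [char_eq_mFourier, toTorus_ofTorus hL]

/-- Parseval's identity. -/
theorem hasSum_sq_coeff (hL : ∀ i, 0 < L i) {f : Space → ℝ}
    (hf : MemLp f 2 (volume.restrict (box L))) :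
    HasSum (fun k => ‖coeff L f k‖ ^ 2) ((boxVol L)⁻¹ * ∫ x in box L, f x ^ 2) := by
  have h1 : MemLp (fun y => (f (ofTorus L y) : ℂ)) 2 := (memLp_ofTorus hL hf).ofReal
  have h2 := UnitAddTorus.hasSum_sq_mFourierCoeff (h1.toLp _)
  have h3 : ∀ k, UnitAddTorus.mFourierCoeff (h1.toLp _) k = coeff L f k := fun k => by
    rw [← mFourierCoeff_ofTorus hL hf]
    refine integral_congr_ae ?_
    filter_upwards [h1.coeFn_toLp] with y hy
    rw [hy]
  simp_rw [h3] at h2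
  convert h2 using 1
  have h4 : ∫ y, ‖(h1.toLp _ : UnitAddTorus (Fin 3) → ℂ) y‖ ^ 2 = ∫ y, f (ofTorus L y) ^ 2 := by
    refine integral_congr_ae ?_
    filter_upwards [h1.coeFn_toLp] with y hy
    rw [hy]; simp
  rw [h4, integral_ofTorus hL (h := fun x => f x ^ 2) (hf.1.pow 2), smul_eq_mul]

/-- A square integrable function with absolutely summable Fourier coefficients is the sum of its
Fourier series. -/
theorem ae_eq_tsum_coeff (hL : ∀ i, 0 < L i) {f : Space → ℝ}
    (hf : MemLp f 2 (volume.restrict (box L))) (hs : Summable fun k => ‖coeff L f k‖) :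
    ∀ᵐ x ∂volume.restrict (box L), (f x : ℂ) = ∑' k, coeff L f k * char L k x := by
  have h1 : MemLp (fun y => (f (ofTorus L y) : ℂ)) 2 := (memLp_ofTorus hL hf).ofReal
  have h2 := UnitAddTorus.hasSum_mFourier_series_L2 (h1.toLp _)
  have h3 : ∀ k, UnitAddTorus.mFourierCoeff (h1.toLp _) k = coeff L f k := fun k => by
    rw [← mFourierCoeff_ofTorus hL hf]
    refine integral_congr_ae ?_
    filter_upwards [h1.coeFn_toLp] with y hy
    rw [hy]
  simp_rw [h3] at h2
  have hs' : Summable fun k => coeff L f k • (UnitAddTorus.mFourier k : C(UnitAddTorus (Fin 3), ℂ)) := by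
    refine .of_norm ?_
    simpa only [norm_smul, UnitAddTorus.mFourier_norm, mul_one] using hs
  have h4 := hs'.hasSum.mapL (ContinuousMap.toLp (E := ℂ) 2 (volume : Measure (UnitAddTorus (Fin 3))) ℂ)
  simp only [map_smul] at h4
  have h5 := h2.unique h4
  have h6 : ∀ᵐ y : UnitAddTorus (Fin 3), (f (ofTorus L y) : ℂ) =
      ∑' k, coeff L f k * UnitAddTorus.mFourier k y := by
    filter_upwards [h1.coeFn_toLp, ContinuousMap.coeFn_toLp (p := 2) (𝕜 := ℂ) volume
      (∑' k, coeff L f k • (UnitAddTorus.mFourier k : C(UnitAddTorus (Fin 3), ℂ)))] with y hy1 hy2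
    rw [← hy1, h5, hy2]
    exact (ContinuousMap.tsum_apply hs' y).symm
  filter_upwards [ae_box_of_ae_torus hL h6, ae_restrict_mem measurableSet_box] with x hx hxb
  rw [ofTorus_toTorus hL hxb] at hx
  rw [hx]
  simp_rw [char_eq_mFourier]

theorem ae_eq_zero_of_coeff (hL : ∀ i, 0 < L i) {f : Space → ℝ}
    (hf : MemLp f 2 (volume.restrict (box L))) (h0 : ∀ k, coeff L f k = 0) :
    ∀ᵐ x ∂volume.restrict (box L), f x = 0 := by
  filter_upwards [ae_eq_tsum_coeff hL hf (by simp [h0, summable_zero])] with x hx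
  simpa [h0] using hx

end

section

variable {L : Space}

/-! ### Weak partial derivatives -/

theorem partialDeriv_eq_zero_of_notMem {φ : Space → ℝ} {i : Fin 3} {x : Space}
    (hx : x ∉ tsupport φ) : partialDeriv i φ x = 0 := by
  have : fderiv ℝ φ x = 0 := by
    by_contra h
    exact hx (support_fderiv_subset ℝ h)
  simp [partialDeriv, this]

theorem continuous_partialDeriv {φ : Space → ℝ} (i : Fin 3) (hφ : ContDiff ℝ 1 φ) :
    Continuous (partialDeriv i φ) :=
  (hφ.continuous_fderiv (by simp)).clm_apply continuous_const

theorem hasCompactSupport_partialDeriv {φ : Space → ℝ} (i : Fin 3) (hφ : HasCompactSupport φ) :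
    HasCompactSupport (partialDeriv i φ) :=
  HasCompactSupport.intro hφ fun _ hx => partialDeriv_eq_zero_of_notMem hx

theorem integrable_mul_of_compactSupport {f φ : Space → ℝ} (hf : LocallyIntegrable f)
    (hφ : Continuous φ) (hc : HasCompactSupport φ) : Integrable fun x => f x * φ x := by
  simpa [mul_comm] using hf.integrable_smul_left_of_hasCompactSupport hφ hc

/-- A continuously differentiable function has its classical derivatives as weak derivatives. -/
theorem hasWeakPartial_of_contDiff {f : Space → ℝ} (i : Fin 3) (hf : ContDiff ℝ 1 f) :
    HasWeakPartial univ i f (partialDeriv i f) := by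
  have hf1 := continuous_partialDeriv i hf
  refine ⟨hf.continuous.locallyIntegrable.locallyIntegrableOn _,
    hf1.locallyIntegrable.locallyIntegrableOn _, fun φ hφ hc _ => ?_⟩
  rw [setIntegral_univ, setIntegral_univ]
  have hφ1 := hφ.of_le (m := 1) (by simp)
  exact integral_mul_fderiv_eq_neg_fderiv_mul_of_integrable
    (integrable_mul_of_compactSupport hf1.locallyIntegrable hφ.continuous hc)
    (integrable_mul_of_compactSupport hf.continuous.locallyIntegrable
      (continuous_partialDeriv i hφ1) (hasCompactSupport_partialDeriv i hc))
    (integrable_mul_of_compactSupport hf.continuous.locallyIntegrable hφ.continuous hc)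
    (fun x _ => hf.differentiable (by simp) x) fun x _ => hφ1.differentiable (by simp) x

theorem HasWeakPartial.ae_eq {f g g' : Space → ℝ} {i : Fin 3} (h : HasWeakPartial univ i f g)
    (h' : HasWeakPartial univ i f g') : g =ᵐ[volume] g' := by
  have hg := locallyIntegrableOn_univ.1 h.2.1
  have hg' := locallyIntegrableOn_univ.1 h'.2.1
  refine ae_eq_of_integral_contDiff_smul_eq hg hg' fun φ hφ hc => ?_
  have e1 := h.2.2 φ hφ hc (subset_univ _)
  have e2 := h'.2.2 φ hφ hc (subset_univ _)
  rw [e1] at e2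
  simp only [setIntegral_univ, neg_inj] at e2
  simpa [mul_comm] using e2

theorem HasWeakPartial.congr {f f' g g' : Space → ℝ} {i : Fin 3} (h : HasWeakPartial univ i f g)
    (hf : f =ᵐ[volume] f') (hg : g =ᵐ[volume] g') : HasWeakPartial univ i f' g' := by
  obtain ⟨h1, h2, h3⟩ := h
  rw [locallyIntegrableOn_univ] at h1 h2
  refine ⟨(h1.congr hf).locallyIntegrableOn _, (h2.congr hg).locallyIntegrableOn _,
    fun φ hφ hc hs => ?_⟩
  have e := h3 φ hφ hc hs
  simp only [setIntegral_univ] at e ⊢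
  have e1 : ∫ x, f x * partialDeriv i φ x = ∫ x, f' x * partialDeriv i φ x :=
    integral_congr_ae (hf.mono fun x hx => by simp only [hx])
  have e2 : ∫ x, g x * φ x = ∫ x, g' x * φ x :=
    integral_congr_ae (hg.mono fun x hx => by simp only [hx])
  rw [← e1, ← e2, e]

theorem weakPartial_ae_eq {f g : Space → ℝ} {i : Fin 3} (h : HasWeakPartial univ i f g) :
    weakPartial i f =ᵐ[volume] g := by
  have hex : ∃ g, HasWeakPartial univ i f g := ⟨g, h⟩
  rw [weakPartial, dif_pos hex]
  exact (Classical.choose_spec hex).ae_eq h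

theorem partialDeriv_mul {f g : Space → ℝ} {i : Fin 3} {x : Space} (hf : DifferentiableAt ℝ f x)
    (hg : DifferentiableAt ℝ g x) :
    partialDeriv i (fun y => f y * g y) x = partialDeriv i f x * g x + f x * partialDeriv i g x := by
  rw [partialDeriv, fderiv_fun_mul hf hg]
  simp [partialDeriv]
  ring

/-- The product rule for a weakly differentiable function and a smooth one. -/
theorem HasWeakPartial.mul_contDiff {f g s : Space → ℝ} {i : Fin 3}
    (h : HasWeakPartial univ i f g) (hs : ContDiff ℝ (⊤ : ℕ∞) s) :
    HasWeakPartial univ i (fun x => f x * s x) fun x => g x * s x + f x * partialDeriv i s x := by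
  obtain ⟨h1, h2, h3⟩ := h
  rw [locallyIntegrableOn_univ] at h1 h2
  have hs1 := continuous_partialDeriv i (hs.of_le (m := 1) (by simp))
  have mulC : ∀ {u v : Space → ℝ}, LocallyIntegrable u → Continuous v →
      LocallyIntegrable fun x => u x * v x := by
    intro u v hu hv
    rw [← locallyIntegrableOn_univ] at hu ⊢
    exact hu.mul_continuousOn hv.continuousOn isOpen_univ.isLocallyClosed
  refine ⟨(mulC h1 hs.continuous).locallyIntegrableOn _,
    ((mulC h2 hs.continuous).add (mulC h1 hs1)).locallyIntegrableOn _, fun φ hφ hc _ => ?_⟩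
  have hsφ : HasCompactSupport fun x => s x * φ x := hc.mul_left
  have e := h3 (fun x => s x * φ x) (hs.mul hφ) hsφ (subset_univ _)
  simp only [setIntegral_univ] at e ⊢
  have hφ1 := continuous_partialDeriv i (hφ.of_le (m := 1) (by simp))
  have ha : Integrable fun x => f x * (s x * partialDeriv i φ x) :=
    integrable_mul_of_compactSupport h1 (hs.continuous.mul hφ1)
      (hasCompactSupport_partialDeriv i hc).mul_left
  have hb : Integrable fun x => f x * (partialDeriv i s x * φ x) :=
    integrable_mul_of_compactSupport h1 (hs1.mul hφ.continuous) hc.mul_left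
  have hd : Integrable fun x => g x * (s x * φ x) :=
    integrable_mul_of_compactSupport h2 (hs.continuous.mul hφ.continuous) hsφ
  have e1 : ∫ x, f x * partialDeriv i (fun x => s x * φ x) x =
      (∫ x, f x * (s x * partialDeriv i φ x)) + ∫ x, f x * (partialDeriv i s x * φ x) := by
    rw [← integral_add ha hb]
    congr 1; ext x
    rw [partialDeriv_mul (hs.differentiable (by simp) x) (hφ.differentiable (by simp) x)]
    ring
  have e2 : ∫ x, (g x * s x + f x * partialDeriv i s x) * φ x =
      (∫ x, g x * (s x * φ x)) + ∫ x, f x * (partialDeriv i s x * φ x) := by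
    rw [← integral_add hd hb]
    congr 1; ext x; ring
  have e3 : ∫ x, f x * s x * partialDeriv i φ x = ∫ x, f x * (s x * partialDeriv i φ x) := by
    congr 1; ext x; ring
  rw [e2, e3]
  linarith

/-! ### Periodic functions -/

theorem IsPeriodic.add_lattice {f : Space → ℝ} (hf : IsPeriodic L f) (n : Fin 3 → ℤ) :
    (fun x => f (x + fun i => n i * L i)) =ᵐ[volume] f := by
  have hadd : ∀ {a b : Space}, (fun x => f (x + a)) =ᵐ[volume] f →
      (fun x => f (x + b)) =ᵐ[volume] f → (fun x => f (x + (a + b))) =ᵐ[volume] f := by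
    intro a b ha hb
    have hq := (measurePreserving_add_right (volume : Measure Space) a).quasiMeasurePreserving
    filter_upwards [ha, hq.ae hb] with x h1 h2
    rw [← add_assoc, h2, h1]
  have e : (fun i => (n i : ℝ) * L i) = Pi.single 0 (n 0 * L 0) +
      (Pi.single 1 (n 1 * L 1) + Pi.single 2 (n 2 * L 2)) := by
    ext i; fin_cases i <;> simp
  rw [e]
  exact hadd (hf 0 _) (hadd (hf 1 _) (hf 2 _))

theorem exists_ofTorus_toTorus (hL : ∀ i, 0 < L i) (x : Space) :
    ∃ n : Fin 3 → ℤ, ofTorus L (toTorus L x) = x + fun i => n i * L i := by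
  have h : ∀ i, ∃ n : ℤ, ofTorus L (toTorus L x) i = x i + n * L i := by
    intro i
    set y : ℝ := (AddCircle.equivIoc (1 : ℝ) 0 (toTorus L x i)).1 with hy
    have h1 : ((y : ℝ) : UnitAddCircle) = ((x i / L i : ℝ) : UnitAddCircle) := by
      rw [hy, AddCircle.coe_equivIoc]; rfl
    have h2 : ((y - x i / L i : ℝ) : UnitAddCircle) = 0 := by
      rw [AddCircle.coe_sub, h1, sub_self]
    obtain ⟨n, hn⟩ := (AddCircle.coe_eq_zero_iff (p := (1 : ℝ))).1 h2
    refine ⟨n, ?_⟩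
    have : ofTorus L (toTorus L x) i = L i * y := rfl
    rw [this]
    have hLi := (hL i).ne'
    have hn' : y = x i / L i + n := by simp at hn; linarith
    rw [hn']; field_simp
  choose n hn using h
  exact ⟨n, funext hn⟩

/-- A periodic function is the lift of a function on the torus. -/
theorem IsPeriodic.ae_eq_ofTorus (hL : ∀ i, 0 < L i) {f : Space → ℝ} (hf : IsPeriodic L f) :
    ∀ᵐ x, f (ofTorus L (toTorus L x)) = f x := by
  have h := ae_all_iff.2 fun n : Fin 3 → ℤ => hf.add_lattice n
  filter_upwards [h] with x hx
  obtain ⟨n, hn⟩ := exists_ofTorus_toTorus hL x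
  rw [hn]; exact hx n

/-- An almost everywhere identity of periodic functions on the box holds on the whole space. -/
theorem IsPeriodic.ae_eq_of_box (hL : ∀ i, 0 < L i) {f g : Space → ℝ} (hf : IsPeriodic L f)
    (hg : IsPeriodic L g) (h : f =ᵐ[volume.restrict (box L)] g) : f =ᵐ[volume] g := by
  -- translates of the box by lattice vectors cover the space up to a null set
  have hcover : ∀ n : Fin 3 → ℤ, ∀ᵐ x ∂volume, (x + fun i => (n i : ℝ) * L i) ∈ box L → f x = g x := by
    intro n
    have hq := (measurePreserving_add_right (volume : Measure Space)
      (fun i => (n i : ℝ) * L i)).quasiMeasurePreserving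
    have h3 := (ae_restrict_iff' measurableSet_box).1 h
    filter_upwards [hq.ae h3, hf.add_lattice n, hg.add_lattice n] with x hx h4 h5 hm
    rw [← h4, ← h5]; exact hx hm
  have hnull : ∀ᵐ x : Space, ∀ i, ∀ m : ℤ, x i ≠ m * L i := by
    rw [ae_all_iff]; intro i
    rw [ae_all_iff]; intro m
    exact Measure.ae_eval_ne (μ := fun _ : Fin 3 => (volume : Measure ℝ)) i _
  filter_upwards [ae_all_iff.2 hcover, hnull] with x hx hn
  obtain ⟨n, hn'⟩ := exists_ofTorus_toTorus hL x
  refine hx n fun i _ => ?_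
  have hi := congrFun hn' i
  have hmem : ((AddCircle.equivIoc (1 : ℝ) 0 (toTorus L x i)).1) ∈ Ioc (0 : ℝ) 1 := by
    simpa using (AddCircle.equivIoc (1 : ℝ) 0 (toTorus L x i)).2
  have e : ofTorus L (toTorus L x) i =
    L i * (AddCircle.equivIoc (1 : ℝ) 0 (toTorus L x i)).1 := rfl
  rw [← hn', e]
  refine ⟨mul_pos (hL i) hmem.1, lt_of_le_of_ne (by nlinarith [hmem.2, hL i]) fun h1 => ?_⟩
  rw [← e, hi] at h1
  refine hn i (1 - n i) ?_
  push_cast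
  simp only [Pi.add_apply] at h1
  linarith

section
attribute [local instance] instMeasureSpaceCircle instIsAddHaarCircle instIsProbabilityCircle

/-- The integral of a periodic function over a translate of the box does not depend on the
translate. -/
theorem box_integral_add (hL : ∀ i, 0 < L i) {h : Space → ℝ} (hp : IsPeriodic L h)
    (hi : LocallyIntegrable h) (z : Space) : ∫ y in box L, h (y + z) = ∫ y in box L, h y := by
  have hm : AEStronglyMeasurable h volume := hi.aestronglyMeasurable
  have hc : ENNReal.ofReal (boxVol L) ≠ 0 := by simpa using boxVol_pos hL
  -- `H` is the function on the torus that corresponds to `h`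
  set H : UnitAddTorus (Fin 3) → ℝ := fun y => h (ofTorus L y) with hH
  have hHm : AEStronglyMeasurable H := by
    have h1 : AEStronglyMeasurable h (volume.restrict (box L)) := hm.restrict
    rw [← map_ofTorus hL] at h1
    exact (h1.comp_measurable measurable_ofTorus).mono_ac (Measure.absolutelyContinuous_smul hc)
  have hz : ∀ z : Space, ∫ y in box L, h (y + z) = boxVol L * ∫ q, H q := by
    intro z
    have hq := (measurePreserving_add_right (volume : Measure Space) z).quasiMeasurePreserving
    have e1 : ∫ y in box L, h (y + z) = ∫ y in box L, H (toTorus L y + toTorus L z) := by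
      refine integral_congr_ae (ae_restrict_of_ae ?_)
      filter_upwards [hq.ae (hp.ae_eq_ofTorus hL)] with y hy
      rw [← hy, hH]
      congr 2
      ext i
      simp [toTorus, add_div]
    have hHz : AEStronglyMeasurable (fun q => H (q + toTorus L z)) :=
      hHm.comp_measurePreserving (measurePreserving_add_right volume (toTorus L z))
    have e2 : ∫ y in box L, H (toTorus L y + toTorus L z) =
        boxVol L * ∫ q, H (q + toTorus L z) := by
      have := integral_map (μ := volume.restrict (box L)) (measurable_toTorus (L := L)).aemeasurable
        (f := fun q => H (q + toTorus L z)) (by rw [map_toTorus hL]; exact hHz.smul_measure _)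
      rw [← this, map_toTorus hL, integral_smul_measure, ENNReal.toReal_ofReal (boxVol_pos hL).le,
        smul_eq_mul]
    rw [e1, e2, integral_add_right_eq_self]
  have h0 := hz 0
  simp only [add_zero] at h0
  rw [hz z, h0]

end

theorem integral_partialDeriv_eq_zero {ψ : Space → ℝ} (i : Fin 3) (hψ : ContDiff ℝ 1 ψ)
    (hc : HasCompactSupport ψ) : ∫ x, partialDeriv i ψ x = 0 := by
  have h1 : Integrable (partialDeriv i ψ) :=
    (continuous_partialDeriv i hψ).integrable_of_hasCompactSupport
      (hasCompactSupport_partialDeriv i hc)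
  have := integral_mul_fderiv_eq_neg_fderiv_mul_of_integrable (μ := (volume : Measure Space))
    (f := fun _ => (1 : ℝ)) (g := ψ) (v := Pi.single i 1) (by simp)
    (by simp only [one_mul]; exact h1)
    (by simpa using hψ.continuous.integrable_of_hasCompactSupport hc)
    (fun _ _ => by simp) fun x _ => hψ.differentiable (by simp) x
  simpa [partialDeriv] using this

/-- The mean of `h` convolved with `ψ`, where `h` is periodic: by Fubini's theorem and the
invariance of the box integral under translations it is the product of the integrals. -/
theorem integral_convolution_box (hL : ∀ i, 0 < L i) {h ψ : Space → ℝ} (hp : IsPeriodic L h)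
    (hi : LocallyIntegrable h) (hψ : Continuous ψ) (hc : HasCompactSupport ψ) :
    ∫ y in box L, ∫ x, h x * ψ (x - y) = (∫ z, ψ z) * ∫ y in box L, h y := by
  -- all the supports of the functions `x ↦ ψ (x - y)` lie in one compact set `K`
  set K : Set Space := Set.image2 (· + ·) (tsupport ψ) (Icc 0 L) with hK
  have hKc : IsCompact K := by
    rw [hK, ← image_prod]
    exact (hc.isCompact.prod isCompact_Icc).image (by fun_prop)
  obtain ⟨C, hC⟩ := hψ.bounded_above_of_compact_support hc
  have hint : Integrable (fun p : Space × Space => h p.2 * ψ (p.2 - p.1))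
      ((volume.restrict (box L)).prod volume) := by
    have h1 : Integrable (K.indicator h) := (integrable_indicator_iff hKc.measurableSet).2
      (hi.integrableOn_isCompact hKc)
    have h2 : Integrable (fun p : Space × Space => K.indicator h p.2)
        ((volume.restrict (box L)).prod volume) := h1.comp_snd _
    have h3 : Integrable (fun p : Space × Space => K.indicator h p.2 * ψ (p.2 - p.1))
        ((volume.restrict (box L)).prod volume) :=
      h2.mul_bdd (c := C) (hψ.comp (by fun_prop)).aestronglyMeasurable
        (Eventually.of_forall fun p => hC _)
    refine h3.congr ?_
    have hb : ∀ᵐ p ∂((volume.restrict (box L)).prod (volume : Measure Space)), p.1 ∈ box L :=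
      Measure.quasiMeasurePreserving_fst.ae (ae_restrict_mem measurableSet_box)
    filter_upwards [hb] with p hp
    by_cases hpK : p.2 ∈ K
    · rw [indicator_of_mem hpK]
    · have : ψ (p.2 - p.1) = 0 := by
        refine image_eq_zero_of_notMem_tsupport fun hmem => hpK ?_
        exact ⟨p.2 - p.1, hmem, p.1, ⟨fun i => (hp i (mem_univ i)).1.le,
          fun i => (hp i (mem_univ i)).2.le⟩, by simp⟩
      rw [this]; simp
  have hint' : Integrable (fun p : Space × Space => h (p.1 + p.2) * ψ p.2)
      ((volume.restrict (box L)).prod volume) := by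
    have := (measurePreserving_prod_add (volume.restrict (box L))
      (volume : Measure Space)).integrable_comp_of_integrable hint
    simpa [Function.comp_def] using this
  have e1 : ∀ y, ∫ x, h x * ψ (x - y) = ∫ z, h (y + z) * ψ z := by
    intro y
    rw [← integral_add_left_eq_self (fun x => h x * ψ (x - y)) y]
    simp
  simp_rw [e1]
  rw [integral_integral_swap hint', ← integral_mul_const]
  refine integral_congr_ae (Eventually.of_forall fun z => ?_)
  simp only
  rw [integral_mul_const, box_integral_add hL hp hi z, mul_comm]

/-- A weak partial derivative of a periodic function has vanishing integral over the box. -/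
theorem HasWeakPartial.integral_box_eq_zero (hL : ∀ i, 0 < L i) {f g : Space → ℝ} {i : Fin 3}
    (h : HasWeakPartial univ i f g) (hf : IsPeriodic L f) (hg : IsPeriodic L g) :
    ∫ x in box L, g x = 0 := by
  obtain ⟨h1, h2, h3⟩ := h
  rw [locallyIntegrableOn_univ] at h1 h2
  -- mollify: the derivative of the convolution `f * ψ` has mean `∫ ∂ψ` times that of `f`, and
  -- `∫ ∂ψ = 0`
  let B : ContDiffBump (0 : Space) := ⟨1, 2, by norm_num, by norm_num⟩
  set ψ : Space → ℝ := B.normed volume with hψdef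
  have hψ : ContDiff ℝ (⊤ : ℕ∞) ψ := B.contDiff_normed
  have hc : HasCompactSupport ψ := B.hasCompactSupport_normed
  have hψ1 : ∫ t, ψ t = 1 := B.integral_normed
  have hψ' := hψ.of_le (m := 1) (by simp)
  have e1 := integral_convolution_box hL hg h2 hψ.continuous hc
  have e2 := integral_convolution_box hL hf h1 (continuous_partialDeriv i hψ')
    (hasCompactSupport_partialDeriv i hc)
  rw [integral_partialDeriv_eq_zero i hψ' hc, zero_mul] at e2
  rw [hψ1, one_mul] at e1
  have e3 : ∀ y, ∫ x, g x * ψ (x - y) = -∫ x, f x * partialDeriv i ψ (x - y) := by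
    intro y
    have hsub : ContDiff ℝ (⊤ : ℕ∞) fun x : Space => ψ (x - y) :=
      hψ.comp (contDiff_id.sub contDiff_const)
    have hcs : HasCompactSupport fun x : Space => ψ (x - y) := by
      have := hc.comp_homeomorph (Homeomorph.subRight y)
      simpa [Function.comp_def] using this
    have := h3 _ hsub hcs (subset_univ _)
    simp only [setIntegral_univ] at this
    have hd : ∀ x, partialDeriv i (fun x : Space => ψ (x - y)) x = partialDeriv i ψ (x - y) := by
      intro x
      simp only [partialDeriv]
      rw [fderiv_comp_sub]
    simp_rw [hd] at this
    rw [this, neg_neg]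
  rw [← e1]
  simp_rw [e3]
  rw [integral_neg, e2, neg_zero]

/-- The Fourier coefficients of a weak partial derivative of a periodic function. -/
theorem HasWeakPartial.coeff_eq (hL : ∀ i, 0 < L i) {f g : Space → ℝ} {j : Fin 3}
    (h : HasWeakPartial univ j f g) (hf : IsPeriodic L f) (hg : IsPeriodic L g)
    (hf2 : MemLp f 2 (volume.restrict (box L))) (hg2 : MemLp g 2 (volume.restrict (box L)))
    (k : Fin 3 → ℤ) :
    coeff L g k = (2 * Real.pi * k j / L j : ℝ) * Complex.I * coeff L f k := by
  have hfi : IntegrableOn f (box L) := hf2.integrable (by norm_num)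
  have hgi : IntegrableOn g (box L) := hg2.integrable (by norm_num)
  set P := phase L (-k) with hP
  set p : ℝ := P (Pi.single j 1) with hp
  have hpe : p = -(2 * Real.pi * k j / L j) := by
    rw [hp, hP, phase]
    simp only [sum_apply, smul_apply, ContinuousLinearMap.proj_apply, smul_eq_mul, Pi.neg_apply]
    rw [Finset.sum_eq_single j (fun b _ hb => by simp [hb]) (by simp)]
    simp; ring
  -- real and imaginary part come from the vanishing of the mean of `∂ (f cos P)` and `∂ (f sin P)`
  have hcos : ContDiff ℝ (⊤ : ℕ∞) fun x => Real.cos (P x) := Real.contDiff_cos.comp P.contDiff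
  have hsin : ContDiff ℝ (⊤ : ℕ∞) fun x => Real.sin (P x) := Real.contDiff_sin.comp P.contDiff
  have dcos : ∀ x, partialDeriv j (fun x => Real.cos (P x)) x = -p * Real.sin (P x) := by
    intro x
    rw [partialDeriv, (P.hasFDerivAt.cos).fderiv]
    simp [hp]; ring
  have dsin : ∀ x, partialDeriv j (fun x => Real.sin (P x)) x = p * Real.cos (P x) := by
    intro x
    rw [partialDeriv, (P.hasFDerivAt.sin).fderiv]
    simp [hp]; ring
  have hper : ∀ (i : Fin 3) (n : ℤ) (x : Space), ∃ m : ℤ,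
      P (x + Pi.single i (n * L i)) = P x + m * (2 * Real.pi) := by
    intro i n x
    refine ⟨-k i * n, ?_⟩
    rw [map_add, hP, phase]
    simp only [sum_apply, smul_apply, ContinuousLinearMap.proj_apply, smul_eq_mul, Pi.neg_apply]
    congr 1
    rw [Finset.sum_eq_single i (fun b _ hb => by simp [hb]) (by simp)]
    have := (hL i).ne'
    simp; field_simp
  have pcos : ∀ {u : Space → ℝ}, IsPeriodic L u → IsPeriodic L fun x => u x * Real.cos (P x) := by
    intro u hu i n
    filter_upwards [hu i n] with x hx
    obtain ⟨m, hm⟩ := hper i n x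
    rw [hx, hm, Real.cos_add_int_mul_two_pi]
  have psin : ∀ {u : Space → ℝ}, IsPeriodic L u → IsPeriodic L fun x => u x * Real.sin (P x) := by
    intro u hu i n
    filter_upwards [hu i n] with x hx
    obtain ⟨m, hm⟩ := hper i n x
    rw [hx, hm, Real.sin_add_int_mul_two_pi]
  have padd : ∀ {u w : Space → ℝ} (c : ℝ), IsPeriodic L u → IsPeriodic L w →
      IsPeriodic L fun x => u x + c * w x := by
    intro u w c hu hw i n
    filter_upwards [hu i n, hw i n] with x hx hx'
    rw [hx, hx']
  have icos : ∀ {u : Space → ℝ}, IntegrableOn u (box L) →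
      IntegrableOn (fun x => u x * Real.cos (P x)) (box L) := fun hu =>
    hu.mul_bdd (c := 1) hcos.continuous.aestronglyMeasurable
      (Eventually.of_forall fun x => Real.abs_cos_le_one _)
  have isin : ∀ {u : Space → ℝ}, IntegrableOn u (box L) →
      IntegrableOn (fun x => u x * Real.sin (P x)) (box L) := fun hu =>
    hu.mul_bdd (c := 1) hsin.continuous.aestronglyMeasurable
      (Eventually.of_forall fun x => Real.abs_sin_le_one _)
  have w1 := h.mul_contDiff hcos
  have w2 := h.mul_contDiff hsin
  have ae1 : (fun x => g x * Real.cos (P x) + f x * partialDeriv j (fun x => Real.cos (P x)) x) =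
      fun x => g x * Real.cos (P x) + (-p) * (f x * Real.sin (P x)) := by
    ext x; rw [dcos]; ring
  have ae2 : (fun x => g x * Real.sin (P x) + f x * partialDeriv j (fun x => Real.sin (P x)) x) =
      fun x => g x * Real.sin (P x) + p * (f x * Real.cos (P x)) := by
    ext x; rw [dsin]; ring
  rw [ae1] at w1
  rw [ae2] at w2
  have z1 := w1.integral_box_eq_zero hL (pcos hf) (padd _ (pcos hg) (psin hf))
  have z2 := w2.integral_box_eq_zero hL (psin hf) (padd _ (psin hg) (pcos hf))
  rw [integral_add (icos hgi) ((isin hfi).const_mul _), integral_const_mul] at z1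
  rw [integral_add (isin hgi) ((icos hfi).const_mul _), integral_const_mul] at z2
  have hsplit : ∀ {u : Space → ℝ}, IntegrableOn u (box L) →
      ∫ x in box L, char L (-k) x * (u x : ℂ) =
        ((∫ x in box L, u x * Real.cos (P x) : ℝ) : ℂ) +
          ((∫ x in box L, u x * Real.sin (P x) : ℝ) : ℂ) * Complex.I := by
    intro u hu
    rw [← integral_complex_ofReal, ← integral_complex_ofReal, ← integral_mul_const,
      ← integral_add (icos hu).ofReal ((isin hu).ofReal.mul_const _)]
    refine integral_congr_ae (Eventually.of_forall fun x => ?_)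
    simp only [char, ← hP]
    rw [Complex.exp_mul_I, ← Complex.ofReal_cos, ← Complex.ofReal_sin]
    push_cast
    ring
  rw [coeff, coeff, hsplit hgi, hsplit hfi]
  have z1' : ∫ x in box L, g x * Real.cos (P x) = p * ∫ x in box L, f x * Real.sin (P x) := by
    linarith
  have z2' : ∫ x in box L, g x * Real.sin (P x) = -p * ∫ x in box L, f x * Real.cos (P x) := by
    linarith
  have hq : (2 * Real.pi * k j / L j : ℝ) = -p := by rw [hpe, neg_neg]
  rw [z1', z2', hq, Complex.real_smul, Complex.real_smul]
  push_cast
  linear_combination ((p : ℂ) * ((boxVol L)⁻¹ : ℂ) *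
    ((∫ x in box L, f x * Real.sin (P x) : ℝ) : ℂ)) * (Complex.I_mul_I)

end

section

variable {L : Space} {S : ℝ}

/-! ### Functions of time and space -/

/-- The measure of the space-time cylinder `(0, S) × box L`. -/
def cylinder (L : Space) (S : ℝ) : Measure (ℝ × Space) :=
  (volume.restrict (Ioo 0 S)).prod (volume.restrict (box L))

instance : IsFiniteMeasure (cylinder L S) := by unfold cylinder; infer_instance

/-- Square integrability on the space-time cylinder. -/
def SqInt (L : Space) (S : ℝ) (u : ℝ → Space → ℝ) : Prop :=
  MemLp (fun p : ℝ × Space => u p.1 p.2) 2 (cylinder L S)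

theorem SqInt.integrable {u : ℝ → Space → ℝ} (h : SqInt L S u) :
    Integrable (fun p : ℝ × Space => u p.1 p.2) (cylinder L S) :=
  MemLp.integrable (by norm_num) h

theorem SqInt.mono {u : ℝ → Space → ℝ} {t : ℝ} (h : SqInt L S u) (ht : t ≤ S) : SqInt L t u :=
  MemLp.mono_measure (Measure.prod_mono (Measure.restrict_mono (Ioo_subset_Ioo_right ht) le_rfl)
    le_rfl) h

theorem SqInt.ae_memLp {u : ℝ → Space → ℝ} (h : SqInt L S u) :
    ∀ᵐ t ∂volume.restrict (Ioo 0 S), MemLp (u t) 2 (volume.restrict (box L)) := by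
  have h1 := h.integrable_sq
  have h2 := AEStronglyMeasurable.prodMk_left (MemLp.aestronglyMeasurable h)
  filter_upwards [h2, h1.prod_right_ae] with t ht1 ht2
  exact (memLp_two_iff_integrable_sq ht1).2 ht2

theorem SqInt.integrable_integral_sq {u : ℝ → Space → ℝ} (h : SqInt L S u) :
    IntegrableOn (fun t => ∫ x in box L, u t x ^ 2) (Ioo 0 S) :=
  Integrable.integral_prod_left (MemLp.integrable_sq h)

theorem SqInt.ae_integrableOn {u : ℝ → Space → ℝ} (h : SqInt L S u) :
    ∀ᵐ x ∂volume.restrict (box L), IntegrableOn (fun t => u t x) (Ioo 0 S) :=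
  Integrable.prod_left_ae (f := fun p : ℝ × Space => u p.1 p.2) h.integrable

theorem SqInt.sub {u v : ℝ → Space → ℝ} (hu : SqInt L S u) (hv : SqInt L S v) :
    SqInt L S fun t x => u t x - v t x :=
  MemLp.sub hu hv

section
variable {E : Type*} [NormedAddCommGroup E] [NormedSpace ℝ E]

theorem SqInt.integrable_smul {u : ℝ → Space → ℝ} (hu : SqInt L S u) {φ : ℝ → ℝ} {χ : Space → E}
    {C D : ℝ} (hφ : Continuous φ) (hC : ∀ t, ‖φ t‖ ≤ C) (hχ : Continuous χ) (hD : ∀ x, ‖χ x‖ ≤ D) :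
    Integrable (fun p : ℝ × Space => (u p.1 p.2 * φ p.1) • χ p.2) (cylinder L S) := by
  have h1 : Integrable (fun p : ℝ × Space => u p.1 p.2 * φ p.1) (cylinder L S) :=
    hu.integrable.mul_bdd (c := C) (hφ.comp continuous_fst).aestronglyMeasurable
      (Eventually.of_forall fun p => hC _)
  exact h1.smul_bdd D (hχ.comp continuous_snd).aestronglyMeasurable
    (Eventually.of_forall fun p => hD _)

/-- Fubini's theorem for the pairing with a product `φ(t) χ(x)`. -/
theorem SqInt.integral_swap [CompleteSpace E] {u : ℝ → Space → ℝ} (hu : SqInt L S u) {φ : ℝ → ℝ}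
    {χ : Space → E} {C D : ℝ} (hφ : Continuous φ) (hC : ∀ t, ‖φ t‖ ≤ C) (hχ : Continuous χ)
    (hD : ∀ x, ‖χ x‖ ≤ D) :
    ∫ t in Ioo 0 S, φ t • ∫ x in box L, u t x • χ x =
      ∫ x in box L, (∫ t in Ioo 0 S, u t x * φ t) • χ x := by
  have h := integral_integral_swap (f := fun (t : ℝ) (x : Space) => (u t x * φ t) • χ x)
    (μ := volume.restrict (Ioo 0 S)) (ν := volume.restrict (box L))
    (hu.integrable_smul hφ hC hχ hD)
  simp_rw [integral_smul_const] at h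
  rw [← h]
  refine integral_congr_ae (Eventually.of_forall fun t => ?_)
  simp only
  rw [← integral_smul]
  congr 1; ext x
  rw [smul_smul, mul_comm]

theorem SqInt.integrable_pairing [CompleteSpace E] {u : ℝ → Space → ℝ} (hu : SqInt L S u)
    {χ : Space → E} {D : ℝ} (hχ : Continuous χ) (hD : ∀ x, ‖χ x‖ ≤ D) :
    IntegrableOn (fun t => ∫ x in box L, u t x • χ x) (Ioo 0 S) := by
  have := hu.integrable_smul (φ := fun _ => 1) (C := 1) continuous_const (by simp) hχ hD
  simp only [mul_one] at this
  exact this.integral_prod_left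
end

theorem coeff_eq_smul (f : Space → ℝ) (k : Fin 3 → ℤ) :
    coeff L f k = (boxVol L)⁻¹ • ∫ x in box L, f x • char L (-k) x := by
  rw [coeff]
  congr 2; ext x
  rw [Complex.real_smul, mul_comm]

theorem SqInt.integrable_coeff {u : ℝ → Space → ℝ} (hu : SqInt L S u) (k : Fin 3 → ℤ) :
    IntegrableOn (fun t => coeff L (u t) k) (Ioo 0 S) := by
  simp_rw [coeff_eq_smul]
  exact (hu.integrable_pairing (continuous_char _) fun x => (norm_char _ x).le).smul (boxVol L)⁻¹

theorem SqInt.integrable_normSq_coeff (hL : ∀ i, 0 < L i) {u : ℝ → Space → ℝ} (hu : SqInt L S u)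
    (k : Fin 3 → ℤ) : IntegrableOn (fun t => ‖coeff L (u t) k‖ ^ 2) (Ioo 0 S) := by
  refine (hu.integrable_integral_sq.const_mul (boxVol L)⁻¹).mono'
    ((hu.integrable_coeff k).aestronglyMeasurable.norm.pow 2) ?_
  filter_upwards [hu.ae_memLp] with t ht
  rw [Real.norm_of_nonneg (by positivity)]
  exact le_hasSum (hasSum_sq_coeff hL ht) k fun _ _ => by positivity

/-- `u'` is the weak time derivative of `u` on the cylinder. -/
def WeakTimeDeriv (L : Space) (S : ℝ) (u u' : ℝ → Space → ℝ) : Prop :=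
  ∀ φ : ℝ → ℝ, ContDiff ℝ (⊤ : ℕ∞) φ → HasCompactSupport φ → tsupport φ ⊆ Ioo 0 S →
    ∀ᵐ x ∂volume.restrict (box L),
      ∫ t in Ioo 0 S, u t x * deriv φ t = -∫ t in Ioo 0 S, u' t x * φ t

theorem bound_of_test {E : Type*} [NormedAddCommGroup E] [NormedSpace ℝ E] {φ : E → ℝ}
    (hφ : Continuous φ) (hc : HasCompactSupport φ) : ∃ C, ∀ t, ‖φ t‖ ≤ C :=
  hφ.bounded_above_of_compact_support hc

theorem WeakTimeDeriv.integral_coeff {u u' : ℝ → Space → ℝ} (h : WeakTimeDeriv L S u u')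
    (hu : SqInt L S u) (hu' : SqInt L S u') (k : Fin 3 → ℤ) {φ : ℝ → ℝ}
    (hφ : ContDiff ℝ (⊤ : ℕ∞) φ) (hc : HasCompactSupport φ) (hs : tsupport φ ⊆ Ioo 0 S) :
    ∫ t in Ioo 0 S, deriv φ t • coeff L (u t) k = -∫ t in Ioo 0 S, φ t • coeff L (u' t) k := by
  have hφ1 : Continuous (deriv φ) := hφ.continuous_deriv (by simp)
  obtain ⟨C, hC⟩ := bound_of_test hφ1 hc.deriv
  obtain ⟨C', hC'⟩ := bound_of_test hφ.continuous hc
  have e1 := hu.integral_swap hφ1 hC (continuous_char (L := L) (-k)) fun x => (norm_char _ x).le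
  have e2 := hu'.integral_swap hφ.continuous hC' (continuous_char (L := L) (-k))
    fun x => (norm_char _ x).le
  simp_rw [coeff_eq_smul, smul_comm _ (boxVol L)⁻¹]
  rw [integral_smul, integral_smul, e1, e2, ← smul_neg, ← integral_neg]
  congr 1
  refine integral_congr_ae ?_
  filter_upwards [h φ hφ hc hs] with x hx
  rw [hx, neg_smul]

/-- The Fourier coefficients of `u` are primitives of those of its weak time derivative. -/
theorem WeakTimeDeriv.exists_coeff_primitive {u u' : ℝ → Space → ℝ} (hS : 0 < S)
    (h : WeakTimeDeriv L S u u') (hu : SqInt L S u) (hu' : SqInt L S u') (k : Fin 3 → ℤ) :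
    ∃ c : ℂ, ∀ᵐ t ∂volume.restrict (Ioo 0 S),
      coeff L (u t) k = c + ∫ s in (0 : ℝ)..t, coeff L (u' s) k := by
  have hi := hu.integrable_coeff k
  have hi' := hu'.integrable_coeff k
  have hφi : ∀ {w : ℝ → Space → ℝ}, SqInt L S w → ∀ {φ : ℝ → ℝ}, Continuous φ →
      HasCompactSupport φ → IntegrableOn (fun t => φ t • coeff L (w t) k) (Ioo 0 S) := by
    intro w hw φ hφ hc
    obtain ⟨C, hC⟩ := bound_of_test hφ hc
    exact (hw.integrable_coeff k).bdd_smul C hφ.aestronglyMeasurable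
      (Eventually.of_forall hC)
  have hre : ∀ φ : ℝ → ℝ, ContDiff ℝ (⊤ : ℕ∞) φ → HasCompactSupport φ → tsupport φ ⊆ Ioo 0 S →
      ∫ t in Ioo 0 S, (coeff L (u t) k).re * deriv φ t =
        -∫ t in Ioo 0 S, (coeff L (u' t) k).re * φ t := by
    intro φ hφ hc hs
    have hφ1 : Continuous (deriv φ) := hφ.continuous_deriv (by simp)
    have e := congrArg Complex.re (h.integral_coeff hu hu' k hφ hc hs)
    have e1 := Complex.reCLM.integral_comp_comm (hφi hu hφ1 hc.deriv)
    have e2 := Complex.reCLM.integral_comp_comm (hφi hu' hφ.continuous hc)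
    simp only [Complex.reCLM_apply, Complex.smul_re, smul_eq_mul, Complex.neg_re] at e e1 e2
    rw [← e1, ← e2] at e
    simpa only [mul_comm] using e
  have him : ∀ φ : ℝ → ℝ, ContDiff ℝ (⊤ : ℕ∞) φ → HasCompactSupport φ → tsupport φ ⊆ Ioo 0 S →
      ∫ t in Ioo 0 S, (coeff L (u t) k).im * deriv φ t =
        -∫ t in Ioo 0 S, (coeff L (u' t) k).im * φ t := by
    intro φ hφ hc hs
    have hφ1 : Continuous (deriv φ) := hφ.continuous_deriv (by simp)
    have e := congrArg Complex.im (h.integral_coeff hu hu' k hφ hc hs)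
    have e1 := Complex.imCLM.integral_comp_comm (hφi hu hφ1 hc.deriv)
    have e2 := Complex.imCLM.integral_comp_comm (hφi hu' hφ.continuous hc)
    simp only [Complex.imCLM_apply, Complex.smul_im, smul_eq_mul, Complex.neg_im] at e e1 e2
    rw [← e1, ← e2] at e
    simpa only [mul_comm] using e
  obtain ⟨c1, h1⟩ := exists_primitive_of_weak_deriv hS hi.re hi'.re hre
  obtain ⟨c2, h2⟩ := exists_primitive_of_weak_deriv hS hi.im hi'.im him
  refine ⟨⟨c1, c2⟩, ?_⟩
  filter_upwards [h1, h2, ae_restrict_mem measurableSet_Ioo] with t ht1 ht2 ht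
  have hsub : IntegrableOn (fun s => coeff L (u' s) k) (Ioc 0 t) :=
    hi'.mono_set fun s hs => ⟨hs.1, hs.2.trans_lt ht.2⟩
  have r1 := Complex.reCLM.integral_comp_comm hsub
  have r2 := Complex.imCLM.integral_comp_comm hsub
  rw [intervalIntegral.integral_of_le ht.1.le] at ht1 ht2 ⊢
  apply Complex.ext
  · rw [Complex.add_re]; exact ht1.trans (by rw [← Complex.reCLM_apply (∫ _ in _, _), ← r1]; rfl)
  · rw [Complex.add_im]; exact ht2.trans (by rw [← Complex.imCLM_apply (∫ _ in _, _), ← r2]; rfl)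

/-- The weak time derivative commutes with weak partial derivatives. -/
theorem WeakTimeDeriv.partial {u u' g g' : ℝ → Space → ℝ} {j : Fin 3} (h : WeakTimeDeriv L S u u')
    (hu : SqInt L S u) (hu' : SqInt L S u') (hg : SqInt L S g) (hg' : SqInt L S g')
    (hug : ∀ᵐ t ∂volume.restrict (Ioo 0 S), HasWeakPartial univ j (u t) (g t))
    (hug' : ∀ᵐ t ∂volume.restrict (Ioo 0 S), HasWeakPartial (box L) j (u' t) (g' t)) :
    WeakTimeDeriv L S g g' := by
  intro φ hφ hc hs
  have hφ1 : Continuous (deriv φ) := hφ.continuous_deriv (by simp)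
  obtain ⟨C, hC⟩ := bound_of_test hφ1 hc.deriv
  obtain ⟨C', hC'⟩ := bound_of_test hφ.continuous hc
  have hF : Integrable (fun x => (∫ t in Ioo 0 S, g t x * deriv φ t) + ∫ t in Ioo 0 S, g' t x * φ t)
      (volume.restrict (box L)) := by
    have i1 := hg.integrable_smul (χ := fun _ => (1 : ℝ)) (D := 1) hφ1 hC continuous_const (by simp)
    have i2 := hg'.integrable_smul (χ := fun _ => (1 : ℝ)) (D := 1) hφ.continuous hC'
      continuous_const (by simp)
    simp only [smul_eq_mul, mul_one] at i1 i2
    exact i1.integral_prod_right.add i2.integral_prod_right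
  -- test with a function `e` of compact support in the box, for which no boundary terms appear
  have key : ∀ᵐ x, x ∈ box L →
      (∫ t in Ioo 0 S, g t x * deriv φ t) + ∫ t in Ioo 0 S, g' t x * φ t = 0 := by
    refine isOpen_box.ae_eq_zero_of_integral_contDiff_smul_eq_zero
      (IntegrableOn.locallyIntegrableOn hF) fun e he hec hes => ?_
    have he1 := he.of_le (m := 1) (by simp)
    have hde := continuous_partialDeriv j he1
    obtain ⟨D, hD⟩ := bound_of_test he.continuous hec
    obtain ⟨D', hD'⟩ := bound_of_test hde (hasCompactSupport_partialDeriv j hec)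
    have s1 := hg.integral_swap hφ1 hC he.continuous hD
    have s2 := hg'.integral_swap hφ.continuous hC' he.continuous hD
    have s3 := hu.integral_swap hφ1 hC hde hD'
    have s4 := hu'.integral_swap hφ.continuous hC' hde hD'
    simp only [smul_eq_mul] at s1 s2 s3 s4
    have r1 : ∫ t in Ioo 0 S, deriv φ t * ∫ x in box L, g t x * e x =
        -∫ t in Ioo 0 S, deriv φ t * ∫ x in box L, u t x * partialDeriv j e x := by
      rw [← integral_neg]
      refine integral_congr_ae ?_
      filter_upwards [hug] with t ht
      have := ht.2.2 e he hec (subset_univ _)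
      simp only [setIntegral_univ] at this
      rw [setIntegral_eq_integral_of_forall_compl_eq_zero (f := fun x => g t x * e x),
        setIntegral_eq_integral_of_forall_compl_eq_zero, this]
      · ring
      · intro x hx
        rw [partialDeriv_eq_zero_of_notMem fun hx' => hx (hes hx'), mul_zero]
      · intro x hx
        rw [image_eq_zero_of_notMem_tsupport fun hx' => hx (hes hx'), mul_zero]
    have r2 : ∫ t in Ioo 0 S, φ t * ∫ x in box L, g' t x * e x =
        -∫ t in Ioo 0 S, φ t * ∫ x in box L, u' t x * partialDeriv j e x := by
      rw [← integral_neg]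
      refine integral_congr_ae ?_
      filter_upwards [hug'] with t ht
      rw [ht.2.2 e he hec hes]
      ring
    have r3 : ∫ x in box L, (∫ t in Ioo 0 S, u t x * deriv φ t) * partialDeriv j e x =
        -∫ x in box L, (∫ t in Ioo 0 S, u' t x * φ t) * partialDeriv j e x := by
      rw [← integral_neg]
      refine integral_congr_ae ?_
      filter_upwards [h φ hφ hc hs] with x hx
      rw [hx]; ring
    have i1 : Integrable (fun x => (∫ t in Ioo 0 S, g t x * deriv φ t) * e x)
        (volume.restrict (box L)) := by
      have := (hg.integrable_smul hφ1 hC he.continuous hD).integral_prod_right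
      simpa only [smul_eq_mul, integral_mul_const] using this
    have i2 : Integrable (fun x => (∫ t in Ioo 0 S, g' t x * φ t) * e x)
        (volume.restrict (box L)) := by
      have := (hg'.integrable_smul hφ.continuous hC' he.continuous hD).integral_prod_right
      simpa only [smul_eq_mul, integral_mul_const] using this
    have e0 : ∫ x, e x • ((∫ t in Ioo 0 S, g t x * deriv φ t) + ∫ t in Ioo 0 S, g' t x * φ t) =
        (∫ x in box L, (∫ t in Ioo 0 S, g t x * deriv φ t) * e x) +
          ∫ x in box L, (∫ t in Ioo 0 S, g' t x * φ t) * e x := by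
      rw [← integral_add i1 i2, ← setIntegral_eq_integral_of_forall_compl_eq_zero (s := box L)]
      · refine integral_congr_ae (Eventually.of_forall fun x => ?_)
        simp only [smul_eq_mul]; ring
      · intro x hx
        rw [image_eq_zero_of_notMem_tsupport fun hx' => hx (hes hx'), zero_smul]
    rw [e0, ← s1, ← s2, r1, r2, s3, s4, r3]
    ring
  rw [ae_restrict_iff' measurableSet_box]
  filter_upwards [key] with x hx hxb
  have := hx hxb
  linarith

end

section

variable {L : Space} {S : ℝ}

/-! ### Weighted sums of Fourier coefficients -/

/-- The `j`-th component of the wave vector of the `k`-th character. -/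
def wave (L : Space) (k : Fin 3 → ℤ) (j : Fin 3) : ℝ := 2 * Real.pi * k j / L j

/-- The weight `1 + |ξ|²`, where `ξ` is the wave vector of the `k`-th character. -/
def weight (L : Space) (k : Fin 3 → ℤ) : ℝ := 1 + ∑ j, wave L k j ^ 2

theorem one_le_weight (k : Fin 3 → ℤ) : 1 ≤ weight L k :=
  le_add_of_nonneg_right (Finset.sum_nonneg fun _ _ => sq_nonneg _)

theorem weight_pos (k : Fin 3 → ℤ) : 0 < weight L k := one_pos.trans_le (one_le_weight k)

theorem sq_wave_le_weight (k : Fin 3 → ℤ) (j : Fin 3) : 1 + wave L k j ^ 2 ≤ weight L k := by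
  have := Finset.single_le_sum (f := fun j => wave L k j ^ 2) (fun _ _ => sq_nonneg _)
    (Finset.mem_univ j)
  unfold weight
  linarith

/-- The weight `(1 + |ξ|²)³` of `H³` is controlled by the function and its three pure third
derivatives. -/
theorem weight_pow_three_le (k : Fin 3 → ℤ) :
    weight L k ^ 3 ≤ 16 * (1 + ∑ j, (|wave L k j| ^ 3) ^ 2) := by
  have h : ∀ a b c : ℝ, 0 ≤ a → 0 ≤ b → 0 ≤ c →
      (1 + (a + b + c)) ^ 3 ≤ 16 * (1 + (a ^ 3 + b ^ 3 + c ^ 3)) := by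
    intro a b c ha hb hc
    have h2 : ∀ x y : ℝ, 0 ≤ x → 0 ≤ y → (x + y) ^ 3 ≤ 4 * (x ^ 3 + y ^ 3) := fun x y hx hy => by
      nlinarith [mul_nonneg (add_nonneg hx hy) (sq_nonneg (x - y))]
    have e1 := h2 (1 + a) (b + c) (by positivity) (by positivity)
    have e2 := h2 1 a (by positivity) ha
    have e3 := h2 b c hb hc
    have e4 : (1 + (a + b + c)) ^ 3 = (1 + a + (b + c)) ^ 3 := by ring
    rw [e4]; linarith
  have := h (wave L k 0 ^ 2) (wave L k 1 ^ 2) (wave L k 2 ^ 2) (sq_nonneg _) (sq_nonneg _)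
    (sq_nonneg _)
  have e : ∀ x : ℝ, (|x| ^ 3) ^ 2 = (x ^ 2) ^ 3 := fun x => by
    rw [← pow_mul, ← sq_abs x, ← pow_mul]
  simp only [weight, Fin.sum_univ_three, e]
  exact this

theorem summable_one_add_sq_rpow {c : ℝ} (hc : 0 < c) :
    Summable fun n : ℤ => (1 + (c * n) ^ 2) ^ (-(2 / 3) : ℝ) := by
  have h := (Real.summable_abs_int_rpow (b := 4 / 3) (by norm_num)).mul_left (c ^ (-(4 / 3) : ℝ))
  refine Summable.of_norm_bounded_eventually h ?_
  refine (finite_singleton (0 : ℤ)).subset fun n hn => ?_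
  by_contra h0
  refine hn ?_
  change ‖(1 + (c * (n : ℝ)) ^ 2) ^ (-(2 / 3) : ℝ)‖ ≤ c ^ (-(4 / 3) : ℝ) * |(n : ℝ)| ^ (-(4 / 3) : ℝ)
  have hn0 : 0 < |(n : ℝ)| := abs_pos.2 (by exact_mod_cast h0)
  have h1 : (0 : ℝ) < (c * |(n : ℝ)|) ^ 2 := by positivity
  rw [Real.norm_of_nonneg (by positivity), ← Real.mul_rpow hc.le hn0.le]
  have e : (c * |(n : ℝ)|) ^ (-(4 / 3) : ℝ) = ((c * |(n : ℝ)|) ^ 2) ^ (-(2 / 3) : ℝ) := by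
    rw [← Real.rpow_natCast, ← Real.rpow_mul (by positivity)]; norm_num
  rw [e]
  refine Real.rpow_le_rpow_of_nonpos h1 ?_ (by norm_num)
  rw [mul_pow, mul_pow, sq_abs]; linarith

/-- `∑ (1 + |ξ|²)⁻²` converges in dimension three: the exponent is split into `2/3` for each
coordinate, and `∑ |n| ^ (-4/3)` converges. -/
theorem summable_weight (hL : ∀ i, 0 < L i) : Summable fun k => (weight L k ^ 2)⁻¹ := by
  set f : Fin 3 → ℤ → ℝ := fun j n => (1 + (2 * Real.pi / L j * n) ^ 2) ^ (-(2 / 3) : ℝ) with hf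
  have hf0 : ∀ j n, 0 ≤ f j n := fun j n => by rw [hf]; positivity
  have hfs : ∀ j, Summable (f j) := fun j =>
    summable_one_add_sq_rpow (by have := hL j; have := Real.pi_pos; positivity)
  have hprod : Summable fun k : Fin 3 → ℤ => ∏ j, f j (k j) := by
    refine summable_of_sum_le (c := ∏ j, ∑' n, f j n)
      (fun k => Finset.prod_nonneg fun j _ => hf0 j _) fun s => ?_
    classical
    calc ∑ k ∈ s, ∏ j, f j (k j)
        ≤ ∑ k ∈ Fintype.piFinset fun j => s.image fun k => k j, ∏ j, f j (k j) :=
          Finset.sum_le_sum_of_subset_of_nonneg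
            (fun k hk => Fintype.mem_piFinset.2 fun j => Finset.mem_image_of_mem _ hk)
            fun k _ _ => Finset.prod_nonneg fun j _ => hf0 j _
      _ = ∏ j, ∑ n ∈ s.image fun k => k j, f j n := (Finset.prod_univ_sum _ _).symm
      _ ≤ _ := Finset.prod_le_prod (fun j _ => Finset.sum_nonneg fun n _ => hf0 j n)
          fun j _ => (hfs j).sum_le_tsum _ fun n _ => hf0 j n
  refine hprod.of_nonneg_of_le (fun k => by positivity) fun k => ?_
  have hw := weight_pos (L := L) k
  have e : (weight L k ^ 2)⁻¹ = ∏ _j : Fin 3, weight L k ^ (-(2 / 3) : ℝ) := by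
    rw [Finset.prod_const, Finset.card_univ, Fintype.card_fin, ← Real.rpow_natCast (_ ^ _),
      ← Real.rpow_mul hw.le, ← Real.rpow_natCast, ← Real.rpow_neg hw.le]
    norm_num
  rw [e]
  refine Finset.prod_le_prod (fun j _ => by positivity) fun j _ => ?_
  rw [hf]
  refine Real.rpow_le_rpow_of_nonpos (by positivity) ?_ (by norm_num)
  have := sq_wave_le_weight (L := L) k j
  rw [wave] at this
  calc _ = 1 + (2 * Real.pi * k j / L j) ^ 2 := by ring
    _ ≤ _ := this

theorem norm_phase_le (k : Fin 3 → ℤ) : ‖phase L k‖ ≤ 3 * √(weight L k) := by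
  refine ContinuousLinearMap.opNorm_le_bound _ (by positivity) fun x => ?_
  have h1 : ∀ j, |wave L k j| ≤ √(weight L k) := fun j =>
    Real.abs_le_sqrt (by linarith [sq_wave_le_weight (L := L) k j])
  have e : phase L k x = ∑ j, wave L k j * x j := by
    simp [phase, wave, sum_apply]
  rw [e]
  calc ‖∑ j, wave L k j * x j‖ ≤ ∑ j, ‖wave L k j * x j‖ := norm_sum_le _ _
    _ ≤ ∑ _j : Fin 3, √(weight L k) * ‖x‖ := by
        refine Finset.sum_le_sum fun j _ => ?_
        rw [norm_mul]
        exact mul_le_mul (h1 j) (norm_le_pi_norm x j) (norm_nonneg _) (Real.sqrt_nonneg _)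
    _ = _ := by simp; ring

/-- The arithmetic-geometric mean inequality behind the absolute convergence of the series of
gradients. The free parameter `R` is chosen later so that the bound is linear in the `H³` norm. -/
theorem two_mul_le_weight {w R a : ℝ} (hw : 0 < w) (hR : 0 < R) :
    2 * (√w * a) ≤ R * (w ^ 2)⁻¹ + R⁻¹ * (w ^ 3 * a ^ 2) := by
  have hs : √w ^ 2 = w := Real.sq_sqrt hw.le
  have e : R * (w ^ 2)⁻¹ + R⁻¹ * (w ^ 3 * a ^ 2) - 2 * (√w * a) =
      R⁻¹ * (R * w⁻¹ - w * √w * a) ^ 2 := by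
    have : w ^ 3 = w ^ 2 * √w ^ 2 := by rw [hs]; ring
    rw [this]; field_simp; ring
  have : 0 ≤ R⁻¹ * (R * w⁻¹ - w * √w * a) ^ 2 := by positivity
  linarith

/-- The real part of one term of a Fourier series. -/
theorem hasFDerivAt_re_char (a : ℂ) (k : Fin 3 → ℤ) (x : Space) :
    HasFDerivAt (fun x => (a * char L k x).re) ((a * (char L k x * Complex.I)).re • phase L k) x := by
  have h1 : HasFDerivAt (fun x => ((phase L k x : ℝ) : ℂ))
      (Complex.ofRealCLM.comp (phase L k)) x :=
    Complex.ofRealCLM.hasFDerivAt.comp x (phase L k).hasFDerivAt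
  have h2 := ((h1.mul_const Complex.I).cexp.const_mul a)
  have h3 := Complex.reCLM.hasFDerivAt.comp x h2
  convert! h3 using 1
  ext y
  simp [char]
  ring

theorem contDiff_re_char (a : ℂ) (k : Fin 3 → ℤ) : ContDiff ℝ 1 fun x => (a * char L k x).re := by
  have h1 : ContDiff ℝ 1 (char L k) := (contDiff_char k).of_le (by simp)
  exact Complex.reCLM.contDiff.comp (contDiff_const.mul h1)

/-- A Fourier series whose coefficients decay like those of a function with square integrable third
derivatives is continuously differentiable. -/
theorem contDiff_fourierSeries (hL : ∀ i, 0 < L i) {a : (Fin 3 → ℤ) → ℂ} {N : ℝ}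
    (hs : Summable fun k => weight L k ^ 3 * ‖a k‖ ^ 2)
    (hN : ∑' k, weight L k ^ 3 * ‖a k‖ ^ 2 ≤ N) (ha : Summable fun k => ‖a k‖) :
    ContDiff ℝ 1 (fun x => (∑' k, a k * char L k x).re) ∧
      ∀ j x, |partialDeriv j (fun x => (∑' k, a k * char L k x).re) x| ≤
        3 / 2 * ((∑' k, (weight L k ^ 2)⁻¹) + 1) * √(1 + N) := by
  have hN0 : 0 ≤ N := le_trans (tsum_nonneg fun k => by have := weight_pos (L := L) k; positivity) hN
  set R := √(1 + N) with hR
  have hRpos : 0 < R := Real.sqrt_pos.2 (by linarith)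
  -- the weight `R` balances the two sums: a bound linear in `N` would not be square integrable in
  -- time, as only `N` itself is integrable
  have hR2 : R ^ 2 = 1 + N := Real.sq_sqrt (by linarith)
  set Z := ∑' k, (weight L k ^ 2)⁻¹ with hZ
  have hZ0 : 0 ≤ Z := tsum_nonneg fun k => by positivity
  set c : (Fin 3 → ℤ) → ℝ := fun k =>
    3 / 2 * (R * (weight L k ^ 2)⁻¹ + R⁻¹ * (weight L k ^ 3 * ‖a k‖ ^ 2)) with hc
  have hcs : Summable c :=
    (((summable_weight hL).mul_left R).add (hs.mul_left R⁻¹)).mul_left (3 / 2)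
  have hcsum : ∑' k, c k ≤ 3 / 2 * (Z + 1) * R := by
    rw [hc, tsum_mul_left, ((summable_weight hL).mul_left R).tsum_add (hs.mul_left R⁻¹),
      tsum_mul_left, tsum_mul_left, ← hZ]
    have : R⁻¹ * ∑' k, weight L k ^ 3 * ‖a k‖ ^ 2 ≤ R := by
      rw [inv_mul_le_iff₀ hRpos]; nlinarith
    nlinarith
  have hterm : ∀ x, Summable fun k => a k * char L k x := fun x => by
    refine .of_norm ?_
    simpa [norm_char] using ha
  have heq : (fun x => (∑' k, a k * char L k x).re) = fun x => ∑' k, (a k * char L k x).re := by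
    ext x; exact Complex.re_tsum (hterm x)
  have hbd : ∀ k x, ‖fderiv ℝ (fun x => (a k * char L k x).re) x‖ ≤ c k := by
    intro k x
    rw [(hasFDerivAt_re_char (a k) k x).fderiv, norm_smul]
    have h1 : ‖(a k * (char L k x * Complex.I)).re‖ ≤ ‖a k‖ := by
      refine (Complex.abs_re_le_norm _).trans ?_
      simp [norm_char]
    calc _ ≤ ‖a k‖ * (3 * √(weight L k)) :=
          mul_le_mul h1 (norm_phase_le k) (norm_nonneg _) (norm_nonneg _)
      _ ≤ c k := by
          have := two_mul_le_weight (a := ‖a k‖) (weight_pos (L := L) k) hRpos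
          rw [hc]; simp only; linarith
  have hre : ∀ k x, ‖(a k * char L k x).re‖ ≤ ‖a k‖ := fun k x => by
    refine (Complex.abs_re_le_norm _).trans ?_
    simp [norm_char]
  rw [heq]
  constructor
  · refine contDiff_tsum (v := fun n k => if n = 0 then ‖a k‖ else c k)
      (fun k => contDiff_re_char (a k) k) (fun n _ => ?_) fun n k x hn => ?_
    · by_cases h : n = 0 <;> simp [h, ha, hcs]
    · have hn' : n ≤ 1 := by exact_mod_cast hn
      interval_cases n
      · simpa using hre k x
      · rw [norm_iteratedFDeriv_one]
        simpa using hbd k x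
  · intro j x
    have hd := fderiv_tsum_apply hcs (fun k x => (contDiff_re_char (L := L) (a k) k).differentiable
      one_ne_zero x) hbd (x₀ := 0) (by
        have : Summable fun k => (a k * char L k 0).re := .of_norm_bounded ha fun k => hre k 0
        exact this) x
    rw [partialDeriv, hd]
    have hsumd : Summable fun k => fderiv ℝ (fun x => (a k * char L k x).re) x :=
      .of_norm_bounded hcs fun k => hbd k x
    have h1 : ‖∑' k, fderiv ℝ (fun x => (a k * char L k x).re) x‖ ≤ ∑' k, c k :=
      tsum_of_norm_bounded hcs.hasSum fun k => hbd k x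
    have h2 : ‖(Pi.single j 1 : Space)‖ ≤ 1 := by
      refine (pi_norm_le_iff_of_nonneg zero_le_one).2 fun i => ?_
      by_cases hij : i = j
      · subst hij; simp
      · simp [hij]
    calc _ ≤ ‖∑' k, fderiv ℝ (fun x => (a k * char L k x).re) x‖ * ‖(Pi.single j 1 : Space)‖ :=
          ContinuousLinearMap.le_opNorm _ _
      _ ≤ (∑' k, c k) * 1 := mul_le_mul h1 h2 (norm_nonneg _) ((norm_nonneg _).trans h1)
      _ ≤ _ := by rw [mul_one]; exact hcsum

/-- `sq_le_of_primitive` for complex valued functions. -/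
theorem normSq_le_of_primitive {f h : ℝ → ℂ} {w : ℝ} (hS : 0 < S) (hw : 0 < w)
    (hh : IntervalIntegrable h volume 0 S)
    (hh2 : IntervalIntegrable (fun s => ‖h s‖ ^ 2) volume 0 S)
    (hf : ∀ s ∈ Icc 0 S, f s = f 0 + ∫ r in (0 : ℝ)..s, h r) {t : ℝ} (ht : t ∈ Icc 0 S) :
    ‖f t‖ ^ 2 ≤ (S⁻¹ + w) * (∫ s in (0 : ℝ)..S, ‖f s‖ ^ 2) + w⁻¹ * ∫ s in (0 : ℝ)..S, ‖h s‖ ^ 2 := by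
  have hsub : ∀ s ∈ Icc 0 S, IntervalIntegrable h volume 0 s := fun s hs => hh.mono_set (by
    rw [uIcc_of_le hs.1, uIcc_of_le hS.le]; exact Icc_subset_Icc_right hs.2)
  have hre : ∀ s ∈ Icc 0 S, (f s).re = (f 0).re + ∫ r in (0 : ℝ)..s, (h r).re := by
    intro s hs
    have := Complex.reCLM.intervalIntegral_comp_comm (hsub s hs)
    simp only [Complex.reCLM_apply] at this
    rw [this, ← Complex.add_re, ← hf s hs]
  have him : ∀ s ∈ Icc 0 S, (f s).im = (f 0).im + ∫ r in (0 : ℝ)..s, (h r).im := by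
    intro s hs
    have := Complex.imCLM.intervalIntegral_comp_comm (hsub s hs)
    simp only [Complex.imCLM_apply] at this
    rw [this, ← Complex.add_im, ← hf s hs]
  have ire : IntervalIntegrable (fun s => (h s).re) volume 0 S := ⟨hh.1.re, hh.2.re⟩
  have iim : IntervalIntegrable (fun s => (h s).im) volume 0 S := ⟨hh.1.im, hh.2.im⟩
  have ire2 : IntervalIntegrable (fun s => (h s).re ^ 2) volume 0 S := by
    refine hh2.mono_fun ((intervalIntegrable_iff.1 ire).aestronglyMeasurable.pow 2) (Eventually.of_forall fun s => ?_)
    simp only [norm_pow, norm_norm]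
    gcongr
    exact Complex.abs_re_le_norm _
  have iim2 : IntervalIntegrable (fun s => (h s).im ^ 2) volume 0 S := by
    refine hh2.mono_fun ((intervalIntegrable_iff.1 iim).aestronglyMeasurable.pow 2) (Eventually.of_forall fun s => ?_)
    simp only [norm_pow, norm_norm]
    gcongr
    exact Complex.abs_im_le_norm _
  have b1 := sq_le_of_primitive hS hw ire ire2 hre ht
  have b2 := sq_le_of_primitive hS hw iim iim2 him ht
  have cre := continuousOn_of_primitive hS.le ire hre
  have cim := continuousOn_of_primitive hS.le iim him
  rw [← uIcc_of_le hS.le] at cre cim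
  have e : ∀ z : ℂ, ‖z‖ ^ 2 = z.re ^ 2 + z.im ^ 2 := fun z => by
    rw [← Complex.normSq_eq_norm_sq, Complex.normSq_apply]; ring
  simp_rw [e]
  have jre : IntervalIntegrable (fun s => (f s).re ^ 2) volume 0 S := (cre.pow 2).intervalIntegrable
  have jim : IntervalIntegrable (fun s => (f s).im ^ 2) volume 0 S := (cim.pow 2).intervalIntegrable
  rw [intervalIntegral.integral_add jre jim, intervalIntegral.integral_add ire2 iim2]
  linarith

theorem summable_integral_of_sum_le {ι α : Type*} {m : MeasurableSpace α} {μ : Measure α}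
    {F : ι → α → ℝ} {N : α → ℝ}
    (hF : ∀ k, Integrable (F k) μ) (hF0 : ∀ k t, 0 ≤ F k t) (hN : Integrable N μ)
    (h : ∀ᵐ t ∂μ, Summable (fun k => F k t) ∧ ∑' k, F k t ≤ N t) :
    Summable fun k => ∫ t, F k t ∂μ := by
  refine summable_of_sum_le (c := ∫ t, N t ∂μ) (fun k => integral_nonneg (hF0 k)) fun s => ?_
  rw [← integral_finsetSum _ fun k _ => hF k]
  refine integral_mono_ae (integrable_finsetSum _ fun k _ => hF k) hN ?_
  filter_upwards [h] with t ht
  exact (ht.1.sum_le_tsum s fun k _ => hF0 k t).trans ht.2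

/-- The information on the Fourier coefficients of a function in
`L²(0, S; V³) ∩ H¹(0, S; H¹)` and of its time derivative `u'` on which its regularity rests. -/
structure SobolevBounds (L : Space) (S : ℝ) (u u' : ℝ → Space → ℝ) : Prop where
  sqInt : SqInt L S u
  sqInt' : SqInt L S u'
  weak : WeakTimeDeriv L S u u'
  per : ∀ᵐ t ∂volume.restrict (Ioo 0 S), IsPeriodic L (u t)
  third : ∀ j, ∃ g, SqInt L S g ∧ ∀ᵐ t ∂volume.restrict (Ioo 0 S), ∀ k,
    ‖coeff L (g t) k‖ = |wave L k j| ^ 3 * ‖coeff L (u t) k‖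
  deriv : ∀ j, ∃ g, SqInt L S g ∧ ∀ᵐ t ∂volume.restrict (Ioo 0 S), ∀ k,
    ‖coeff L (g t) k‖ = |wave L k j| * ‖coeff L (u' t) k‖

/-- The `H³` norm of `u` is square integrable in time, in terms of Fourier coefficients. -/
theorem SobolevBounds.exists_bound_third (hL : ∀ i, 0 < L i) {u u' : ℝ → Space → ℝ}
    (h : SobolevBounds L S u u') : ∃ N : ℝ → ℝ, IntegrableOn N (Ioo 0 S) ∧
      ∀ᵐ t ∂volume.restrict (Ioo 0 S),
        Summable (fun k => weight L k ^ 3 * ‖coeff L (u t) k‖ ^ 2) ∧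
        ∑' k, weight L k ^ 3 * ‖coeff L (u t) k‖ ^ 2 ≤ N t := by
  choose g hg hgc using h.third
  refine ⟨fun t => 16 * ((boxVol L)⁻¹ * (∫ x in box L, u t x ^ 2) +
    ∑ j, (boxVol L)⁻¹ * ∫ x in box L, g j t x ^ 2), ?_, ?_⟩
  · exact ((h.sqInt.integrable_integral_sq.const_mul _).add (integrable_finsetSum _ fun j _ =>
      (hg j).integrable_integral_sq.const_mul _)).const_mul _
  · filter_upwards [h.sqInt.ae_memLp, ae_all_iff.2 fun j => (hg j).ae_memLp, ae_all_iff.2 hgc]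
      with t h1 h2 h3
    have s := ((hasSum_sq_coeff hL h1).add (hasSum_sum (s := Finset.univ)
      fun j _ => hasSum_sq_coeff hL (h2 j))).mul_left 16
    have hle : ∀ k, weight L k ^ 3 * ‖coeff L (u t) k‖ ^ 2 ≤
        16 * (‖coeff L (u t) k‖ ^ 2 + ∑ j, ‖coeff L (g j t) k‖ ^ 2) := by
      intro k
      have := mul_le_mul_of_nonneg_right (weight_pow_three_le (L := L) k)
        (sq_nonneg ‖coeff L (u t) k‖)
      refine this.trans (le_of_eq ?_)
      simp_rw [h3, mul_pow]
      rw [← Finset.sum_mul]; ring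
    have hsum : Summable fun k => weight L k ^ 3 * ‖coeff L (u t) k‖ ^ 2 :=
      s.summable.of_nonneg_of_le (fun k => by have := weight_pos (L := L) k; positivity) hle
    exact ⟨hsum, hasSum_le hle hsum.hasSum s⟩

/-- The `H¹` norm of `u'` is square integrable in time, in terms of Fourier coefficients. -/
theorem SobolevBounds.exists_bound_deriv (hL : ∀ i, 0 < L i) {u u' : ℝ → Space → ℝ}
    (h : SobolevBounds L S u u') : ∃ N : ℝ → ℝ, IntegrableOn N (Ioo 0 S) ∧
      ∀ᵐ t ∂volume.restrict (Ioo 0 S),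
        Summable (fun k => weight L k * ‖coeff L (u' t) k‖ ^ 2) ∧
        ∑' k, weight L k * ‖coeff L (u' t) k‖ ^ 2 ≤ N t := by
  choose g hg hgc using h.deriv
  refine ⟨fun t => (boxVol L)⁻¹ * (∫ x in box L, u' t x ^ 2) +
    ∑ j, (boxVol L)⁻¹ * ∫ x in box L, g j t x ^ 2, ?_, ?_⟩
  · exact (h.sqInt'.integrable_integral_sq.const_mul _).add (integrable_finsetSum _ fun j _ =>
      (hg j).integrable_integral_sq.const_mul _)
  · filter_upwards [h.sqInt'.ae_memLp, ae_all_iff.2 fun j => (hg j).ae_memLp, ae_all_iff.2 hgc]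
      with t h1 h2 h3
    have s := (hasSum_sq_coeff hL h1).add (hasSum_sum (s := Finset.univ)
      fun j _ => hasSum_sq_coeff hL (h2 j))
    have heq : ∀ k, ‖coeff L (u' t) k‖ ^ 2 + ∑ j, ‖coeff L (g j t) k‖ ^ 2 =
        weight L k * ‖coeff L (u' t) k‖ ^ 2 := by
      intro k
      simp_rw [h3, mul_pow, sq_abs]
      rw [← Finset.sum_mul, weight]; ring
    simp_rw [heq] at s
    exact ⟨s.summable, s.tsum_eq.le⟩

end

section

variable {L : Space} {S : ℝ}

/-! ### The regular representative -/

/-- `ũ` is a regular representative of `u` on `[0, S]`: it is continuous and periodic, for almost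
every `x` it is a primitive of `u'` in time, and for almost every time it is continuously
differentiable in space with derivatives bounded by a function `A` in `L²(0, S)`. -/
structure IsRegularRep (L : Space) (S : ℝ) (u u' ũ : ℝ → Space → ℝ) (A : ℝ → ℝ) : Prop where
  cont : ContinuousOn (fun p : ℝ × Space => ũ p.1 p.2) (Icc 0 S ×ˢ univ)
  per : ∀ t x (i : Fin 3) (n : ℤ), ũ t (x + Pi.single i (n * L i)) = ũ t x
  sqInt : SqInt L S u'
  prim : ∀ᵐ x ∂volume.restrict (box L), ∀ t ∈ Icc 0 S,
    ũ t x = ũ 0 x + ∫ s in (0 : ℝ)..t, u' s x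
  nonneg : ∀ t, 0 ≤ A t
  bound_sq : IntegrableOn (fun t => A t ^ 2) (Ioo 0 S)
  ae_time : ∀ᵐ t ∂volume.restrict (Ioo 0 S), u t =ᵐ[volume] ũ t ∧ ContDiff ℝ 1 (ũ t) ∧
    ∀ j x, |partialDeriv j (ũ t) x| ≤ A t

theorem char_add_single (hL : ∀ i, 0 < L i) (k : Fin 3 → ℤ) (x : Space) (i : Fin 3) (n : ℤ) :
    char L k (x + Pi.single i (n * L i)) = char L k x := by
  have h : toTorus L (x + Pi.single i (n * L i)) = toTorus L x := by
    ext j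
    simp only [toTorus, Pi.add_apply]
    by_cases hj : j = i
    · subst hj
      rw [Pi.single_eq_same, add_div, mul_div_cancel_right₀ _ (hL j).ne', AddCircle.coe_add]
      have : ((n : ℝ) : UnitAddCircle) = 0 :=
        (AddCircle.coe_eq_zero_iff (p := (1 : ℝ))).2 ⟨n, by simp⟩
      rw [this, add_zero]
    · rw [Pi.single_eq_of_ne hj, add_zero]
  rw [char_eq_mFourier, char_eq_mFourier, h]

theorem sq_integral_le {f : ℝ → ℝ} {t : ℝ} (ht : 0 < t) (hf : IntegrableOn f (Ioo 0 t))
    (hf2 : IntegrableOn (fun s => f s ^ 2) (Ioo 0 t)) :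
    (∫ s in Ioo 0 t, f s) ^ 2 ≤ t * ∫ s in Ioo 0 t, f s ^ 2 := by
  set m := ∫ s in Ioo 0 t, f s with hm
  have h0 : 0 ≤ ∫ s in Ioo 0 t, (t * f s - m) ^ 2 := integral_nonneg fun s => sq_nonneg _
  have e : ∫ s in Ioo 0 t, (t * f s - m) ^ 2 =
      t ^ 2 * (∫ s in Ioo 0 t, f s ^ 2) - 2 * t * m * m + t * m ^ 2 := by
    have e1 : ∀ s, (t * f s - m) ^ 2 = t ^ 2 * f s ^ 2 - 2 * t * m * f s + m ^ 2 := fun s => by ring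
    simp_rw [e1]
    have hc : IntegrableOn (fun _ : ℝ => m ^ 2) (Ioo 0 t) := by simp
    have i3 : IntegrableOn (fun s => t ^ 2 * f s ^ 2 - 2 * t * m * f s) (Ioo 0 t) :=
      (hf2.const_mul _).sub (hf.const_mul _)
    rw [integral_add i3 hc,
      integral_sub (hf2.const_mul _) (hf.const_mul _), integral_const_mul, integral_const_mul, ← hm,
      setIntegral_const]
    simp [ht.le]
  rw [e] at h0
  have : 0 ≤ t * (t * (∫ s in Ioo 0 t, f s ^ 2) - m ^ 2) := by linarith
  have := nonneg_of_mul_nonneg_right this ht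
  linarith

theorem SqInt.memLp_integral {u : ℝ → Space → ℝ} (hS : 0 < S) (hu : SqInt L S u) :
    MemLp (fun x => ∫ s in Ioo 0 S, u s x) 2 (volume.restrict (box L)) := by
  have hm : AEStronglyMeasurable (fun x => ∫ s in Ioo 0 S, u s x) (volume.restrict (box L)) :=
    (Integrable.integral_prod_right hu.integrable).aestronglyMeasurable
  rw [memLp_two_iff_integrable_sq hm]
  have h2 : Integrable (fun p : ℝ × Space => u p.1 p.2 ^ 2) (cylinder L S) := MemLp.integrable_sq hu
  refine ((h2.integral_prod_right).const_mul S).mono' (hm.pow 2) ?_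
  filter_upwards [hu.ae_integrableOn, h2.prod_left_ae] with x h1 h3
  rw [Real.norm_of_nonneg (sq_nonneg _)]
  exact sq_integral_le hS h1 h3

theorem coeff_integral {u : ℝ → Space → ℝ} (hu : SqInt L S u) (k : Fin 3 → ℤ) :
    coeff L (fun x => ∫ s in Ioo 0 S, u s x) k = ∫ s in Ioo 0 S, coeff L (u s) k := by
  have := hu.integral_swap (φ := fun _ => 1) (C := 1) continuous_const (by simp)
    (continuous_char (L := L) (-k)) fun x => (norm_char _ x).le
  simp only [one_smul, mul_one] at this
  simp_rw [coeff_eq_smul]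
  rw [integral_smul, this]

theorem coeff_sub {f g : Space → ℝ} (hf : IntegrableOn f (box L)) (hg : IntegrableOn g (box L))
    (k : Fin 3 → ℤ) : coeff L (fun x => f x - g x) k = coeff L f k - coeff L g k := by
  have hi : ∀ {f : Space → ℝ}, IntegrableOn f (box L) →
      IntegrableOn (fun x => f x • char L (-k) x) (box L) := fun hf =>
    hf.smul_bdd 1 (continuous_char _).aestronglyMeasurable
      (Eventually.of_forall fun x => (norm_char _ x).le)
  simp_rw [coeff_eq_smul, sub_smul]
  rw [integral_sub (hi hf) (hi hg), smul_sub]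

/-- A function whose Fourier coefficients satisfy the bounds `SobolevBounds` has a regular
representative, namely the sum of its Fourier series. -/
theorem SobolevBounds.exists_regularRep (hL : ∀ i, 0 < L i) (hS : 0 < S) {u u' : ℝ → Space → ℝ}
    (h : SobolevBounds L S u u') : ∃ ũ A, IsRegularRep L S u u' ũ A := by
  obtain ⟨N, hN, hNb⟩ := h.exists_bound_third hL
  obtain ⟨N', hN', hNb'⟩ := h.exists_bound_deriv hL
  choose c hc using fun k => h.weak.exists_coeff_primitive hS h.sqInt h.sqInt' k
  have hc := ae_all_iff.2 hc
  -- the continuous representatives of the Fourier coefficients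
  set α : (Fin 3 → ℤ) → ℝ → ℂ := fun k t => c k + ∫ s in (0 : ℝ)..t, coeff L (u' s) k with hα
  have hii : ∀ k, IntervalIntegrable (fun s => coeff L (u' s) k) volume 0 S := fun k =>
    (intervalIntegrable_iff_integrableOn_Ioo_of_le hS.le).2 (h.sqInt'.integrable_coeff k)
  have hii2 : ∀ k, IntervalIntegrable (fun s => ‖coeff L (u' s) k‖ ^ 2) volume 0 S := fun k =>
    (intervalIntegrable_iff_integrableOn_Ioo_of_le hS.le).2 (h.sqInt'.integrable_normSq_coeff hL k)
  have hα0 : ∀ k t, α k t = α k 0 + ∫ s in (0 : ℝ)..t, coeff L (u' s) k := fun k t => by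
    simp [hα]
  have hαc : ∀ k, ContinuousOn (α k) (Icc 0 S) := fun k => by
    have := intervalIntegral.continuousOn_primitive_interval' (hii k) (a := 0) (by simp)
    rw [uIcc_of_le hS.le] at this
    exact continuousOn_const.add this
  -- a summable bound of the coefficients that is uniform in time
  set P : (Fin 3 → ℤ) → ℝ := fun k => ∫ t in Ioo 0 S, weight L k ^ 3 * ‖coeff L (u t) k‖ ^ 2 with hP
  set Q : (Fin 3 → ℤ) → ℝ := fun k => ∫ t in Ioo 0 S, weight L k * ‖coeff L (u' t) k‖ ^ 2 with hQ
  have hPs : Summable P := summable_integral_of_sum_le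
    (fun k => (h.sqInt.integrable_normSq_coeff hL k).const_mul _)
    (fun k t => by have := weight_pos (L := L) k; positivity) hN hNb
  have hQs : Summable Q := summable_integral_of_sum_le
    (fun k => (h.sqInt'.integrable_normSq_coeff hL k).const_mul _)
    (fun k t => by have := weight_pos (L := L) k; positivity) hN' hNb'
  set B : (Fin 3 → ℤ) → ℝ := fun k => 1 / 2 * ((weight L k ^ 2)⁻¹ + ((S⁻¹ + 1) * P k + Q k)) with hB
  have hBs : Summable B :=
    ((summable_weight hL).add ((hPs.mul_left _).add hQs)).mul_left _
  have hαB : ∀ k, ∀ t ∈ Icc 0 S, ‖α k t‖ ≤ B k := by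
    intro k t ht
    have hw := weight_pos (L := L) k
    have hw1 := one_le_weight (L := L) k
    -- the parameter of the Sobolev inequality in time is the weight itself
    have b := normSq_le_of_primitive hS hw (hii k) (hii2 k) (fun s _ => hα0 k s) ht
    have e1 : ∫ s in (0 : ℝ)..S, ‖α k s‖ ^ 2 = ∫ s in Ioo 0 S, ‖coeff L (u s) k‖ ^ 2 := by
      rw [intervalIntegral.integral_of_le hS.le, integral_Ioc_eq_integral_Ioo]
      refine integral_congr_ae ?_
      filter_upwards [hc] with s hs
      rw [hs k]
    rw [e1, intervalIntegral.integral_of_le hS.le, integral_Ioc_eq_integral_Ioo] at b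
    set p := ∫ s in Ioo 0 S, ‖coeff L (u s) k‖ ^ 2 with hp
    set q := ∫ s in Ioo 0 S, ‖coeff L (u' s) k‖ ^ 2 with hq
    have hp0 : 0 ≤ p := integral_nonneg fun s => by positivity
    have hPp : P k = weight L k ^ 3 * p := by rw [hP, hp, ← integral_const_mul]
    have hQq : Q k = weight L k * q := by rw [hQ, hq, ← integral_const_mul]
    have b1 : weight L k ^ 2 * ‖α k t‖ ^ 2 ≤ (S⁻¹ + 1) * P k + Q k := by
      rw [hPp, hQq]
      calc weight L k ^ 2 * ‖α k t‖ ^ 2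
          ≤ weight L k ^ 2 * ((S⁻¹ + weight L k) * p + (weight L k)⁻¹ * q) := by gcongr
        _ = (S⁻¹ * weight L k ^ 2 + weight L k ^ 3) * p + weight L k * q := by field_simp
        _ ≤ (S⁻¹ * weight L k ^ 3 + weight L k ^ 3) * p + weight L k * q := by
            have : weight L k ^ 2 ≤ weight L k ^ 3 := pow_le_pow_right₀ hw1 (by norm_num)
            gcongr
        _ = _ := by ring
    have e2 : (weight L k ^ 2)⁻¹ + weight L k ^ 2 * ‖α k t‖ ^ 2 - 2 * ‖α k t‖ =
        ((weight L k)⁻¹ - weight L k * ‖α k t‖) ^ 2 := by field_simp; ring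
    have := sq_nonneg ((weight L k)⁻¹ - weight L k * ‖α k t‖)
    rw [hB]; simp only
    linarith
  set ũ : ℝ → Space → ℝ := fun t x => (∑' k, α k t * char L k x).re with hũ
  have hbd : ∀ k, ∀ p ∈ Icc 0 S ×ˢ (univ : Set Space), ‖α k p.1 * char L k p.2‖ ≤ B k := by
    intro k p hp
    rw [norm_mul, norm_char, mul_one]; exact hαB k p.1 hp.1
  have hcont : ContinuousOn (fun p : ℝ × Space => ũ p.1 p.2) (Icc 0 S ×ˢ univ) := by
    refine Complex.continuous_re.comp_continuousOn (continuousOn_tsum (fun k => ?_) hBs hbd)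
    exact ((hαc k).comp continuousOn_fst fun p hp => hp.1).mul
      ((continuous_char k).comp_continuousOn continuousOn_snd)
  have hαs : ∀ t ∈ Icc 0 S, Summable fun k => ‖α k t‖ := fun t ht =>
    hBs.of_nonneg_of_le (fun k => norm_nonneg _) fun k => hαB k t ht
  have hũb : ∀ t ∈ Icc 0 S, ∀ x, ‖ũ t x‖ ≤ ∑' k, B k := fun t ht x =>
    (Complex.abs_re_le_norm _).trans (tsum_of_norm_bounded hBs.hasSum fun k => hbd k (t, x) ⟨ht, trivial⟩)
  have hũc : ∀ t ∈ Icc 0 S, Continuous (ũ t) := fun t ht => by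
    rw [← continuousOn_univ]
    exact hcont.comp (f := fun x => (t, x)) (by fun_prop) fun x _ => ⟨ht, trivial⟩
  -- for almost every time, the series represents `u`
  have hrep : ∀ᵐ t ∂volume.restrict (Ioo 0 S), u t =ᵐ[volume.restrict (box L)] ũ t := by
    filter_upwards [hc, h.sqInt.ae_memLp, ae_restrict_mem measurableSet_Ioo] with t h1 h2 ht
    have h1' : ∀ k, coeff L (u t) k = α k t := h1
    have ht' : t ∈ Icc 0 S := ⟨ht.1.le, ht.2.le⟩
    have := ae_eq_tsum_coeff hL h2 (by simp_rw [h1']; exact hαs t ht')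
    filter_upwards [this] with x hx
    simp_rw [h1'] at hx
    rw [hũ]; simp only; rw [← hx, Complex.ofReal_re]
  have hper : ∀ t x (i : Fin 3) (n : ℤ), ũ t (x + Pi.single i (n * L i)) = ũ t x := fun t x i n => by
    rw [hũ]; simp only [char_add_single hL]
  -- the Fourier coefficients of the series, at every time
  have hcoeff : ∀ k, ∀ t ∈ Icc 0 S, coeff L (ũ t) k = α k t := by
    intro k
    refine Measure.eqOn_Icc_of_ae_eq volume hS.ne (f := fun t => coeff L (ũ t) k) ?_ ?_ (hαc k)
    · rw [← restrict_Ioo_eq_restrict_Icc]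
      filter_upwards [hc, hrep] with t h1 h2
      rw [← show coeff L (u t) k = α k t from h1 k, coeff, coeff]
      congr 1
      refine integral_congr_ae ?_
      filter_upwards [h2] with x hx
      rw [hx]
    · simp_rw [coeff_eq_smul]
      refine ContinuousOn.const_smul (g := fun t => ∫ x in box L, ũ t x • char L (-k) x) ?_
        (boxVol L)⁻¹
      refine continuousOn_of_dominated (bound := fun _ => ∑' k, B k) (fun t ht => ?_)
        (fun t ht => Eventually.of_forall fun x => ?_) (integrable_const _)
        (Eventually.of_forall fun x => ?_)
      · exact ((hũc t ht).smul (continuous_char _)).aestronglyMeasurable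
      · rw [norm_smul, norm_char, mul_one]; exact hũb t ht x
      · have : ContinuousOn (fun t => ũ t x) (Icc 0 S) :=
          hcont.comp (f := fun t : ℝ => (t, x)) (by fun_prop) fun t ht => ⟨ht, trivial⟩
        exact this.smul continuousOn_const
  have hmem : ∀ t ∈ Icc 0 S, MemLp (ũ t) 2 (volume.restrict (box L)) := fun t ht =>
    MemLp.of_bound (hũc t ht).aestronglyMeasurable _ (Eventually.of_forall fun x => hũb t ht x)
  have h0S : (0 : ℝ) ∈ Icc 0 S := ⟨le_rfl, hS.le⟩
  -- both sides have the same Fourier coefficients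
  have hprim_t : ∀ t ∈ Icc 0 S, ∀ᵐ x ∂volume.restrict (box L),
      ũ t x = ũ 0 x + ∫ s in (0 : ℝ)..t, u' s x := by
    intro t ht
    rcases ht.1.eq_or_lt with h0 | h0
    · subst h0; simp
    have hut := h.sqInt'.mono ht.2
    have hD := hut.memLp_integral h0
    have hd : MemLp (fun x => (ũ t x - ũ 0 x) - ∫ s in Ioo 0 t, u' s x) 2 (volume.restrict (box L)) :=
      ((hmem t ht).sub (hmem 0 h0S)).sub hD
    have hz := ae_eq_zero_of_coeff hL hd fun k => by
      have i1 : IntegrableOn (ũ t) (box L) := (hmem t ht).integrable (by norm_num)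
      have i0 : IntegrableOn (ũ 0) (box L) := (hmem 0 h0S).integrable (by norm_num)
      have iD : IntegrableOn (fun x => ∫ s in Ioo 0 t, u' s x) (box L) := hD.integrable (by norm_num)
      have i10 : IntegrableOn (fun x => ũ t x - ũ 0 x) (box L) := i1.sub i0
      rw [coeff_sub i10 iD, coeff_sub i1 i0, hcoeff k t ht, hcoeff k 0 h0S, coeff_integral hut,
        hα0 k t, intervalIntegral.integral_of_le ht.1, integral_Ioc_eq_integral_Ioo]
      ring
    filter_upwards [hz] with x hx
    rw [intervalIntegral.integral_of_le ht.1, integral_Ioc_eq_integral_Ioo]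
    linarith
  have hprim : ∀ᵐ x ∂volume.restrict (box L), ∀ t ∈ Icc 0 S,
      ũ t x = ũ 0 x + ∫ s in (0 : ℝ)..t, u' s x := by
    -- exchange the quantifiers by taking a countable dense set of times
    have : Nonempty (Icc 0 S) := ⟨⟨0, h0S⟩⟩
    have hd := ae_all_iff.2 fun n : ℕ =>
      hprim_t (TopologicalSpace.denseSeq (Icc 0 S) n) (TopologicalSpace.denseSeq (Icc 0 S) n).2
    filter_upwards [hd, h.sqInt'.ae_integrableOn] with x h1 h2
    have c1 : Continuous fun t : Icc 0 S => ũ t x := by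
      have : ContinuousOn (fun t => ũ t x) (Icc 0 S) :=
        hcont.comp (f := fun t => (t, x)) (by fun_prop) fun t ht => ⟨ht, trivial⟩
      exact continuousOn_iff_continuous_domRestrict.1 this
    have c2 : Continuous fun t : Icc 0 S => ũ 0 x + ∫ s in (0 : ℝ)..t, u' s x := by
      have i2 : IntervalIntegrable (fun s => u' s x) volume 0 S :=
        (intervalIntegrable_iff_integrableOn_Ioo_of_le hS.le).2 h2
      have := intervalIntegral.continuousOn_primitive_interval' i2 (a := 0) (by simp)
      rw [uIcc_of_le hS.le] at this
      exact continuousOn_iff_continuous_domRestrict.1 (continuousOn_const.add this)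
    have := (TopologicalSpace.denseRange_denseSeq (Icc 0 S)).equalizer c1 c2 (funext h1)
    intro t ht
    exact congrFun this ⟨t, ht⟩
  set Z := ∑' k, (weight L k ^ 2)⁻¹ with hZ
  have hZ0 : 0 ≤ Z := tsum_nonneg fun k => by positivity
  refine ⟨ũ, fun t => 3 / 2 * (Z + 1) * √(1 + max (N t) 0), hcont, hper, h.sqInt', hprim,
    fun t => by positivity, ?_, ?_⟩
  · have e : ∀ t, (3 / 2 * (Z + 1) * √(1 + max (N t) 0)) ^ 2 =
        (3 / 2 * (Z + 1)) ^ 2 * (1 + max (N t) 0) := fun t => by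
      rw [mul_pow, Real.sq_sqrt (by positivity)]
    simp_rw [e]
    have h1 : IntegrableOn (fun _ : ℝ => (1 : ℝ)) (Ioo 0 S) := by simp
    exact (h1.add hN.pos_part).const_mul _
  · filter_upwards [hc, hNb, hrep, h.per, ae_restrict_mem measurableSet_Ioo] with t h1 h2 h3 h4 ht
    have ht' : t ∈ Icc 0 S := ⟨ht.1.le, ht.2.le⟩
    have h1' : ∀ k, coeff L (u t) k = α k t := h1
    simp_rw [h1'] at h2
    have := contDiff_fourierSeries hL h2.1 (h2.2.trans (le_max_left _ 0)) (hαs t ht')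
    refine ⟨h4.ae_eq_of_box hL (fun i n => Eventually.of_forall fun x => hper t x i n) h3, this⟩

end

section

variable {L : Space} {S : ℝ} {T : EReal}

/-! ### Regular representatives of the components of a solution -/

theorem Ioo_subset_timeInterval (hST : (S : EReal) < T) : Ioo 0 S ⊆ timeInterval T :=
  fun _ ht => ⟨ht.1, lt_trans (EReal.coe_lt_coe_iff.2 ht.2) hST⟩

theorem ae_Ioo_of_ae_timeInterval (hST : (S : EReal) < T) {p : ℝ → Prop}
    (h : ∀ᵐ t ∂volume.restrict (timeInterval T), p t) : ∀ᵐ t ∂volume.restrict (Ioo 0 S), p t :=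
  ae_mono (Measure.restrict_mono (Ioo_subset_timeInterval hST) le_rfl) h

theorem weakTimeDeriv_of_hasWeakTimeDeriv (hST : (S : EReal) < T) {u u' : ℝ → Space → ℝ}
    (h : HasWeakTimeDeriv L T u u') : WeakTimeDeriv L S u u' := by
  intro φ hφ hc hs
  have hsub := Ioo_subset_timeInterval hST
  filter_upwards [h φ hφ hc (hs.trans hsub)] with x hx
  have hd : ∀ t, t ∉ Ioo 0 S → deriv φ t = 0 := fun t ht => by
    have : t ∉ tsupport (deriv φ) := fun h' => ht (hs (tsupport_deriv_subset h'))
    exact image_eq_zero_of_notMem_tsupport this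
  have hφ0 : ∀ t, t ∉ Ioo 0 S → φ t = 0 := fun t ht =>
    image_eq_zero_of_notMem_tsupport fun h' => ht (hs h')
  have hcut : ∀ {f g : ℝ → ℝ}, (∀ t, t ∉ Ioo 0 S → g t = 0) →
      ∫ t in Ioo 0 S, f t * g t = ∫ t in timeInterval T, f t * g t := fun hg => by
    rw [setIntegral_eq_integral_of_forall_compl_eq_zero fun t ht => by rw [hg t ht, mul_zero],
      setIntegral_eq_integral_of_forall_compl_eq_zero fun t ht => by
        rw [hg t fun h' => ht (hsub h'), mul_zero]]
  rw [hcut hd, hcut hφ0, hx]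

/-- If the Fourier coefficients of `g` are those of the `j`-th derivative of `u` then the same holds
for the time derivatives, although `g'` need not be a weak derivative of `u'` across the faces of
the box. -/
theorem WeakTimeDeriv.coeff_partial {u u' g g' : ℝ → Space → ℝ} {j : Fin 3}
    (h : WeakTimeDeriv L S u u') (hg : WeakTimeDeriv L S g g')
    (hu : SqInt L S u) (hu' : SqInt L S u') (hgs : SqInt L S g) (hgs' : SqInt L S g')
    (hc : ∀ᵐ t ∂volume.restrict (Ioo 0 S), ∀ k,
      coeff L (g t) k = (wave L k j : ℂ) * Complex.I * coeff L (u t) k) :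
    ∀ᵐ t ∂volume.restrict (Ioo 0 S), ∀ k,
      coeff L (g' t) k = (wave L k j : ℂ) * Complex.I * coeff L (u' t) k := by
  refine ae_all_iff.2 fun k => ?_
  have hi := hgs'.integrable_coeff k
  have hi' := (hu'.integrable_coeff k).const_mul ((wave L k j : ℂ) * Complex.I)
  rw [ae_restrict_iff' measurableSet_Ioo]
  have := isOpen_Ioo.ae_eq_zero_of_integral_contDiff_smul_eq_zero (μ := volume)
    (f := fun t => coeff L (g' t) k - (wave L k j : ℂ) * Complex.I * coeff L (u' t) k)
    (U := Ioo 0 S) (IntegrableOn.locallyIntegrableOn (hi.sub hi')) fun φ hφ hφc hφs => ?_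
  · filter_upwards [this] with t ht hts
    exact sub_eq_zero.1 (ht hts)
  · obtain ⟨C, hC⟩ := bound_of_test hφ.continuous hφc
    have e1 := hg.integral_coeff hgs hgs' k hφ hφc hφs
    have e2 := h.integral_coeff hu hu' k hφ hφc hφs
    have e3 : ∫ t in Ioo 0 S, _root_.deriv φ t • coeff L (g t) k =
        (wave L k j : ℂ) * Complex.I * ∫ t in Ioo 0 S, _root_.deriv φ t • coeff L (u t) k := by
      rw [← integral_const_mul]
      refine integral_congr_ae ?_
      filter_upwards [hc] with t ht
      rw [ht k, mul_smul_comm]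
    have j1 : IntegrableOn (fun t => φ t • coeff L (g' t) k) (Ioo 0 S) :=
      hi.bdd_smul C hφ.continuous.aestronglyMeasurable (Eventually.of_forall hC)
    have j2 : IntegrableOn (fun t => φ t • ((wave L k j : ℂ) * Complex.I * coeff L (u' t) k))
        (Ioo 0 S) :=
      hi'.bdd_smul C hφ.continuous.aestronglyMeasurable (Eventually.of_forall hC)
    rw [← setIntegral_eq_integral_of_forall_compl_eq_zero (s := Ioo 0 S)]
    · simp_rw [smul_sub]
      rw [integral_sub j1 j2]
      simp_rw [← mul_smul_comm]
      rw [integral_const_mul]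
      rw [e3, e2] at e1
      linear_combination e1
    · intro t ht
      rw [image_eq_zero_of_notMem_tsupport fun h' => ht (hφs h'), zero_smul]

theorem ae_coeff_eq (hL : ∀ i, 0 < L i) {u g : ℝ → Space → ℝ} {j : Fin 3}
    (hu : SqInt L S u) (hg : SqInt L S g)
    (hup : ∀ᵐ t ∂volume.restrict (Ioo 0 S), IsPeriodic L (u t))
    (hgp : ∀ᵐ t ∂volume.restrict (Ioo 0 S), IsPeriodic L (g t))
    (h : ∀ᵐ t ∂volume.restrict (Ioo 0 S), HasWeakPartial univ j (u t) (g t)) :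
    ∀ᵐ t ∂volume.restrict (Ioo 0 S), ∀ k,
      coeff L (g t) k = (wave L k j : ℂ) * Complex.I * coeff L (u t) k := by
  filter_upwards [hu.ae_memLp, hg.ae_memLp, hup, hgp, h] with t h1 h2 h3 h4 h5 k
  rw [h5.coeff_eq hL h3 h4 h1 h2, wave]

theorem norm_wave_mul (x : ℝ) (z : ℂ) : ‖(x : ℂ) * Complex.I * z‖ = |x| * ‖z‖ := by
  simp

/-- The functions in `L²(V³) ∩ H¹(H¹)` satisfy the bounds on the Fourier coefficients. The time
derivative is only assumed to have weak derivatives inside the box; that its coefficients behave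
like those of a periodic function is inherited from `u`. -/
theorem sobolevBounds_of_mem (hL : ∀ i, 0 < L i) (hS : 0 < S) (hST : (S : EReal) < T)
    {u : ℝ → Space → ℝ} (h3 : MemL2locV L T 3 u) (h1 : MemH1locH1 L T u) :
    SobolevBounds L S u (timeDeriv L T u) := by
  have hex := h1.2
  have hspec : MemL2locH1 L T (timeDeriv L T u) ∧ HasWeakTimeDeriv L T u (timeDeriv L T u) := by
    rw [timeDeriv, dif_pos hex]
    exact Classical.choose_spec hex
  have hu : SqInt L S u := h1.1.1 S hS hST
  have hu' : SqInt L S (timeDeriv L T u) := hspec.1.1 S hS hST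
  have hw := weakTimeDeriv_of_hasWeakTimeDeriv hST hspec.2
  have hper := ae_Ioo_of_ae_timeInterval hST h3.1.2
  refine ⟨hu, hu', hw, hper, fun j => ?_, fun j => ?_⟩
  · obtain ⟨g1, hg1, hw1⟩ := h3.2 j
    obtain ⟨g2, hg2, hw2⟩ := hg1.2 j
    obtain ⟨g3, hg3, hw3⟩ := hg2.2 j
    have s1 : SqInt L S g1 := hg1.1.1 S hS hST
    have s2 : SqInt L S g2 := hg2.1.1 S hS hST
    have s3 : SqInt L S g3 := hg3.1 S hS hST
    have p1 := ae_Ioo_of_ae_timeInterval hST hg1.1.2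
    have p2 := ae_Ioo_of_ae_timeInterval hST hg2.1.2
    have p3 := ae_Ioo_of_ae_timeInterval hST hg3.2
    refine ⟨g3, s3, ?_⟩
    filter_upwards [ae_coeff_eq hL hu s1 hper p1 (ae_Ioo_of_ae_timeInterval hST hw1),
      ae_coeff_eq hL s1 s2 p1 p2 (ae_Ioo_of_ae_timeInterval hST hw2),
      ae_coeff_eq hL s2 s3 p2 p3 (ae_Ioo_of_ae_timeInterval hST hw3)] with t e1 e2 e3 k
    rw [e3, norm_wave_mul, e2, norm_wave_mul, e1, norm_wave_mul]
    ring
  · obtain ⟨g, hg, hwg⟩ := h3.2 j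
    obtain ⟨g', hg', hwg'⟩ := hspec.1.2 j
    have s1 : SqInt L S g := hg.1.1 S hS hST
    have s2 : SqInt L S g' := hg' S hS hST
    have hwg := ae_Ioo_of_ae_timeInterval hST hwg
    have hg2 := hw.partial hu hu' s1 s2 hwg (ae_Ioo_of_ae_timeInterval hST hwg')
    refine ⟨g', s2, ?_⟩
    filter_upwards [hw.coeff_partial hg2 hu hu' s1 s2
      (ae_coeff_eq hL hu s1 hper (ae_Ioo_of_ae_timeInterval hST hg.1.2) hwg)] with t ht k
    rw [ht, norm_wave_mul]

/-! ### Periodic continuous functions -/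

/-- Exact periodicity with respect to the box. -/
def PeriodicFun (L : Space) (f : Space → ℝ) : Prop :=
  ∀ x (i : Fin 3) (n : ℤ), f (x + Pi.single i (n * L i)) = f x

theorem PeriodicFun.isPeriodic {f : Space → ℝ} (h : PeriodicFun L f) : IsPeriodic L f :=
  fun i n => Eventually.of_forall fun x => h x i n

theorem PeriodicFun.add_lattice {f : Space → ℝ} (h : PeriodicFun L f) (n : Fin 3 → ℤ) (x : Space) :
    f (x + fun i => n i * L i) = f x := by
  have e : (fun i => (n i : ℝ) * L i) = Pi.single 0 (n 0 * L 0) +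
      (Pi.single 1 (n 1 * L 1) + Pi.single 2 (n 2 * L 2)) := by
    ext i; fin_cases i <;> simp
  rw [e, ← add_assoc, ← add_assoc, h, h, h]

theorem exists_mem_Icc_periodic (hL : ∀ i, 0 < L i) (x : Space) :
    ∃ y ∈ Icc 0 L, ∀ f, PeriodicFun L f → f y = f x := by
  obtain ⟨n, hn⟩ := exists_ofTorus_toTorus hL x
  refine ⟨ofTorus L (toTorus L x), ?_, fun f hf => by rw [hn, hf.add_lattice]⟩
  have hmem : ∀ i, ((AddCircle.equivIoc (1 : ℝ) 0 (toTorus L x i)).1) ∈ Ioc (0 : ℝ) 1 := fun i => by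
    simpa using (AddCircle.equivIoc (1 : ℝ) 0 (toTorus L x i)).2
  exact ⟨fun i => mul_nonneg (hL i).le (hmem i).1.le,
    fun i => mul_le_of_le_one_right (hL i).le (hmem i).2⟩

theorem Icc_subset_closure_box (hL : ∀ i, 0 < L i) : Icc 0 L ⊆ closure (box L) := by
  rw [box, closure_pi_set]
  intro x hx i _
  change x i ∈ closure (Ioo 0 (L i))
  rw [closure_Ioo (hL i).ne]
  exact ⟨hx.1 i, hx.2 i⟩

theorem box_subset_Icc : box L ⊆ Icc 0 L := fun _ hx =>
  ⟨fun i => (hx i (mem_univ i)).1.le, fun i => (hx i (mem_univ i)).2.le⟩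

/-- A closed condition that holds almost everywhere on the box holds everywhere for periodic
continuous functions. -/
theorem forall_of_ae_box (hL : ∀ i, 0 < L i) {f : Space → ℝ} (hp : PeriodicFun L f)
    (hf : Continuous f) {s : Set ℝ} (hs : IsClosed s)
    (h : ∀ᵐ x ∂volume.restrict (box L), f x ∈ s) (x : Space) : f x ∈ s := by
  have hbox : ∀ y ∈ box L, f y ∈ s := by
    intro y hy
    by_contra hcon
    have hopen : IsOpen (box L ∩ f ⁻¹' sᶜ) := isOpen_box.inter (hs.isOpen_compl.preimage hf)
    have hpos := hopen.measure_pos (volume : Measure Space) ⟨y, hy, hcon⟩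
    rw [ae_restrict_iff' measurableSet_box] at h
    refine hpos.ne' (measure_mono_null ?_ h)
    rintro z ⟨hz, hz'⟩ hz''
    exact hz' (hz'' hz)
  obtain ⟨y, hy, hyf⟩ := exists_mem_Icc_periodic hL x
  rw [← hyf f hp]
  have : closure (box L) ⊆ f ⁻¹' s := closure_minimal hbox (hs.preimage hf)
  exact this (Icc_subset_closure_box hL hy)

variable {u u' ũ : ℝ → Space → ℝ} {A : ℝ → ℝ}

theorem IsRegularRep.periodicFun (h : IsRegularRep L S u u' ũ A) (t : ℝ) : PeriodicFun L (ũ t) :=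
  h.per t

theorem IsRegularRep.continuous (h : IsRegularRep L S u u' ũ A) {t : ℝ} (ht : t ∈ Icc 0 S) :
    Continuous (ũ t) := by
  rw [← continuousOn_univ]
  exact h.cont.comp (f := fun x => (t, x)) (by fun_prop) fun x _ => ⟨ht, trivial⟩

theorem exists_bound_of_periodic (hL : ∀ i, 0 < L i) {ψ : ℝ → Space → ℝ}
    (hc : ContinuousOn (fun p : ℝ × Space => ψ p.1 p.2) (Icc 0 S ×ˢ univ))
    (hp : ∀ t, PeriodicFun L (ψ t)) : ∃ M, 0 ≤ M ∧ ∀ t ∈ Icc 0 S, ∀ x, |ψ t x| ≤ M := by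
  obtain ⟨M, hM⟩ := (isCompact_Icc.prod isCompact_Icc).exists_bound_of_continuousOn
    (hc.mono (prod_mono_right (subset_univ (Icc 0 L))))
  refine ⟨max M 0, le_max_right _ _, fun t ht x => ?_⟩
  obtain ⟨y, hy, hyf⟩ := exists_mem_Icc_periodic hL x
  rw [← hyf _ (hp t)]
  exact (hM (t, y) ⟨ht, hy⟩).trans (le_max_left _ _)

theorem IsRegularRep.exists_bound (hL : ∀ i, 0 < L i) (h : IsRegularRep L S u u' ũ A) :
    ∃ M, 0 ≤ M ∧ ∀ t ∈ Icc 0 S, ∀ x, |ũ t x| ≤ M :=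
  exists_bound_of_periodic hL h.cont h.periodicFun

theorem IsRegularRep.exists_delta (hL : ∀ i, 0 < L i) (h : IsRegularRep L S u u' ũ A)
    {ε : ℝ} (hε : 0 < ε) : ∃ δ > 0, ∀ t ∈ Icc 0 S, ∀ s ∈ Icc 0 S, |t - s| < δ →
      ∀ x, |ũ t x - ũ s x| < ε := by
  have huc := (isCompact_Icc.prod isCompact_Icc).uniformContinuousOn_of_continuous
    (h.cont.mono (prod_mono_right (subset_univ (Icc 0 L))))
  obtain ⟨δ, hδ, hd⟩ := Metric.uniformContinuousOn_iff.1 huc ε hε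
  refine ⟨δ, hδ, fun t ht s hs hts x => ?_⟩
  obtain ⟨y, hy, hyf⟩ := exists_mem_Icc_periodic hL x
  rw [← hyf _ (h.periodicFun t), ← hyf _ (h.periodicFun s)]
  have := hd (t, y) ⟨ht, hy⟩ (s, y) ⟨hs, hy⟩ (by simpa [Prod.dist_eq, Real.dist_eq, hδ] using hts)
  simpa [Real.dist_eq] using this

/-- The regular representative attains the initial value. -/
theorem IsRegularRep.initial_value (hL : ∀ i, 0 < L i) (hS : 0 < S) (h : IsRegularRep L S u u' ũ A)
    {u₀ : Space → ℝ} (hu₀ : AEStronglyMeasurable u₀ (volume.restrict (box L)))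
    (hi : HasInitialValue L u u₀) : ũ 0 =ᵐ[volume.restrict (box L)] u₀ := by
  have h0 : (0 : ℝ) ∈ Icc 0 S := ⟨le_rfl, hS.le⟩
  set l : Filter ℝ := 𝓝[>] (0 : ℝ) ⊓ ae volume with hl
  have hne : l.NeBot := by
    rw [hl, inf_neBot_iff]
    intro s hs s' hs'
    obtain ⟨δ, hδ, hsub⟩ := mem_nhdsGT_iff_exists_Ioo_subset.1 hs
    by_contra hcon
    rw [not_nonempty_iff_eq_empty] at hcon
    have : Ioo 0 δ ⊆ s'ᶜ := fun x hx hx' => by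
      have : x ∈ s ∩ s' := ⟨hsub hx, hx'⟩
      rw [hcon] at this; exact this
    have hz := measure_mono_null this (mem_ae_iff.1 hs')
    rw [Real.volume_Ioo, ENNReal.ofReal_eq_zero] at hz
    simp only [mem_Ioi] at hδ
    linarith
  have hIoo : ∀ δ > 0, ∀ᶠ t in l, t ∈ Ioo 0 δ := fun δ hδ =>
    Filter.mem_inf_of_left (Ioo_mem_nhdsGT hδ)
  have hae : ∀ᶠ t in l, t ∈ Ioo 0 S → u t =ᵐ[volume] ũ t := by
    have := (ae_restrict_iff' measurableSet_Ioo).1 (h.ae_time.mono fun t ht => ht.1)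
    exact Filter.mem_inf_of_right this
  have key : eLpNorm (fun x => ũ 0 x - u₀ x) 2 (volume.restrict (box L)) = 0 := by
    set c := volume.restrict (box L) univ ^ ((2 : ENNReal).toReal⁻¹) with hc
    have hctop : c ≠ ⊤ := ENNReal.rpow_ne_top_of_nonneg (by positivity) (measure_ne_top _ _)
    -- the distance to the value at time `t` is small uniformly in space
    have hlim : Tendsto (fun t => eLpNorm (fun x => ũ 0 x - ũ t x) 2 (volume.restrict (box L)))
        l (𝓝 0) := by
      rw [ENNReal.tendsto_nhds_zero]
      intro ε hε
      obtain ⟨η, hη, hηε⟩ : ∃ η : ℝ, 0 < η ∧ c * ENNReal.ofReal η ≤ ε := by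
        have ht : Tendsto (fun η : ℝ => c * ENNReal.ofReal η) (𝓝[>] 0) (𝓝 (c * ENNReal.ofReal 0)) :=
          (ENNReal.Tendsto.const_mul (ENNReal.continuous_ofReal.tendsto 0)
            (Or.inr hctop)).mono_left nhdsWithin_le_nhds
        rw [ENNReal.ofReal_zero, mul_zero] at ht
        have h2 := (ENNReal.tendsto_nhds_zero.1 ht ε hε).and self_mem_nhdsWithin
        obtain ⟨η, h3, h4⟩ := h2.exists
        exact ⟨η, h4, h3⟩
      obtain ⟨δ, hδ, hd⟩ := h.exists_delta hL hη
      filter_upwards [hIoo δ hδ, hIoo S hS] with t ht htS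
      refine (eLpNorm_le_of_ae_bound (C := η) (Eventually.of_forall fun x => ?_)).trans hηε
      refine (hd 0 h0 t ⟨htS.1.le, htS.2.le⟩ ?_ x).le
      rw [zero_sub, abs_neg, abs_of_pos ht.1]; exact ht.2
    have hsum := hlim.add hi
    rw [add_zero] at hsum
    refine le_antisymm (ge_of_tendsto hsum ?_) bot_le
    filter_upwards [hae, hIoo S hS] with t ht htS
    have htS' : t ∈ Icc 0 S := ⟨htS.1.le, htS.2.le⟩
    have e : eLpNorm (fun x => u t x - u₀ x) 2 (volume.restrict (box L)) =
        eLpNorm (fun x => ũ t x - u₀ x) 2 (volume.restrict (box L)) := by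
      refine eLpNorm_congr_ae (ae_restrict_of_ae ?_)
      filter_upwards [ht htS] with x hx
      rw [hx]
    rw [e]
    have m1 : AEStronglyMeasurable (fun x => ũ 0 x - ũ t x) (volume.restrict (box L)) :=
      ((h.continuous h0).sub (h.continuous htS')).aestronglyMeasurable
    have m2 : AEStronglyMeasurable (fun x => ũ t x - u₀ x) (volume.restrict (box L)) :=
      (h.continuous htS').aestronglyMeasurable.sub hu₀
    have := eLpNorm_add_le m1 m2 (by norm_num : (1 : ENNReal) ≤ 2)
    refine le_trans (le_of_eq ?_) this
    congr 1; ext x; simp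
  have := (eLpNorm_eq_zero_iff ((h.continuous h0).aestronglyMeasurable.sub hu₀) (by norm_num)).1 key
  filter_upwards [this] with x hx
  exact sub_eq_zero.1 hx

theorem MemV.aestronglyMeasurable_box {m : ℕ} {f : Space → ℝ} (h : MemV L m f) :
    AEStronglyMeasurable f (volume.restrict (box L)) := by
  have h2 : MemL2loc f := by
    cases m with
    | zero => exact h.2
    | succ m => exact h.2.1
  exact ((h2 (Icc 0 L) isCompact_Icc).mono_measure
    (Measure.restrict_mono box_subset_Icc le_rfl)).aestronglyMeasurable

end

section

variable {L : Space} {S : ℝ} {T : EReal}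

/-! ### The equations at a fixed time -/

theorem PeriodicFun.partialDeriv {f : Space → ℝ} (h : PeriodicFun L f) (j : Fin 3) :
    PeriodicFun L (partialDeriv j f) := by
  intro x i n
  have e : (fun y => f (y + Pi.single i (n * L i))) = f := funext fun y => h y i n
  unfold Kolmogorov.partialDeriv
  rw [← fderiv_comp_add_right, e]

theorem PeriodicFun.comp {f : Space → ℝ} (h : PeriodicFun L f) (g : ℝ → ℝ) :
    PeriodicFun L fun x => g (f x) := fun x i n => congrArg g (h x i n)

theorem PeriodicFun.comp₂ {f f' : Space → ℝ} (h : PeriodicFun L f) (h' : PeriodicFun L f')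
    (g : ℝ → ℝ → ℝ) : PeriodicFun L fun x => g (f x) (f' x) := fun x i n =>
  congrArg₂ g (h x i n) (h' x i n)

theorem integrableOn_box_of_continuous {f : Space → ℝ} (hf : Continuous f) :
    IntegrableOn f (box L) :=
  (hf.continuousOn.integrableOn_compact isCompact_Icc).mono_set box_subset_Icc

theorem memL2loc_of_continuous {f : Space → ℝ} (hf : Continuous f) : MemL2loc f := fun K hK => by
  have h2 : IntegrableOn (fun x => f x ^ 2) K :=
    (hf.pow 2).continuousOn.integrableOn_compact hK
  exact (memLp_two_iff_integrable_sq hf.aestronglyMeasurable).2 h2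

theorem memV_one {f : Space → ℝ} (hf : ContDiff ℝ 1 f) (hp : PeriodicFun L f) : MemV L 1 f :=
  ⟨hp.isPeriodic, memL2loc_of_continuous hf.continuous, fun i =>
    ⟨partialDeriv i f, hasWeakPartial_of_contDiff i hf,
      memL2loc_of_continuous (continuous_partialDeriv i hf)⟩⟩

theorem weakPartial_ae_eq_partialDeriv {f f' : Space → ℝ} (hf : ContDiff ℝ 1 f)
    (h : f' =ᵐ[volume] f) (i : Fin 3) : weakPartial i f' =ᵐ[volume] partialDeriv i f :=
  weakPartial_ae_eq ((hasWeakPartial_of_contDiff i hf).congr h.symm EventuallyEq.rfl)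

theorem integral_box_partialDeriv (hL : ∀ i, 0 < L i) {f : Space → ℝ} (hf : ContDiff ℝ 1 f)
    (hp : PeriodicFun L f) (i : Fin 3) : ∫ x in box L, partialDeriv i f x = 0 :=
  (hasWeakPartial_of_contDiff i hf).integral_box_eq_zero hL hp.isPeriodic
    (hp.partialDeriv i).isPeriodic

/-- Transport by a solenoidal field preserves the integral. -/
theorem integral_box_transport (hL : ∀ i, 0 < L i) {v : Fin 3 → Space → ℝ} {f : Space → ℝ}
    (hv : ∀ i, ContDiff ℝ 1 (v i)) (hvp : ∀ i, PeriodicFun L (v i))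
    (hdiv : ∀ x, ∑ i, partialDeriv i (v i) x = 0) (hf : ContDiff ℝ 1 f) (hp : PeriodicFun L f) :
    ∫ x in box L, ∑ j, v j x * partialDeriv j f x = 0 := by
  have h1 : ∀ j, ∫ x in box L, partialDeriv j (fun y => v j y * f y) x = 0 := fun j =>
    integral_box_partialDeriv hL ((hv j).mul hf) ((hvp j).comp₂ hp fun a b => a * b) j
  have h2 : ∫ x in box L, ∑ j, partialDeriv j (fun y => v j y * f y) x = 0 := by
    rw [integral_finsetSum _ fun j _ => integrableOn_box_of_continuous
      (continuous_partialDeriv j ((hv j).mul hf))]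
    simp [h1]
  rw [← h2]
  congr 1; ext x
  have e : ∀ j, partialDeriv j (fun y => v j y * f y) x =
      partialDeriv j (v j) x * f x + v j x * partialDeriv j f x := fun j =>
    partialDeriv_mul ((hv j).differentiable one_ne_zero x) (hf.differentiable one_ne_zero x)
  simp_rw [e]
  rw [Finset.sum_add_distrib, ← Finset.sum_mul, hdiv, zero_mul, zero_add]

/-- The classical symmetric gradient. -/
def symPartial (v : Fin 3 → Space → ℝ) (i j : Fin 3) (x : Space) : ℝ :=
  (partialDeriv j (v i) x + partialDeriv i (v j) x) / 2

theorem continuous_symPartial {v : Fin 3 → Space → ℝ} (hv : ∀ i, ContDiff ℝ 1 (v i))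
    (i j : Fin 3) : Continuous (symPartial v i j) :=
  ((continuous_partialDeriv j (hv i)).add (continuous_partialDeriv i (hv j))).div_const 2

theorem symGrad_ae_eq {v v' : Fin 3 → Space → ℝ} (hv : ∀ i, ContDiff ℝ 1 (v i))
    (h : ∀ i, v' i =ᵐ[volume] v i) (i j : Fin 3) :
    symGrad v' i j =ᵐ[volume] symPartial v i j := by
  filter_upwards [weakPartial_ae_eq_partialDeriv (hv i) (h i) j,
    weakPartial_ae_eq_partialDeriv (hv j) (h j) i] with x h1 h2
  rw [symGrad, symPartial, h1, h2]

/-- The equations of the model at a fixed time, for continuously differentiable periodic functions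
`v`, `ω`, `b` and time derivatives `v'`, `ω'`, `b'`, with continuously differentiable test
functions. -/
structure SliceEq (L : Space) (κ : ℝ) (v : Fin 3 → Space → ℝ) (ω b : Space → ℝ)
    (v' : Fin 3 → Space → ℝ) (ω' b' : Space → ℝ) : Prop where
  v_diff : ∀ i, ContDiff ℝ 1 (v i)
  ω_diff : ContDiff ℝ 1 ω
  b_diff : ContDiff ℝ 1 b
  v_per : ∀ i, PeriodicFun L (v i)
  ω_per : PeriodicFun L ω
  b_per : PeriodicFun L b
  v'_int : ∀ i, IntegrableOn (v' i) (box L)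
  ω'_int : IntegrableOn ω' (box L)
  b'_int : IntegrableOn b' (box L)
  div : ∀ x, ∑ i, partialDeriv i (v i) x = 0
  mean : ∀ i, ∫ x in box L, v i x = 0
  eq_v : ∀ w : Fin 3 → Space → ℝ, (∀ i, ContDiff ℝ 1 (w i)) → (∀ i, PeriodicFun L (w i)) →
    (∀ x, ∑ i, partialDeriv i (w i) x = 0) → (∀ i, ∫ x in box L, w i x = 0) →
    ∫ x in box L, ∑ i, v' i x * w i x =
      (∫ x in box L, ∑ i, ∑ j, v i x * v j x * partialDeriv j (w i) x)
        - ∫ x in box L, ∑ i, ∑ j, b x / ω x * symPartial v i j x * symPartial w i j x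
  eq_ω : ∀ z : Space → ℝ, ContDiff ℝ 1 z → PeriodicFun L z →
    ∫ x in box L, ω' x * z x =
      (∫ x in box L, ∑ j, ω x * v j x * partialDeriv j z x)
        - (∫ x in box L, ∑ j, b x / ω x * partialDeriv j ω x * partialDeriv j z x)
        - κ * ∫ x in box L, ω x ^ 2 * z x
  eq_b : ∀ q : Space → ℝ, ContDiff ℝ 1 q → PeriodicFun L q →
    ∫ x in box L, b' x * q x =
      (∫ x in box L, ∑ j, b x * v j x * partialDeriv j q x)
        - (∫ x in box L, ∑ j, b x / ω x * partialDeriv j b x * partialDeriv j q x)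
        - (∫ x in box L, b x * ω x * q x)
        + ∫ x in box L, b x / ω x * (∑ i, ∑ j, symPartial v i j x ^ 2) * q x

theorem memVdiv_one {w : Fin 3 → Space → ℝ} (hw : ∀ i, ContDiff ℝ 1 (w i))
    (hp : ∀ i, PeriodicFun L (w i)) (hd : ∀ x, ∑ i, partialDeriv i (w i) x = 0)
    (hm : ∀ i, ∫ x in box L, w i x = 0) : MemVdiv L 1 w := by
  refine ⟨fun i => memV_one (hw i) (hp i), ?_, hm⟩
  have h := ae_all_iff.2 fun i => weakPartial_ae_eq_partialDeriv (hw i) EventuallyEq.rfl i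
  filter_upwards [h] with x hx
  simp only [hx, hd, Pi.zero_apply]

theorem integral_box_congr {f g : Space → ℝ} (h : ∀ᵐ x, f x = g x) :
    ∫ x in box L, f x = ∫ x in box L, g x := integral_congr_ae (ae_restrict_of_ae h)

/-- Regular representatives of the three components of a solution on `[0, S]`, together with the
equations that they satisfy. -/
structure RegularSolution (L : Space) (κ S : ℝ) (v : ℝ → Fin 3 → Space → ℝ) (ω b : ℝ → Space → ℝ)
    (v' : ℝ → Fin 3 → Space → ℝ) (ω' b' : ℝ → Space → ℝ) (V : ℝ → Fin 3 → Space → ℝ)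
    (W B : ℝ → Space → ℝ) (A : ℝ → ℝ) : Prop where
  rep_v : ∀ i, IsRegularRep L S (fun t => v t i) (fun t => v' t i) (fun t => V t i) A
  rep_ω : IsRegularRep L S ω ω' W A
  rep_b : IsRegularRep L S b b' B A
  slice : ∀ᵐ t ∂volume.restrict (Ioo 0 S), SliceEq L κ (V t) (W t) (B t) (v' t) (ω' t) (b' t)

theorem IsRegularRep.mono {u u' ũ : ℝ → Space → ℝ} {A A' : ℝ → ℝ} (h : IsRegularRep L S u u' ũ A)
    (hle : ∀ t, A t ≤ A' t) (hi : IntegrableOn (fun t => A' t ^ 2) (Ioo 0 S)) :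
    IsRegularRep L S u u' ũ A' :=
  ⟨h.cont, h.per, h.sqInt, h.prim, fun t => (h.nonneg t).trans (hle t), hi,
    h.ae_time.mono fun t ht => ⟨ht.1, ht.2.1, fun j x => (ht.2.2 j x).trans (hle t)⟩⟩

theorem SqInt.ae_integrableOn_box {u : ℝ → Space → ℝ} (h : SqInt L S u) :
    ∀ᵐ t ∂volume.restrict (Ioo 0 S), IntegrableOn (u t) (box L) :=
  h.ae_memLp.mono fun _ ht => ht.integrable (by norm_num)

/-- Solutions have regular representatives, which satisfy the equations in the form `SliceEq`. -/
theorem exists_regularSolution (hL : ∀ i, 0 < L i) (hS : 0 < S) (hST : (S : EReal) < T) {κ : ℝ}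
    {v₀ : Fin 3 → Space → ℝ} {ω₀ b₀ : Space → ℝ} {v : ℝ → Fin 3 → Space → ℝ} {ω b : ℝ → Space → ℝ}
    (h : IsSolution L κ T v₀ ω₀ b₀ v ω b) :
    ∃ V W B A, RegularSolution L κ S v ω b (fun t i => timeDeriv L T (fun s => v s i) t)
      (timeDeriv L T ω) (timeDeriv L T b) V W B A := by
  have hX := h.memX
  choose V' A₁ hV using fun i =>
    (sobolevBounds_of_mem hL hS hST (hX.v_space i) (hX.v_time i)).exists_regularRep hL hS
  obtain ⟨W, A₂, hW⟩ := (sobolevBounds_of_mem hL hS hST hX.ω_space hX.ω_time).exists_regularRep hL hS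
  obtain ⟨B, A₃, hB⟩ := (sobolevBounds_of_mem hL hS hST hX.b_space hX.b_time).exists_regularRep hL hS
  set A : ℝ → ℝ := fun t => √((∑ i, A₁ i t ^ 2) + A₂ t ^ 2 + A₃ t ^ 2) with hA
  have hA2 : IntegrableOn (fun t => A t ^ 2) (Ioo 0 S) := by
    have e : ∀ t, A t ^ 2 = (∑ i, A₁ i t ^ 2) + A₂ t ^ 2 + A₃ t ^ 2 := fun t =>
      Real.sq_sqrt (by positivity)
    simp_rw [e]
    exact ((integrable_finsetSum _ fun i _ => (hV i).bound_sq).add hW.bound_sq).add hB.bound_sq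
  have hV := fun i => (hV i).mono (A' := A) (fun t => by
    refine Real.le_sqrt_of_sq_le ?_
    have := Finset.single_le_sum (f := fun i => A₁ i t ^ 2) (fun _ _ => sq_nonneg _)
      (Finset.mem_univ i)
    have h2 := sq_nonneg (A₂ t)
    have h3 := sq_nonneg (A₃ t)
    linarith) hA2
  have hW := hW.mono (A' := A) (fun t => Real.le_sqrt_of_sq_le (by
    have : 0 ≤ ∑ i, A₁ i t ^ 2 := Finset.sum_nonneg fun _ _ => sq_nonneg _
    have h3 := sq_nonneg (A₃ t)
    linarith)) hA2
  have hB := hB.mono (A' := A) (fun t => Real.le_sqrt_of_sq_le (by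
    have : 0 ≤ ∑ i, A₁ i t ^ 2 := Finset.sum_nonneg fun _ _ => sq_nonneg _
    have h3 := sq_nonneg (A₂ t)
    linarith)) hA2
  refine ⟨fun t i => V' i t, W, B, A, hV, hW, hB, ?_⟩
  filter_upwards [ae_all_iff.2 fun i => (hV i).ae_time, hW.ae_time, hB.ae_time,
    ae_all_iff.2 fun i => (hV i).sqInt.ae_integrableOn_box, hW.sqInt.ae_integrableOn_box,
    hB.sqInt.ae_integrableOn_box,
    ae_Ioo_of_ae_timeInterval hST hX.v_div, ae_Ioo_of_ae_timeInterval hST h.eq_v,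
    ae_Ioo_of_ae_timeInterval hST h.eq_ω, ae_Ioo_of_ae_timeInterval hST h.eq_b]
    with t tV tW tB iV iW iB tdiv teqv teqω teqb
  have cV : ∀ i, ContDiff ℝ 1 (V' i t) := fun i => (tV i).2.1
  have cW := tW.2.1
  have cB := tB.2.1
  have pV : ∀ i, PeriodicFun L (V' i t) := fun i => (hV i).per t
  have eV : ∀ᵐ x, ∀ i, v t i x = V' i t x := ae_all_iff.2 fun i => (tV i).1
  have eW : ∀ᵐ x, ω t x = W t x := tW.1
  have eB : ∀ᵐ x, b t x = B t x := tB.1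
  have dV : ∀ᵐ x, ∀ i j, symGrad (v t) i j x = symPartial (fun i => V' i t) i j x :=
    ae_all_iff.2 fun i => ae_all_iff.2 fun j => symGrad_ae_eq cV (fun i => (tV i).1) i j
  have dW : ∀ᵐ x, ∀ j, weakPartial j (ω t) x = partialDeriv j (W t) x :=
    ae_all_iff.2 fun j => weakPartial_ae_eq_partialDeriv cW tW.1 j
  have dB : ∀ᵐ x, ∀ j, weakPartial j (b t) x = partialDeriv j (B t) x :=
    ae_all_iff.2 fun j => weakPartial_ae_eq_partialDeriv cB tB.1 j
  refine ⟨cV, cW, cB, pV, hW.per t, hB.per t, iV, iW, iB, ?_, ?_, ?_, ?_, ?_⟩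
  · have h1 : (fun x => ∑ i, partialDeriv i (V' i t) x) =ᵐ[volume] fun _ => (0 : ℝ) := by
      filter_upwards [tdiv.1, ae_all_iff.2 fun i => weakPartial_ae_eq_partialDeriv (cV i) (tV i).1 i]
        with x h1 h2
      simp only [h2] at h1
      exact h1
    have := (Continuous.ae_eq_iff_eq volume (continuous_finsetSum _ fun i _ =>
      continuous_partialDeriv i (cV i)) continuous_const).1 h1
    exact fun x => congrFun this x
  · intro i
    rw [← tdiv.2 i]
    exact integral_box_congr ((tV i).1.symm)
  · intro w hw hwp hwd hwm
    have e := teqv w (memVdiv_one hw hwp hwd hwm)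
    have e2 : ∫ x in box L, ∑ i, ∑ j, v t i x * v t j x * weakPartial j (w i) x =
        ∫ x in box L, ∑ i, ∑ j, V' i t x * V' j t x * partialDeriv j (w i) x := by
      refine integral_box_congr ?_
      filter_upwards [eV, ae_all_iff.2 fun i => ae_all_iff.2 fun j =>
        weakPartial_ae_eq_partialDeriv (hw i) EventuallyEq.rfl j] with x h1 h2
      simp only [h1, h2]
    have e3 : ∫ x in box L, ∑ i, ∑ j, b t x / ω t x * symGrad (v t) i j x * symGrad w i j x =
        ∫ x in box L, ∑ i, ∑ j,
          B t x / W t x * symPartial (fun i => V' i t) i j x * symPartial w i j x := by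
      refine integral_box_congr ?_
      filter_upwards [eW, eB, dV, ae_all_iff.2 fun i => ae_all_iff.2 fun j =>
        symGrad_ae_eq hw (fun _ => EventuallyEq.rfl) i j] with x h1 h2 h3 h4
      simp only [h1, h2, h3, h4]
    rw [e2, e3] at e
    linarith
  · intro z hz hzp
    have e := teqω z (memV_one hz hzp)
    have hzd : ∀ᵐ x, ∀ j, weakPartial j z x = partialDeriv j z x := ae_all_iff.2 fun j =>
      weakPartial_ae_eq_partialDeriv hz EventuallyEq.rfl j
    have e2 : ∫ x in box L, ∑ j, ω t x * v t j x * weakPartial j z x =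
        ∫ x in box L, ∑ j, W t x * V' j t x * partialDeriv j z x := by
      refine integral_box_congr ?_
      filter_upwards [eV, eW, hzd] with x h1 h2 h3
      simp only [h1, h2, h3]
    have e3 : ∫ x in box L, ∑ j, b t x / ω t x * weakPartial j (ω t) x * weakPartial j z x =
        ∫ x in box L, ∑ j, B t x / W t x * partialDeriv j (W t) x * partialDeriv j z x := by
      refine integral_box_congr ?_
      filter_upwards [eW, eB, dW, hzd] with x h1 h2 h3 h4
      simp only [h1, h2, h3, h4]
    have e4 : ∫ x in box L, ω t x ^ 2 * z x = ∫ x in box L, W t x ^ 2 * z x := by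
      refine integral_box_congr ?_
      filter_upwards [eW] with x h1
      rw [h1]
    rw [e2, e3, e4] at e
    linarith
  · intro q hq hqp
    have e := teqb q (memV_one hq hqp)
    have hqd : ∀ᵐ x, ∀ j, weakPartial j q x = partialDeriv j q x := ae_all_iff.2 fun j =>
      weakPartial_ae_eq_partialDeriv hq EventuallyEq.rfl j
    have e2 : ∫ x in box L, ∑ j, b t x * v t j x * weakPartial j q x =
        ∫ x in box L, ∑ j, B t x * V' j t x * partialDeriv j q x := by
      refine integral_box_congr ?_
      filter_upwards [eV, eB, hqd] with x h1 h2 h3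
      simp only [h1, h2, h3]
    have e3 : ∫ x in box L, ∑ j, b t x / ω t x * weakPartial j (b t) x * weakPartial j q x =
        ∫ x in box L, ∑ j, B t x / W t x * partialDeriv j (B t) x * partialDeriv j q x := by
      refine integral_box_congr ?_
      filter_upwards [eW, eB, dB, hqd] with x h1 h2 h3 h4
      simp only [h1, h2, h3, h4]
    have e4 : ∫ x in box L, b t x * ω t x * q x = ∫ x in box L, B t x * W t x * q x := by
      refine integral_box_congr ?_
      filter_upwards [eW, eB] with x h1 h2
      rw [h1, h2]
    have e5 : ∫ x in box L, b t x / ω t x * (∑ i, ∑ j, symGrad (v t) i j x ^ 2) * q x =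
        ∫ x in box L, B t x / W t x * (∑ i, ∑ j, symPartial (fun i => V' i t) i j x ^ 2) * q x := by
      refine integral_box_congr ?_
      filter_upwards [eW, eB, dV] with x h1 h2 h3
      simp only [h1, h2, h3]
    rw [e2, e3, e4, e5] at e
    linarith

end

section

variable {L : Space} {S : ℝ}

/-! ### Integration in time -/

/-- `f` is continuous on `[0, S] × ℝ³`, periodic in space, and a primitive in time of the square
integrable function `f'`. -/
structure TimeReg (L : Space) (S : ℝ) (f f' : ℝ → Space → ℝ) : Prop where
  cont : ContinuousOn (fun p : ℝ × Space => f p.1 p.2) (Icc 0 S ×ˢ univ)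
  per : ∀ t, PeriodicFun L (f t)
  sqInt : SqInt L S f'
  prim : ∀ᵐ x ∂volume.restrict (box L), ∀ t ∈ Icc 0 S, f t x = f 0 x + ∫ s in (0 : ℝ)..t, f' s x

variable {f f' g g' : ℝ → Space → ℝ}

theorem IsRegularRep.timeReg {u : ℝ → Space → ℝ} {A : ℝ → ℝ} (h : IsRegularRep L S u f' f A) :
    TimeReg L S f f' :=
  ⟨h.cont, h.per, h.sqInt, h.prim⟩

theorem intervalIntegrable_of_integrableOn_Ioo {a : ℝ → ℝ} {t : ℝ} (ht : t ∈ Icc 0 S)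
    (h : IntegrableOn a (Ioo 0 S)) : IntervalIntegrable a volume 0 t :=
  (intervalIntegrable_iff_integrableOn_Ioo_of_le ht.1).2 (h.mono_set (Ioo_subset_Ioo_right ht.2))

theorem TimeReg.sub (hf : TimeReg L S f f') (hg : TimeReg L S g g') :
    TimeReg L S (fun t x => f t x - g t x) fun t x => f' t x - g' t x := by
  refine ⟨hf.cont.sub hg.cont, fun t => (hf.per t).comp₂ (hg.per t) fun a b => a - b,
    hf.sqInt.sub hg.sqInt, ?_⟩
  filter_upwards [hf.prim, hg.prim, hf.sqInt.ae_integrableOn, hg.sqInt.ae_integrableOn]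
    with x h1 h2 h3 h4 t ht
  rw [h1 t ht, h2 t ht, intervalIntegral.integral_sub
    (intervalIntegrable_of_integrableOn_Ioo ht h3) (intervalIntegrable_of_integrableOn_Ioo ht h4)]
  ring

theorem TimeReg.continuous (h : TimeReg L S f f') {t : ℝ} (ht : t ∈ Icc 0 S) :
    Continuous (f t) := by
  rw [← continuousOn_univ]
  exact h.cont.comp (f := fun x => (t, x)) (by fun_prop) fun x _ => ⟨ht, trivial⟩

theorem aestronglyMeasurable_cylinder {ψ : ℝ → Space → ℝ}
    (hc : ContinuousOn (fun p : ℝ × Space => ψ p.1 p.2) (Icc 0 S ×ˢ univ)) :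
    AEStronglyMeasurable (fun p : ℝ × Space => ψ p.1 p.2) (cylinder L S) := by
  rw [cylinder, Measure.prod_restrict]
  exact (hc.mono (prod_mono Ioo_subset_Icc_self (subset_univ _))).aestronglyMeasurable
    (measurableSet_Ioo.prod measurableSet_box)

theorem ae_cylinder_mem : ∀ᵐ p ∂cylinder L S, p.1 ∈ Icc 0 S := by
  rw [cylinder, Measure.prod_restrict]
  filter_upwards [ae_restrict_mem (measurableSet_Ioo.prod measurableSet_box)] with p hp
  exact Ioo_subset_Icc_self hp.1

theorem integrable_cylinder_of_continuousOn (hL : ∀ i, 0 < L i) {ψ : ℝ → Space → ℝ}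
    (hc : ContinuousOn (fun p : ℝ × Space => ψ p.1 p.2) (Icc 0 S ×ˢ univ))
    (hp : ∀ t, PeriodicFun L (ψ t)) :
    Integrable (fun p : ℝ × Space => ψ p.1 p.2) (cylinder L S) := by
  obtain ⟨M, -, hM⟩ := exists_bound_of_periodic hL hc hp
  exact Integrable.of_bound (aestronglyMeasurable_cylinder hc) M
    (ae_cylinder_mem.mono fun p hp => hM _ hp _)

theorem integrable_cylinder_mul (hL : ∀ i, 0 < L i) {ψ u : ℝ → Space → ℝ}
    (hc : ContinuousOn (fun p : ℝ × Space => ψ p.1 p.2) (Icc 0 S ×ˢ univ))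
    (hp : ∀ t, PeriodicFun L (ψ t)) (hu : SqInt L S u) :
    Integrable (fun p : ℝ × Space => ψ p.1 p.2 * u p.1 p.2) (cylinder L S) := by
  obtain ⟨M, -, hM⟩ := exists_bound_of_periodic hL hc hp
  exact hu.integrable.bdd_mul (c := M) (aestronglyMeasurable_cylinder hc)
    (ae_cylinder_mem.mono fun p hp => hM _ hp _)

theorem TimeReg.integrable_chain (hL : ∀ i, 0 < L i) (h : TimeReg L S f f') {G' : ℝ → ℝ}
    (hG' : Continuous G') (M : ℝ) :
    Integrable (fun p : ℝ × Space => G' (Real.exp (M * p.1) * f p.1 p.2) *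
      (Real.exp (M * p.1) * (M * f p.1 p.2 + f' p.1 p.2))) (cylinder L S) := by
  have he : ContinuousOn (fun p : ℝ × Space => Real.exp (M * p.1)) (Icc 0 S ×ˢ univ) := by fun_prop
  have hψ : ContinuousOn (fun p : ℝ × Space =>
      G' (Real.exp (M * p.1) * f p.1 p.2) * Real.exp (M * p.1)) (Icc 0 S ×ˢ univ) :=
    (hG'.comp_continuousOn (he.mul h.cont)).mul he
  have hper : ∀ t, PeriodicFun L fun x => G' (Real.exp (M * t) * f t x) * Real.exp (M * t) :=
    fun t => (h.per t).comp fun y => G' (Real.exp (M * t) * y) * Real.exp (M * t)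
  have i1 := integrable_cylinder_mul (S := S) hL (ψ := fun t x =>
    G' (Real.exp (M * t) * f t x) * Real.exp (M * t)) hψ hper h.sqInt
  have i2 := integrable_cylinder_of_continuousOn (S := S) hL (ψ := fun t x =>
    G' (Real.exp (M * t) * f t x) * Real.exp (M * t) * (M * f t x))
    (hψ.mul (h.cont.const_mul M)) fun t => (hper t).comp₂ (h.per t) fun a b => a * (M * b)
  refine (i2.add i1).congr (Eventually.of_forall fun p => ?_)
  simp only [Pi.add_apply]
  ring

theorem TimeReg.mono (h : TimeReg L S f f') {t : ℝ} (ht : t ≤ S) : TimeReg L t f f' :=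
  ⟨h.cont.mono (prod_mono_left (Icc_subset_Icc_right ht)), h.per, h.sqInt.mono ht,
    h.prim.mono fun _ hx s hs => hx s ⟨hs.1, hs.2.trans ht⟩⟩

theorem TimeReg.integrableOn_integral_chain (hL : ∀ i, 0 < L i) (h : TimeReg L S f f') {G' : ℝ → ℝ}
    (hG' : Continuous G') (M : ℝ) :
    IntegrableOn (fun s => ∫ x in box L, G' (Real.exp (M * s) * f s x) *
      (Real.exp (M * s) * (M * f s x + f' s x))) (Ioo 0 S) :=
  (h.integrable_chain hL hG' M).integral_prod_left

/-- The fundamental theorem of calculus for `∫ G(e^{Mt} f(t, x)) dx`. -/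
theorem TimeReg.integral_comp (hL : ∀ i, 0 < L i) (h : TimeReg L S f f') {G G' : ℝ → ℝ}
    (hG : ContDiff ℝ 1 G) (hG' : ∀ y, HasDerivAt G (G' y) y) (hc : Continuous G') (M : ℝ)
    {t : ℝ} (ht : t ∈ Icc 0 S) :
    (∫ x in box L, G (Real.exp (M * t) * f t x)) - ∫ x in box L, G (f 0 x) =
      ∫ s in (0 : ℝ)..t, ∫ x in box L, G' (Real.exp (M * s) * f s x) *
        (Real.exp (M * s) * (M * f s x + f' s x)) := by
  have h' := h.mono ht.2
  have hint := h'.integrable_chain hL hc M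
  rw [intervalIntegral.integral_of_le ht.1, integral_Ioc_eq_integral_Ioo,
    integral_integral_swap hint, ← integral_sub]
  · refine integral_congr_ae ?_
    filter_upwards [h'.prim, h'.sqInt.ae_integrableOn] with x h1 h2
    have hi : IntervalIntegrable (fun s => f' s x) volume 0 t :=
      (intervalIntegrable_iff_integrableOn_Ioo_of_le ht.1).2 h2
    have := comp_exp_mul_primitive M ht.1 hi h1 hG hG'
    rw [this, intervalIntegral.integral_of_le ht.1, integral_Ioc_eq_integral_Ioo]
  · exact integrableOn_box_of_continuous
      (hG.continuous.comp (continuous_const.mul (h.continuous ht)))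
  · exact integrableOn_box_of_continuous
      (hG.continuous.comp (h.continuous ⟨le_rfl, ht.1.trans ht.2⟩))

/-! ### Lower bounds -/

/-- The powers `y ↦ y₊ ^ (n + 2)` of the positive part are differentiable, also at `0`. -/
theorem hasDerivAt_max_zero_pow (n : ℕ) (y : ℝ) :
    HasDerivAt (fun y : ℝ => max y 0 ^ (n + 2)) ((n + 2) * max y 0 ^ (n + 1)) y := by
  rcases lt_trichotomy y 0 with hy | hy | hy
  · have e : (fun y : ℝ => max y 0 ^ (n + 2)) =ᶠ[𝓝 y] fun _ => 0 := by
      filter_upwards [gt_mem_nhds hy] with z hz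
      simp [max_eq_right hz.le]
    simpa [max_eq_right hy.le] using (hasDerivAt_const y (0 : ℝ)).congr_of_eventuallyEq e
  · subst hy
    have e : (fun y : ℝ => max y 0 ^ (n + 2)) =O[𝓝 0] fun y => ‖y - 0‖ ^ (n + 2) := by
      refine Asymptotics.IsBigO.of_bound 1 (Eventually.of_forall fun z => ?_)
      rw [one_mul, norm_pow, norm_pow, sub_zero, norm_norm]
      refine pow_le_pow_left₀ (norm_nonneg _) ?_ _
      rw [Real.norm_of_nonneg (le_max_right _ _)]
      exact max_le (le_abs_self z) (norm_nonneg z)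
    simpa using (e.hasFDerivAt (by omega)).hasDerivAt
  · have e : (fun y : ℝ => max y 0 ^ (n + 2)) =ᶠ[𝓝 y] fun y => y ^ (n + 2) := by
      filter_upwards [lt_mem_nhds hy] with z hz
      simp [max_eq_left hz.le]
    have := (hasDerivAt_pow (n + 2) y).congr_of_eventuallyEq e
    rw [max_eq_left hy.le]
    simpa using this

theorem hasDerivAt_max_sub_zero_pow (n : ℕ) (m y : ℝ) :
    HasDerivAt (fun y : ℝ => max (m - y) 0 ^ (n + 2)) (-((n + 2) * max (m - y) 0 ^ (n + 1))) y := by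
  have := (hasDerivAt_max_zero_pow n (m - y)).comp y ((hasDerivAt_id y).const_sub m)
  simpa [Function.comp_def] using this

theorem contDiff_max_sub_zero_pow (n : ℕ) (m : ℝ) :
    ContDiff ℝ 1 fun y : ℝ => max (m - y) 0 ^ (n + 2) := by
  rw [contDiff_one_iff_deriv]
  refine ⟨fun y => (hasDerivAt_max_sub_zero_pow n m y).differentiableAt, ?_⟩
  rw [funext fun y => (hasDerivAt_max_sub_zero_pow n m y).deriv]
  fun_prop

theorem partialDeriv_comp {G : ℝ → ℝ} {d : ℝ} {f : Space → ℝ} {x : Space} {j : Fin 3}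
    (hG : HasDerivAt G d (f x)) (hf : DifferentiableAt ℝ f x) :
    partialDeriv j (fun y => G (f y)) x = d * partialDeriv j f x := by
  have := (hG.comp_hasFDerivAt x hf.hasFDerivAt).fderiv
  unfold partialDeriv
  rw [show (fun y => G (f y)) = G ∘ f from rfl, this]
  rfl

end

section

variable {L : Space} {S : ℝ}

theorem integrableOn_mul_continuous {f g : Space → ℝ} (hf : IntegrableOn f (box L))
    (hg : Continuous g) : IntegrableOn (fun x => f x * g x) (box L) := by
  obtain ⟨K, hK⟩ := isCompact_Icc.exists_bound_of_continuousOn (hg.continuousOn (s := Icc 0 L))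
  exact hf.mul_bdd (c := K) hg.aestronglyMeasurable
    ((ae_restrict_mem measurableSet_box).mono fun x hx => hK x (box_subset_Icc hx))

theorem hasDerivAt_truncSq (m c r : ℝ) :
    HasDerivAt (fun r : ℝ => 3 * max (m - c * r) 0 ^ 2) (-(6 * c * max (m - c * r) 0)) r := by
  have h := ((hasDerivAt_max_sub_zero_pow 0 m (c * r)).comp r
    ((hasDerivAt_id r).const_mul c)).const_mul 3
  simp only [Function.comp_def, CharP.cast_eq_zero, zero_add, pow_one, mul_one] at h
  exact h.congr_deriv (by ring)

theorem hasDerivAt_truncCube (m y : ℝ) :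
    HasDerivAt (fun y : ℝ => max (m - y) 0 ^ 3) (-(3 * max (m - y) 0 ^ 2)) y := by
  have h := hasDerivAt_max_sub_zero_pow 1 m y
  simp only [Nat.cast_one, Nat.reduceAdd] at h
  exact h.congr_deriv (by norm_num)

/-- The function `r ↦ r g(c r) + c⁻¹ G(c r)` with `g(y) = 3 (m - y)₊²` and `G(y) = (m - y)₊³` turns
the convective term into an exact transport term. -/
theorem hasDerivAt_truncFlux {c : ℝ} (hc : c ≠ 0) (m r : ℝ) :
    HasDerivAt (fun r : ℝ => r * (3 * max (m - c * r) 0 ^ 2) + c⁻¹ * max (m - c * r) 0 ^ 3)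
      (r * -(6 * c * max (m - c * r) 0)) r := by
  have h1 := (hasDerivAt_id r).mul (hasDerivAt_truncSq m c r)
  have h2 := ((hasDerivAt_truncCube m (c * r)).comp r ((hasDerivAt_id r).const_mul c)).const_mul c⁻¹
  have h := h1.add h2
  simp only [Function.comp_def, id, mul_one] at h
  refine h.congr_deriv ?_
  field_simp
  ring

/-- For a solution `f` of a convection-diffusion equation whose right-hand side is bounded below
by `-M f`, the truncated energy `∫ (m - e^{Mt} f)₊³` does not increase. -/
theorem integral_trunc_nonpos (hL : ∀ i, 0 < L i) {v : Fin 3 → Space → ℝ} {f f' μ R : Space → ℝ}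
    (hv : ∀ i, ContDiff ℝ 1 (v i)) (hvp : ∀ i, PeriodicFun L (v i))
    (hdiv : ∀ x, ∑ i, partialDeriv i (v i) x = 0) (hf : ContDiff ℝ 1 f) (hfp : PeriodicFun L f)
    (hf' : IntegrableOn f' (box L)) (hμ : ∀ x, 0 ≤ μ x) {M c m : ℝ} (hc : 0 < c)
    (hR : ∀ x, 0 ≤ M * f x + R x) (hRc : Continuous R)
    (heq : ∀ z : Space → ℝ, ContDiff ℝ 1 z → PeriodicFun L z →
      ∫ x in box L, f' x * z x = (∫ x in box L, ∑ j, f x * v j x * partialDeriv j z x)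
        - (∫ x in box L, ∑ j, μ x * partialDeriv j f x * partialDeriv j z x)
        + ∫ x in box L, R x * z x) :
    ∫ x in box L, -(3 * max (m - c * f x) 0 ^ 2) * (c * (M * f x + f' x)) ≤ 0 := by
  set z : Space → ℝ := fun x => 3 * max (m - c * f x) 0 ^ 2 with hz
  have hzC : ContDiff ℝ 1 z :=
    contDiff_const.mul ((contDiff_max_sub_zero_pow 0 m).comp (contDiff_const.mul hf))
  have hzp : PeriodicFun L z := hfp.comp fun r => 3 * max (m - c * r) 0 ^ 2
  have hz0 : ∀ x, 0 ≤ z x := fun x => by positivity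
  have hfd : ∀ x, DifferentiableAt ℝ f x := hf.differentiable one_ne_zero
  have hzd : ∀ j x, partialDeriv j z x =
      -(6 * c * max (m - c * f x) 0) * partialDeriv j f x := fun j x =>
    partialDeriv_comp (hasDerivAt_truncSq m c (f x)) (hfd x)
  have hconv : ∫ x in box L, ∑ j, f x * v j x * partialDeriv j z x = 0 := by
    have hH : ContDiff ℝ 1 fun x => f x * z x + c⁻¹ * max (m - c * f x) 0 ^ 3 :=
      (hf.mul hzC).add
        (contDiff_const.mul ((contDiff_max_sub_zero_pow 1 m).comp (contDiff_const.mul hf)))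
    have hHp : PeriodicFun L fun x => f x * z x + c⁻¹ * max (m - c * f x) 0 ^ 3 :=
      hfp.comp fun r => r * (3 * max (m - c * r) 0 ^ 2) + c⁻¹ * max (m - c * r) 0 ^ 3
    rw [← integral_box_transport hL hv hvp hdiv hH hHp]
    congr 1; ext x
    refine Finset.sum_congr rfl fun j _ => ?_
    have := partialDeriv_comp (j := j) (hasDerivAt_truncFlux hc.ne' m (f x)) (hfd x)
    simp only [hz] at this ⊢
    rw [this, hzd]
    ring
  have hdiff : ∫ x in box L, ∑ j, μ x * partialDeriv j f x * partialDeriv j z x ≤ 0 := by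
    refine integral_nonpos fun x => Finset.sum_nonpos fun j _ => ?_
    rw [hzd]
    have h1 : 0 ≤ max (m - c * f x) 0 := le_max_right _ _
    have h2 : 0 ≤ μ x * (6 * c * max (m - c * f x) 0) * partialDeriv j f x ^ 2 :=
      mul_nonneg (mul_nonneg (hμ x) (by positivity)) (sq_nonneg _)
    nlinarith
  have iz : IntegrableOn (fun x => f' x * z x) (box L)  :=
    integrableOn_mul_continuous hf' hzC.continuous
  have iR : IntegrableOn (fun x => R x * z x) (box L) :=
    integrableOn_box_of_continuous (hRc.mul hzC.continuous)
  have iM : IntegrableOn (fun x => M * f x * z x) (box L) :=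
    integrableOn_box_of_continuous ((continuous_const.mul hf.continuous).mul hzC.continuous)
  have hsum : 0 ≤ (∫ x in box L, M * f x * z x) + ∫ x in box L, R x * z x := by
    rw [← integral_add iM iR]
    refine integral_nonneg fun x => ?_
    simp only [Pi.zero_apply]
    rw [← add_mul]
    exact mul_nonneg (hR x) (hz0 x)
  have e : ∫ x in box L, -(3 * max (m - c * f x) 0 ^ 2) * (c * (M * f x + f' x)) =
      -c * ((∫ x in box L, M * f x * z x) + ∫ x in box L, f' x * z x) := by
    rw [← integral_add iM iz, ← integral_const_mul]
    congr 1; ext x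
    simp only [hz]
    ring
  rw [e, heq z hzC hzp, hconv]
  nlinarith

/-- A lower bound that decays exponentially, from the monotonicity of the truncated energy. -/
theorem TimeReg.lower_bound (hL : ∀ i, 0 < L i) {f f' : ℝ → Space → ℝ} (h : TimeReg L S f f')
    {M m : ℝ} (h0 : ∀ x, m ≤ f 0 x)
    (hs : ∀ᵐ s ∂volume.restrict (Ioo 0 S), ∫ x in box L,
      -(3 * max (m - Real.exp (M * s) * f s x) 0 ^ 2) *
        (Real.exp (M * s) * (M * f s x + f' s x)) ≤ 0)
    {t : ℝ} (ht : t ∈ Icc 0 S) (x : Space) : m ≤ Real.exp (M * t) * f t x := by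
  have e := h.integral_comp hL (contDiff_max_sub_zero_pow 1 m) (hasDerivAt_truncCube m)
    (by fun_prop) M ht
  have e0 : ∫ x in box L, max (m - f 0 x) 0 ^ 3 = 0 := by
    simp [max_eq_right (sub_nonpos.2 (h0 _))]
  have hle : ∫ x in box L, max (m - Real.exp (M * t) * f t x) 0 ^ 3 ≤ 0 := by
    have h1 : ∫ s in (0 : ℝ)..t, ∫ x in box L,
        -(3 * max (m - Real.exp (M * s) * f s x) 0 ^ 2) *
        (Real.exp (M * s) * (M * f s x + f' s x)) ≤ 0 := by
      rw [intervalIntegral.integral_of_le ht.1, integral_Ioc_eq_integral_Ioo]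
      exact integral_nonpos_of_ae (ae_mono
        (Measure.restrict_mono (Ioo_subset_Ioo_right ht.2) le_rfl) hs)
    linarith [e0]
  have hc : Continuous fun x => max (m - Real.exp (M * t) * f t x) 0 ^ 3 := by
    have := h.continuous ht
    fun_prop
  have hz := (integral_eq_zero_iff_of_nonneg (fun x => by positivity)
    (integrableOn_box_of_continuous hc)).1 (le_antisymm hle
      (integral_nonneg fun x => by positivity))
  have hp : PeriodicFun L fun x => Real.exp (M * t) * f t x :=
    (h.per t).comp fun y => Real.exp (M * t) * y
  refine forall_of_ae_box hL hp (continuous_const.mul (h.continuous ht)) isClosed_Ici ?_ x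
  filter_upwards [hz] with y hy
  have : max (m - Real.exp (M * t) * f t y) 0 = 0 := by simpa using hy
  rw [mem_Ici]
  have := le_max_left (m - Real.exp (M * t) * f t y) 0
  linarith

/-- The equation for `ω` as a convection-diffusion equation with right-hand side `-κ ω²`. -/
theorem SliceEq.scalar_ω {κ : ℝ} {v v' : Fin 3 → Space → ℝ} {ω b ω' b' : Space → ℝ}
    (h : SliceEq L κ v ω b v' ω' b') (z : Space → ℝ) (hz : ContDiff ℝ 1 z)
    (hzp : PeriodicFun L z) :
    ∫ x in box L, ω' x * z x = (∫ x in box L, ∑ j, ω x * v j x * partialDeriv j z x)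
      - (∫ x in box L, ∑ j, b x / ω x * partialDeriv j ω x * partialDeriv j z x)
      + ∫ x in box L, -(κ * ω x ^ 2) * z x := by
  rw [h.eq_ω z hz hzp, sub_eq_add_neg, ← integral_const_mul, ← integral_neg]
  simp only [neg_mul, mul_assoc]

theorem SliceEq.continuous_source {κ : ℝ} {v v' : Fin 3 → Space → ℝ} {ω b ω' b' : Space → ℝ}
    (h : SliceEq L κ v ω b v' ω' b') (hω : ∀ x, 0 < ω x) :
    Continuous fun x => b x / ω x * ∑ i, ∑ j, symPartial v i j x ^ 2 :=
  (h.b_diff.continuous.div h.ω_diff.continuous fun x => (hω x).ne').mul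
    (continuous_finsetSum _ fun i _ => continuous_finsetSum _ fun j _ =>
      (continuous_symPartial h.v_diff i j).pow 2)

/-- The equation for `b` as a convection-diffusion equation with right-hand side
`-b ω + μ |D(v)|²`. -/
theorem SliceEq.scalar_b {κ : ℝ} {v v' : Fin 3 → Space → ℝ} {ω b ω' b' : Space → ℝ}
    (h : SliceEq L κ v ω b v' ω' b') (hω : ∀ x, 0 < ω x) (z : Space → ℝ) (hz : ContDiff ℝ 1 z)
    (hzp : PeriodicFun L z) :
    ∫ x in box L, b' x * z x = (∫ x in box L, ∑ j, b x * v j x * partialDeriv j z x)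
      - (∫ x in box L, ∑ j, b x / ω x * partialDeriv j b x * partialDeriv j z x)
      + ∫ x in box L,
        (-(b x * ω x) + b x / ω x * ∑ i, ∑ j, symPartial v i j x ^ 2) * z x := by
  have e : ∫ x in box L, (-(b x * ω x) + b x / ω x * ∑ i, ∑ j, symPartial v i j x ^ 2) * z x =
      -(∫ x in box L, b x * ω x * z x) +
        ∫ x in box L, b x / ω x * (∑ i, ∑ j, symPartial v i j x ^ 2) * z x := by
    rw [← integral_neg, ← integral_add]
    · congr 1; ext x; ring
    · exact (integrableOn_box_of_continuous
        ((h.b_diff.continuous.mul h.ω_diff.continuous).mul hz.continuous)).neg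
    · exact integrableOn_box_of_continuous ((h.continuous_source hω).mul hz.continuous)
  rw [h.eq_b z hz hzp, e]
  ring

variable {κ : ℝ} {v v' : ℝ → Fin 3 → Space → ℝ} {ω b ω' b' : ℝ → Space → ℝ}
  {V : ℝ → Fin 3 → Space → ℝ} {W B : ℝ → Space → ℝ} {A : ℝ → ℝ}

/-- The minimum principle on a time interval on which `ω` and `b` are positive. The constant `M`
dominates the zeroth order terms `-κ ω²` and `-b ω`. -/
theorem RegularSolution.lower_bound_of_pos (hL : ∀ i, 0 < L i)
    (h : RegularSolution L κ S v ω b v' ω' b' V W B A) {M m : ℝ}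
    (hM : ∀ t ∈ Icc 0 S, ∀ x, W t x ≤ M ∧ κ * W t x ≤ M)
    (h0 : ∀ x, m ≤ W 0 x ∧ m ≤ B 0 x) {t : ℝ} (ht : t ∈ Icc 0 S)
    (hpos : ∀ s ∈ Icc 0 t, ∀ x, 0 < W s x ∧ 0 < B s x) (x : Space) :
    m ≤ Real.exp (M * t) * W t x ∧ m ≤ Real.exp (M * t) * B t x := by
  have hsl := ae_mono (Measure.restrict_mono (Ioo_subset_Ioo_right ht.2) le_rfl) h.slice
  constructor
  · refine (h.rep_ω.timeReg.mono ht.2).lower_bound hL (fun x => (h0 x).1) ?_ ⟨ht.1, le_rfl⟩ x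
    filter_upwards [hsl, ae_restrict_mem measurableSet_Ioo] with s hs hst
    have hst' : s ∈ Icc 0 t := Ioo_subset_Icc_self hst
    refine integral_trunc_nonpos hL (v := V s) (μ := fun x => B s x / W s x)
      (R := fun x => -(κ * W s x ^ 2)) hs.v_diff hs.v_per hs.div hs.ω_diff hs.ω_per hs.ω'_int
      (fun x => (div_pos (hpos s hst' x).2 (hpos s hst' x).1).le) (Real.exp_pos _) (fun x => ?_)
      (by have := hs.ω_diff.continuous; fun_prop) hs.scalar_ω
    have h1 := (hM s ⟨hst'.1, hst'.2.trans ht.2⟩ x).2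
    have h2 := (hpos s hst' x).1
    nlinarith
  · refine (h.rep_b.timeReg.mono ht.2).lower_bound hL (fun x => (h0 x).2) ?_ ⟨ht.1, le_rfl⟩ x
    filter_upwards [hsl, ae_restrict_mem measurableSet_Ioo] with s hs hst
    have hst' : s ∈ Icc 0 t := Ioo_subset_Icc_self hst
    have hWpos : ∀ x, 0 < W s x := fun x => (hpos s hst' x).1
    refine integral_trunc_nonpos hL (v := V s) (μ := fun x => B s x / W s x)
      (R := fun x => -(B s x * W s x) + B s x / W s x * ∑ i, ∑ j, symPartial (V s) i j x ^ 2)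
      hs.v_diff hs.v_per hs.div hs.b_diff hs.b_per hs.b'_int
      (fun x => (div_pos (hpos s hst' x).2 (hpos s hst' x).1).le) (Real.exp_pos _) (fun x => ?_)
      ((hs.b_diff.continuous.mul hs.ω_diff.continuous).neg.add (hs.continuous_source hWpos))
      (hs.scalar_b hWpos)
    have h1 := (hM s ⟨hst'.1, hst'.2.trans ht.2⟩ x).1
    have h2 := (hpos s hst' x).2
    have h3 : 0 ≤ B s x / W s x * ∑ i, ∑ j, symPartial (V s) i j x ^ 2 :=
      mul_nonneg (div_pos h2 (hpos s hst' x).1).le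
        (Finset.sum_nonneg fun i _ => Finset.sum_nonneg fun j _ => sq_nonneg _)
    nlinarith

/-- The lower bounds for `ω` and `b` propagate: as long as both are positive the viscosity is
positive and the minimum principle applies, and the bound it gives allows a step of uniform
length. -/
theorem RegularSolution.exists_lower_bound (hL : ∀ i, 0 < L i)
    (h : RegularSolution L κ S v ω b v' ω' b' V W B A) {m : ℝ} (hm : 0 < m)
    (h0 : ∀ x, m ≤ W 0 x ∧ m ≤ B 0 x) :
    ∃ m₀ > 0, ∀ t ∈ Icc 0 S, ∀ x, m₀ ≤ W t x ∧ m₀ ≤ B t x := by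
  obtain ⟨N, hN0, hN⟩ := h.rep_ω.exists_bound hL
  set M := (1 + |κ|) * N with hMdef
  have hM0 : 0 ≤ M := by positivity
  have hM : ∀ t ∈ Icc 0 S, ∀ x, W t x ≤ M ∧ κ * W t x ≤ M := fun t ht x => by
    have h1 := hN t ht x
    have h2 : |κ * W t x| ≤ |κ| * N := by rw [abs_mul]; gcongr
    have h3 : 0 ≤ |κ| * N := by positivity
    have h4 := le_abs_self (W t x)
    have h5 := le_abs_self (κ * W t x)
    constructor <;> nlinarith
  set m₀ := m * Real.exp (-(M * S)) with hm₀
  have hm₀pos : 0 < m₀ := by positivity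
  have hlow : ∀ t ∈ Icc 0 S, ∀ y, m ≤ Real.exp (M * t) * y → m₀ ≤ y := fun t ht y hy => by
    have hy0 : 0 < y := by
      by_contra hneg
      nlinarith [Real.exp_pos (M * t)]
    have h1 : Real.exp (M * t) ≤ Real.exp (M * S) :=
      Real.exp_le_exp.2 (mul_le_mul_of_nonneg_left ht.2 hM0)
    rw [hm₀, Real.exp_neg, ← div_eq_mul_inv, div_le_iff₀ (Real.exp_pos _)]
    nlinarith
  obtain ⟨δ₁, hδ₁, hd₁⟩ := h.rep_ω.exists_delta hL hm₀pos
  obtain ⟨δ₂, hδ₂, hd₂⟩ := h.rep_b.exists_delta hL hm₀pos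
  set δ := min δ₁ δ₂ / 2 with hδ
  have hδ0 : 0 < δ := by positivity
  have hδ1 : δ < δ₁ := by have := min_le_left δ₁ δ₂; linarith
  have hδ2 : δ < δ₂ := by have := min_le_right δ₁ δ₂; linarith
  have key : ∀ n : ℕ, ∀ t ∈ Icc 0 S, t ≤ n * δ → ∀ x, m₀ ≤ W t x ∧ m₀ ≤ B t x := by
    intro n
    induction n with
    | zero =>
      intro t ht htn x
      have : t = 0 := le_antisymm (by simpa using htn) ht.1
      subst this
      exact ⟨hlow 0 ht _ (by simpa using (h0 x).1), hlow 0 ht _ (by simpa using (h0 x).2)⟩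
    | succ n ih =>
      intro t ht htn x
      have hpos : ∀ s ∈ Icc 0 t, ∀ x, 0 < W s x ∧ 0 < B s x := by
        intro s hs x
        have hsS : s ∈ Icc 0 S := ⟨hs.1, hs.2.trans ht.2⟩
        rcases le_or_gt s (n * δ) with hsn | hsn
        · have := ih s hsS hsn x
          exact ⟨hm₀pos.trans_le this.1, hm₀pos.trans_le this.2⟩
        · have hr : (n * δ : ℝ) ∈ Icc 0 S := ⟨by positivity, hsn.le.trans hsS.2⟩
          have h1 := ih _ hr le_rfl x
          push_cast at htn
          have hd : |s - n * δ| ≤ δ := by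
            rw [abs_of_pos (sub_pos.2 hsn)]; linarith [hs.2]
          have h2 := abs_lt.1 (hd₁ s hsS _ hr (hd.trans_lt hδ1) x)
          have h3 := abs_lt.1 (hd₂ s hsS _ hr (hd.trans_lt hδ2) x)
          exact ⟨by linarith, by linarith⟩
      have := h.lower_bound_of_pos hL hM h0 ht hpos x
      exact ⟨hlow t ht _ this.1, hlow t ht _ this.2⟩
  obtain ⟨n, hn⟩ := exists_nat_ge (S / δ)
  rw [div_le_iff₀ hδ0] at hn
  exact ⟨m₀, hm₀pos, fun t ht => key n t ht (ht.2.trans hn)⟩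

end

section

variable {L : Space} {S : ℝ}

/-! ### The difference of two solutions at a fixed time -/

theorem abs_mul_sub_mul_le {x₁ x₂ y₁ y₂ M r : ℝ} (hx : |x₁| ≤ M) (hy : |y₂| ≤ M)
    (hxr : |x₁ - x₂| ≤ r) (hyr : |y₁ - y₂| ≤ r) : |x₁ * y₁ - x₂ * y₂| ≤ 2 * M * r := by
  have hM : 0 ≤ M := (abs_nonneg _).trans hx
  have hr : 0 ≤ r := (abs_nonneg _).trans hxr
  rw [show x₁ * y₁ - x₂ * y₂ = x₁ * (y₁ - y₂) + (x₁ - x₂) * y₂ by ring]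
  refine (abs_add_le _ _).trans ?_
  rw [abs_mul, abs_mul]
  have h1 : |x₁| * |y₁ - y₂| ≤ M * r := by gcongr
  have h2 : |x₁ - x₂| * |y₂| ≤ r * M := by gcongr
  linarith

theorem abs_div_sub_div_le {b₁ b₂ w₁ w₂ m M r : ℝ} (hm : 0 < m) (hw₁ : m ≤ w₁) (hw₂ : m ≤ w₂)
    (hb : |b₁| ≤ M) (hw : |w₁| ≤ M) (hbr : |b₁ - b₂| ≤ r) (hwr : |w₁ - w₂| ≤ r) :
    |b₁ / w₁ - b₂ / w₂| ≤ 2 * M / m ^ 2 * r := by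
  have h1 : 0 < w₁ := hm.trans_le hw₁
  have h2 : 0 < w₂ := hm.trans_le hw₂
  have h3 : m ^ 2 ≤ w₁ * w₂ := by nlinarith
  have h4 : |b₁ * w₂ - b₂ * w₁| ≤ 2 * M * r :=
    abs_mul_sub_mul_le hb hw hbr (by rwa [abs_sub_comm])
  rw [div_sub_div _ _ h1.ne' h2.ne', abs_div, abs_of_pos (mul_pos h1 h2), mul_comm w₁ b₂,
    div_mul_eq_mul_div, div_le_div_iff₀ (mul_pos h1 h2) (by positivity)]
  have h5 : 0 ≤ 2 * M * r := (abs_nonneg _).trans h4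
  have h6 : 0 < m ^ 2 := by positivity
  nlinarith

/-- The difference of two diffusive terms controls the square of the difference `P₁ - P₂` of the
gradients; this absorbs the terms that are linear in `P₁ - P₂`. -/
theorem parabolic_term_le {F μ₁ μ₂ P₁ P₂ r a μ₀ M K N : ℝ} (hμ₀ : 0 < μ₀) (hμ : μ₀ ≤ μ₁)
    (hF : |F| ≤ 2 * M * r) (hK : |μ₁ - μ₂| ≤ K * r) (hP : |P₂| ≤ a) :
    F * (P₁ - P₂) - (μ₁ * P₁ - μ₂ * P₂) * (P₁ - P₂) + N * a * r * |P₁ - P₂| ≤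
      (8 * M ^ 2 + 2 * (K + N) ^ 2) / (4 * μ₀) * (1 + a ^ 2) * r ^ 2 := by
  set x := |P₁ - P₂| with hx
  have hx0 : 0 ≤ x := abs_nonneg _
  have hx2 : (P₁ - P₂) ^ 2 = x ^ 2 := (sq_abs _).symm
  have h1 : F * (P₁ - P₂) ≤ 2 * M * r * x := by
    refine (le_abs_self _).trans ?_
    rw [abs_mul]
    gcongr
  have h2 : -((μ₁ - μ₂) * P₂ * (P₁ - P₂)) ≤ K * r * a * x := by
    refine (neg_le_abs _).trans ?_
    rw [abs_mul, abs_mul]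
    have h0 : 0 ≤ K * r := (abs_nonneg _).trans hK
    gcongr
  have h3 : (μ₁ * P₁ - μ₂ * P₂) * (P₁ - P₂) = μ₁ * x ^ 2 + (μ₁ - μ₂) * P₂ * (P₁ - P₂) := by
    rw [← hx2]; ring
  have h4 : μ₀ * x ^ 2 ≤ μ₁ * x ^ 2 := by gcongr
  set c := (2 * M + (K + N) * a) * r with hc
  have h5 : F * (P₁ - P₂) - (μ₁ * P₁ - μ₂ * P₂) * (P₁ - P₂) + N * a * r * x ≤
      c * x - μ₀ * x ^ 2 := by
    rw [h3, hc]; linarith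
  have h6 : c * x - μ₀ * x ^ 2 ≤ c ^ 2 / (4 * μ₀) := by
    rw [le_div_iff₀ (by positivity)]
    nlinarith [sq_nonneg (c - 2 * μ₀ * x)]
  have h7 : c ^ 2 ≤ (8 * M ^ 2 + 2 * (K + N) ^ 2) * (1 + a ^ 2) * r ^ 2 := by
    rw [hc, mul_pow]
    refine mul_le_mul_of_nonneg_right ?_ (sq_nonneg r)
    nlinarith [sq_nonneg (2 * M - (K + N) * a), sq_nonneg (M * a), sq_nonneg (K + N)]
  refine (h5.trans h6).trans ?_
  rw [div_mul_eq_mul_div, div_mul_eq_mul_div]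
  gcongr

/-- The pointwise estimate for the difference of two solutions with values `vₖ`, `wₖ`, `bₖ`,
symmetric gradients `Dₖ` and gradients `pₖ`, `qₖ`. -/
theorem exists_difference_bound (κ : ℝ) {m M : ℝ} (hm : 0 < m) (hM : 0 < M) : ∃ C, 0 ≤ C ∧
    ∀ (v₁ v₂ : Fin 3 → ℝ) (w₁ w₂ b₁ b₂ : ℝ) (D₁ D₂ : Fin 3 → Fin 3 → ℝ) (p₁ p₂ q₁ q₂ : Fin 3 → ℝ)
      (a : ℝ), (∀ i, |v₁ i| ≤ M) → (∀ i, |v₂ i| ≤ M) → m ≤ w₁ → |w₁| ≤ M → m ≤ w₂ → |w₂| ≤ M →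
      m ≤ b₁ → |b₁| ≤ M → |b₂| ≤ M → (∀ i j, |D₁ i j| ≤ a) → (∀ i j, |D₂ i j| ≤ a) →
      (∀ j, |p₂ j| ≤ a) → (∀ j, |q₂ j| ≤ a) →
      (∑ i, ∑ j, ((v₁ i * v₁ j - v₂ i * v₂ j) * (D₁ i j - D₂ i j)
          - (b₁ / w₁ * D₁ i j - b₂ / w₂ * D₂ i j) * (D₁ i j - D₂ i j)))
        + (∑ j, ((w₁ * v₁ j - w₂ * v₂ j) * (p₁ j - p₂ j)
          - (b₁ / w₁ * p₁ j - b₂ / w₂ * p₂ j) * (p₁ j - p₂ j)))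
        - κ * ((w₁ ^ 2 - w₂ ^ 2) * (w₁ - w₂))
        + (∑ j, ((b₁ * v₁ j - b₂ * v₂ j) * (q₁ j - q₂ j)
          - (b₁ / w₁ * q₁ j - b₂ / w₂ * q₂ j) * (q₁ j - q₂ j)))
        - (b₁ * w₁ - b₂ * w₂) * (b₁ - b₂)
        + (b₁ / w₁ * (∑ i, ∑ j, D₁ i j ^ 2) - b₂ / w₂ * ∑ i, ∑ j, D₂ i j ^ 2) * (b₁ - b₂) ≤
      C * (1 + a ^ 2) * ((∑ i, (v₁ i - v₂ i) ^ 2) + (w₁ - w₂) ^ 2 + (b₁ - b₂) ^ 2) := by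
  set K := 2 * M / m ^ 2 with hK
  set N := 2 * M / m with hN
  set μ₀ := m / M with hμ₀
  have hK0 : 0 ≤ K := by positivity
  have hμ₀0 : 0 < μ₀ := by positivity
  set C₀ := (8 * M ^ 2 + 2 * (K + N) ^ 2) / (4 * μ₀) with hC₀
  set C₁ := (8 * M ^ 2 + 2 * (K + 0) ^ 2) / (4 * μ₀) with hC₁
  have hC₀0 : 0 ≤ C₀ := by positivity
  have hC₁0 : 0 ≤ C₁ := by positivity
  refine ⟨9 * C₀ + 9 * K + 6 * C₁ + 2 * |κ| * M + 2 * M, by positivity, ?_⟩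
  intro v₁ v₂ w₁ w₂ b₁ b₂ D₁ D₂ p₁ p₂ q₁ q₂ a hv₁ hv₂ hw₁ hw₁M hw₂ hw₂M hb₁ hb₁M hb₂M hD₁ hD₂ hp hq
  set e := (∑ i, (v₁ i - v₂ i) ^ 2) + (w₁ - w₂) ^ 2 + (b₁ - b₂) ^ 2 with he
  have hs0 : 0 ≤ ∑ i, (v₁ i - v₂ i) ^ 2 := Finset.sum_nonneg fun _ _ => sq_nonneg _
  have he0 : 0 ≤ e := by positivity
  set r := √e with hr
  have hr0 : 0 ≤ r := Real.sqrt_nonneg _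
  have hr2 : r ^ 2 = e := Real.sq_sqrt he0
  have ha0 : 0 ≤ a := (abs_nonneg _).trans (hp 0)
  have hv : ∀ i, |v₁ i - v₂ i| ≤ r := fun i => Real.abs_le_sqrt (by
    have := Finset.single_le_sum (f := fun i => (v₁ i - v₂ i) ^ 2) (fun _ _ => sq_nonneg _)
      (Finset.mem_univ i)
    have h1 := sq_nonneg (w₁ - w₂)
    have h2 := sq_nonneg (b₁ - b₂)
    linarith)
  have hw : |w₁ - w₂| ≤ r := Real.abs_le_sqrt (by have := sq_nonneg (b₁ - b₂); linarith)
  have hb : |b₁ - b₂| ≤ r := Real.abs_le_sqrt (by have := sq_nonneg (w₁ - w₂); linarith)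
  have hw₁0 : 0 < w₁ := hm.trans_le hw₁
  have hμ : |b₁ / w₁ - b₂ / w₂| ≤ K * r := abs_div_sub_div_le hm hw₁ hw₂ hb₁M hw₁M hb hw
  have hμ₁ : μ₀ ≤ b₁ / w₁ := div_le_div₀ (hm.le.trans hb₁) hb₁ hw₁0 ((le_abs_self _).trans hw₁M)
  have hμ₁' : b₁ / w₁ ≤ M / m := div_le_div₀ hM.le ((le_abs_self _).trans hb₁M) hm hw₁
  have hμ₁0 : 0 ≤ b₁ / w₁ := hμ₀0.le.trans hμ₁
  have tD : ∀ i j, (v₁ i * v₁ j - v₂ i * v₂ j) * (D₁ i j - D₂ i j)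
      - (b₁ / w₁ * D₁ i j - b₂ / w₂ * D₂ i j) * (D₁ i j - D₂ i j)
      + (b₁ / w₁ * D₁ i j ^ 2 - b₂ / w₂ * D₂ i j ^ 2) * (b₁ - b₂) ≤
      (C₀ + K) * (1 + a ^ 2) * e := by
    intro i j
    have h1 := parabolic_term_le (N := N) (P₁ := D₁ i j) hμ₀0 hμ₁
      (abs_mul_sub_mul_le (hv₁ i) (hv₂ j) (hv i) (hv j)) hμ (hD₂ i j)
    have h2 : b₁ / w₁ * ((D₁ i j - D₂ i j) * (D₁ i j + D₂ i j)) * (b₁ - b₂) ≤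
        N * a * r * |D₁ i j - D₂ i j| := by
      refine (le_abs_self _).trans ?_
      rw [abs_mul, abs_mul, abs_mul, abs_of_nonneg hμ₁0]
      have h3 : |D₁ i j + D₂ i j| ≤ 2 * a := (abs_add_le _ _).trans (by linarith [hD₁ i j, hD₂ i j])
      calc b₁ / w₁ * (|D₁ i j - D₂ i j| * |D₁ i j + D₂ i j|) * |b₁ - b₂|
          ≤ M / m * (|D₁ i j - D₂ i j| * (2 * a)) * r := by gcongr
        _ = N * a * r * |D₁ i j - D₂ i j| := by rw [hN]; ring
    have h4 : (b₁ / w₁ - b₂ / w₂) * D₂ i j ^ 2 * (b₁ - b₂) ≤ K * a ^ 2 * e := by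
      refine (le_abs_self _).trans ?_
      rw [abs_mul, abs_mul, abs_pow]
      calc |b₁ / w₁ - b₂ / w₂| * |D₂ i j| ^ 2 * |b₁ - b₂| ≤ K * r * a ^ 2 * r := by
            gcongr; exact hD₂ i j
        _ = K * a ^ 2 * e := by rw [← hr2]; ring
    have h5 : (b₁ / w₁ * D₁ i j ^ 2 - b₂ / w₂ * D₂ i j ^ 2) * (b₁ - b₂) =
        b₁ / w₁ * ((D₁ i j - D₂ i j) * (D₁ i j + D₂ i j)) * (b₁ - b₂) +
          (b₁ / w₁ - b₂ / w₂) * D₂ i j ^ 2 * (b₁ - b₂) := by ring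
    have h6 : 0 ≤ K * e := by positivity
    rw [hr2] at h1
    rw [h5]
    linarith
  have tp : ∀ j, (w₁ * v₁ j - w₂ * v₂ j) * (p₁ j - p₂ j)
      - (b₁ / w₁ * p₁ j - b₂ / w₂ * p₂ j) * (p₁ j - p₂ j) ≤ C₁ * (1 + a ^ 2) * e := fun j => by
    have h1 := parabolic_term_le (N := 0) (P₁ := p₁ j) hμ₀0 hμ₁
      (abs_mul_sub_mul_le hw₁M (hv₂ j) hw (hv j)) hμ (hp j)
    rw [hr2] at h1
    linarith
  have tq : ∀ j, (b₁ * v₁ j - b₂ * v₂ j) * (q₁ j - q₂ j)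
      - (b₁ / w₁ * q₁ j - b₂ / w₂ * q₂ j) * (q₁ j - q₂ j) ≤ C₁ * (1 + a ^ 2) * e := fun j => by
    have h1 := parabolic_term_le (N := 0) (P₁ := q₁ j) hμ₀0 hμ₁
      (abs_mul_sub_mul_le hb₁M (hv₂ j) hb (hv j)) hμ (hq j)
    rw [hr2] at h1
    linarith
  have sD := Finset.sum_le_sum fun i (_ : i ∈ Finset.univ) =>
    Finset.sum_le_sum fun j (_ : j ∈ Finset.univ) => tD i j
  have sp := Finset.sum_le_sum fun j (_ : j ∈ Finset.univ) => tp j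
  have sq := Finset.sum_le_sum fun j (_ : j ∈ Finset.univ) => tq j
  simp only [Finset.sum_const, Finset.card_univ, Fintype.card_fin, nsmul_eq_mul, Nat.cast_ofNat]
    at sD sp sq
  have eD : (∑ i, ∑ j, ((v₁ i * v₁ j - v₂ i * v₂ j) * (D₁ i j - D₂ i j)
      - (b₁ / w₁ * D₁ i j - b₂ / w₂ * D₂ i j) * (D₁ i j - D₂ i j)
      + (b₁ / w₁ * D₁ i j ^ 2 - b₂ / w₂ * D₂ i j ^ 2) * (b₁ - b₂))) =
      (∑ i, ∑ j, ((v₁ i * v₁ j - v₂ i * v₂ j) * (D₁ i j - D₂ i j)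
        - (b₁ / w₁ * D₁ i j - b₂ / w₂ * D₂ i j) * (D₁ i j - D₂ i j))) +
      (b₁ / w₁ * (∑ i, ∑ j, D₁ i j ^ 2) - b₂ / w₂ * ∑ i, ∑ j, D₂ i j ^ 2) * (b₁ - b₂) := by
    rw [Finset.mul_sum, Finset.mul_sum, ← Finset.sum_sub_distrib, Finset.sum_mul,
      ← Finset.sum_add_distrib]
    refine Finset.sum_congr rfl fun i _ => ?_
    rw [Finset.mul_sum, Finset.mul_sum, ← Finset.sum_sub_distrib, Finset.sum_mul,
      ← Finset.sum_add_distrib]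
  have tκ : -(κ * ((w₁ ^ 2 - w₂ ^ 2) * (w₁ - w₂))) ≤ 2 * |κ| * M * e := by
    refine (neg_le_abs _).trans ?_
    have h1 : |w₁ ^ 2 - w₂ ^ 2| ≤ 2 * M * r := by
      rw [pow_two, pow_two]; exact abs_mul_sub_mul_le hw₁M hw₂M hw hw
    rw [abs_mul, abs_mul]
    calc |κ| * (|w₁ ^ 2 - w₂ ^ 2| * |w₁ - w₂|) ≤ |κ| * (2 * M * r * r) := by gcongr
      _ = 2 * |κ| * M * e := by rw [← hr2]; ring
  have tb : -((b₁ * w₁ - b₂ * w₂) * (b₁ - b₂)) ≤ 2 * M * e := by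
    refine (neg_le_abs _).trans ?_
    have h1 := abs_mul_sub_mul_le hb₁M hw₂M hb hw
    rw [abs_mul]
    calc |b₁ * w₁ - b₂ * w₂| * |b₁ - b₂| ≤ 2 * M * r * r := by gcongr
      _ = 2 * M * e := by rw [← hr2]; ring
  have h8 : 0 ≤ (2 * |κ| * M + 2 * M) * a ^ 2 * e := by positivity
  rw [eD] at sD
  linarith

theorem partialDeriv_sub {f g : Space → ℝ} (hf : ContDiff ℝ 1 f) (hg : ContDiff ℝ 1 g) (j : Fin 3)
    (x : Space) :
    partialDeriv j (fun y => f y - g y) x = partialDeriv j f x - partialDeriv j g x := by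
  unfold partialDeriv
  rw [fderiv_fun_sub (hf.differentiable one_ne_zero x) (hg.differentiable one_ne_zero x)]
  rfl

theorem integral_sub_sub_sub {f₁ f₂ g₁ g₂ : Space → ℝ} {ν : Measure Space} (hf₁ : Integrable f₁ ν)
    (hg₁ : Integrable g₁ ν) (hf₂ : Integrable f₂ ν) (hg₂ : Integrable g₂ ν) :
    (∫ x, f₁ x ∂ν) - (∫ x, g₁ x ∂ν) - ((∫ x, f₂ x ∂ν) - ∫ x, g₂ x ∂ν) =
      ∫ x, f₁ x - g₁ x - (f₂ x - g₂ x) ∂ν := by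
  rw [← integral_sub hf₁ hg₁, ← integral_sub hf₂ hg₂]
  exact (integral_sub (hf₁.sub hg₁) (hf₂.sub hg₂)).symm

variable {κ : ℝ} {v₁ v₂ v₁' v₂' : Fin 3 → Space → ℝ} {ω₁ ω₂ b₁ b₂ ω₁' ω₂' b₁' b₂' : Space → ℝ}

/-- Contracting with `vᵢ vⱼ` only sees the symmetric part of the gradient. -/
theorem sum_mul_partialDeriv_eq (v : Fin 3 → ℝ) (w : Fin 3 → Space → ℝ) (x : Space) :
    ∑ i, ∑ j, v i * v j * partialDeriv j (w i) x = ∑ i, ∑ j, v i * v j * symPartial w i j x := by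
  simp only [symPartial, Fin.sum_univ_three]
  ring

theorem SliceEq.difference_v (h₁ : SliceEq L κ v₁ ω₁ b₁ v₁' ω₁' b₁')
    (h₂ : SliceEq L κ v₂ ω₂ b₂ v₂' ω₂' b₂') (hω₁ : ∀ x, 0 < ω₁ x) (hω₂ : ∀ x, 0 < ω₂ x) :
    ∫ x in box L, ∑ i, (v₁' i x - v₂' i x) * (v₁ i x - v₂ i x) =
      ∫ x in box L, ∑ i, ∑ j,
        ((v₁ i x * v₁ j x - v₂ i x * v₂ j x) * (symPartial v₁ i j x - symPartial v₂ i j x)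
        - (b₁ x / ω₁ x * symPartial v₁ i j x - b₂ x / ω₂ x * symPartial v₂ i j x) *
          (symPartial v₁ i j x - symPartial v₂ i j x)) := by
  set w : Fin 3 → Space → ℝ := fun i x => v₁ i x - v₂ i x with hw
  have cw : ∀ i, ContDiff ℝ 1 (w i) := fun i => (h₁.v_diff i).sub (h₂.v_diff i)
  have pw : ∀ i, PeriodicFun L (w i) := fun i => (h₁.v_per i).comp₂ (h₂.v_per i) fun a b => a - b
  have dw : ∀ x, ∑ i, partialDeriv i (w i) x = 0 := fun x => by
    simp only [hw, partialDeriv_sub (h₁.v_diff _) (h₂.v_diff _), Finset.sum_sub_distrib, h₁.div,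
      h₂.div, sub_zero]
  have mw : ∀ i, ∫ x in box L, w i x = 0 := fun i => by
    simp only [hw]
    rw [integral_sub (integrableOn_box_of_continuous (h₁.v_diff i).continuous)
      (integrableOn_box_of_continuous (h₂.v_diff i).continuous), h₁.mean, h₂.mean, sub_zero]
  have sw : ∀ i j x, symPartial w i j x = symPartial v₁ i j x - symPartial v₂ i j x :=
    fun i j x => by
      simp only [symPartial, hw, partialDeriv_sub (h₁.v_diff _) (h₂.v_diff _)]
      ring
  have csw : ∀ i j, Continuous (symPartial w i j) := continuous_symPartial cw
  have cμ₁ : Continuous fun x => b₁ x / ω₁ x :=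
    h₁.b_diff.continuous.div h₁.ω_diff.continuous fun x => (hω₁ x).ne'
  have cμ₂ : Continuous fun x => b₂ x / ω₂ x :=
    h₂.b_diff.continuous.div h₂.ω_diff.continuous fun x => (hω₂ x).ne'
  have ic : ∀ {v : Fin 3 → Space → ℝ}, (∀ i, ContDiff ℝ 1 (v i)) → IntegrableOn
      (fun x => ∑ i, ∑ j, v i x * v j x * symPartial w i j x) (box L) := fun hv =>
    integrableOn_box_of_continuous (continuous_finsetSum _ fun i _ =>
      continuous_finsetSum _ fun j _ =>
        ((hv i).continuous.mul (hv j).continuous).mul (csw i j))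
  have id : ∀ {v : Fin 3 → Space → ℝ} {μ : Space → ℝ}, (∀ i, ContDiff ℝ 1 (v i)) →
      Continuous μ → IntegrableOn
      (fun x => ∑ i, ∑ j, μ x * symPartial v i j x * symPartial w i j x) (box L) := fun hv hμ =>
    integrableOn_box_of_continuous (continuous_finsetSum _ fun i _ =>
      continuous_finsetSum _ fun j _ =>
        (hμ.mul (continuous_symPartial hv i j)).mul (csw i j))
  have iv : ∀ {v' : Fin 3 → Space → ℝ}, (∀ i, IntegrableOn (v' i) (box L)) →
      IntegrableOn (fun x => ∑ i, v' i x * w i x) (box L) := fun hv' =>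
    integrable_finsetSum _ fun i _ => integrableOn_mul_continuous (hv' i) (cw i).continuous
  have e₁ := h₁.eq_v w cw pw dw mw
  have e₂ := h₂.eq_v w cw pw dw mw
  simp only [fun x => sum_mul_partialDeriv_eq (fun i => v₁ i x) w x] at e₁
  simp only [fun x => sum_mul_partialDeriv_eq (fun i => v₂ i x) w x] at e₂
  have e : ∫ x in box L, ∑ i, (v₁' i x - v₂' i x) * (v₁ i x - v₂ i x) =
      (∫ x in box L, ∑ i, v₁' i x * w i x) - ∫ x in box L, ∑ i, v₂' i x * w i x := by
    rw [← integral_sub (iv h₁.v'_int) (iv h₂.v'_int)]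
    congr 1; ext x
    rw [← Finset.sum_sub_distrib]
    exact Finset.sum_congr rfl fun i _ => sub_mul _ _ _
  rw [e, e₁, e₂, integral_sub_sub_sub (ic h₁.v_diff) (id h₁.v_diff cμ₁) (ic h₂.v_diff)
    (id h₂.v_diff cμ₂)]
  congr 1; ext x
  simp only [← Finset.sum_sub_distrib, sw]
  refine Finset.sum_congr rfl fun i _ => Finset.sum_congr rfl fun j _ => ?_
  ring

/-- The difference of two convection-diffusion equations, tested with the difference. -/
theorem difference_scalar {f₁ f₂ f₁' f₂' μ₁ μ₂ R₁ R₂ : Space → ℝ}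
    (hv₁ : ∀ i, Continuous (v₁ i)) (hv₂ : ∀ i, Continuous (v₂ i))
    (hf₁ : ContDiff ℝ 1 f₁) (hf₂ : ContDiff ℝ 1 f₂) (hp₁ : PeriodicFun L f₁) (hp₂ : PeriodicFun L f₂)
    (hi₁ : IntegrableOn f₁' (box L)) (hi₂ : IntegrableOn f₂' (box L))
    (hμ₁ : Continuous μ₁) (hμ₂ : Continuous μ₂) (hR₁ : Continuous R₁) (hR₂ : Continuous R₂)
    (h₁ : ∀ z : Space → ℝ, ContDiff ℝ 1 z → PeriodicFun L z →
      ∫ x in box L, f₁' x * z x = (∫ x in box L, ∑ j, f₁ x * v₁ j x * partialDeriv j z x)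
        - (∫ x in box L, ∑ j, μ₁ x * partialDeriv j f₁ x * partialDeriv j z x)
        + ∫ x in box L, R₁ x * z x)
    (h₂ : ∀ z : Space → ℝ, ContDiff ℝ 1 z → PeriodicFun L z →
      ∫ x in box L, f₂' x * z x = (∫ x in box L, ∑ j, f₂ x * v₂ j x * partialDeriv j z x)
        - (∫ x in box L, ∑ j, μ₂ x * partialDeriv j f₂ x * partialDeriv j z x)
        + ∫ x in box L, R₂ x * z x) :
    ∫ x in box L, (f₁' x - f₂' x) * (f₁ x - f₂ x) =
      ∫ x in box L, ((∑ j,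
        ((f₁ x * v₁ j x - f₂ x * v₂ j x) * (partialDeriv j f₁ x - partialDeriv j f₂ x)
        - (μ₁ x * partialDeriv j f₁ x - μ₂ x * partialDeriv j f₂ x) *
          (partialDeriv j f₁ x - partialDeriv j f₂ x))) + (R₁ x - R₂ x) * (f₁ x - f₂ x)) := by
  set z : Space → ℝ := fun x => f₁ x - f₂ x with hz
  have cz : ContDiff ℝ 1 z := hf₁.sub hf₂
  have pz : PeriodicFun L z := hp₁.comp₂ hp₂ fun a b => a - b
  have dz : ∀ j x, partialDeriv j z x = partialDeriv j f₁ x - partialDeriv j f₂ x :=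
    fun j x => partialDeriv_sub hf₁ hf₂ j x
  have cdz : ∀ j, Continuous (partialDeriv j z) := fun j => continuous_partialDeriv j cz
  have ic : ∀ {f : Space → ℝ} {v : Fin 3 → Space → ℝ}, Continuous f → (∀ i, Continuous (v i)) →
      IntegrableOn (fun x => ∑ j, f x * v j x * partialDeriv j z x) (box L) := fun hf hv =>
    integrableOn_box_of_continuous (continuous_finsetSum _ fun j _ => (hf.mul (hv j)).mul (cdz j))
  have id : ∀ {f μ : Space → ℝ}, ContDiff ℝ 1 f → Continuous μ →
      IntegrableOn (fun x => ∑ j, μ x * partialDeriv j f x * partialDeriv j z x) (box L) :=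
    fun hf hμ => integrableOn_box_of_continuous (continuous_finsetSum _ fun j _ =>
      (hμ.mul (continuous_partialDeriv j hf)).mul (cdz j))
  have iR : ∀ {R : Space → ℝ}, Continuous R → IntegrableOn (fun x => R x * z x) (box L) :=
    fun hR => integrableOn_box_of_continuous (hR.mul cz.continuous)
  have e : ∫ x in box L, (f₁' x - f₂' x) * (f₁ x - f₂ x) =
      (∫ x in box L, f₁' x * z x) - ∫ x in box L, f₂' x * z x := by
    rw [← integral_sub (integrableOn_mul_continuous hi₁ cz.continuous)
      (integrableOn_mul_continuous hi₂ cz.continuous)]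
    congr 1; ext x
    exact sub_mul _ _ _
  have hR : ∫ x in box L, (R₁ x - R₂ x) * z x =
      (∫ x in box L, R₁ x * z x) - ∫ x in box L, R₂ x * z x := by
    rw [← integral_sub (iR hR₁) (iR hR₂)]
    congr 1; ext x
    exact sub_mul _ _ _
  have hQ : ∫ x in box L, ∑ j,
      ((f₁ x * v₁ j x - f₂ x * v₂ j x) * (partialDeriv j f₁ x - partialDeriv j f₂ x)
        - (μ₁ x * partialDeriv j f₁ x - μ₂ x * partialDeriv j f₂ x) *
          (partialDeriv j f₁ x - partialDeriv j f₂ x)) =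
      (∫ x in box L, ∑ j, f₁ x * v₁ j x * partialDeriv j z x)
        - (∫ x in box L, ∑ j, μ₁ x * partialDeriv j f₁ x * partialDeriv j z x)
        - ((∫ x in box L, ∑ j, f₂ x * v₂ j x * partialDeriv j z x)
        - ∫ x in box L, ∑ j, μ₂ x * partialDeriv j f₂ x * partialDeriv j z x) := by
    rw [integral_sub_sub_sub (ic hf₁.continuous hv₁) (id hf₁ hμ₁) (ic hf₂.continuous hv₂)
      (id hf₂ hμ₂)]
    congr 1; ext x
    simp only [dz, sub_mul, Finset.sum_sub_distrib]
    ring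
  have iQ : IntegrableOn (fun x => ∑ j,
      ((f₁ x * v₁ j x - f₂ x * v₂ j x) * (partialDeriv j f₁ x - partialDeriv j f₂ x)
        - (μ₁ x * partialDeriv j f₁ x - μ₂ x * partialDeriv j f₂ x) *
          (partialDeriv j f₁ x - partialDeriv j f₂ x))) (box L) := by
    refine integrableOn_box_of_continuous (continuous_finsetSum _ fun j _ => ?_)
    have c₁ := hf₁.continuous
    have c₂ := hf₂.continuous
    have c₃ := hv₁ j
    have c₄ := hv₂ j
    have c₅ := continuous_partialDeriv j hf₁
    have c₆ := continuous_partialDeriv j hf₂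
    fun_prop
  have iz : IntegrableOn (fun x => (R₁ x - R₂ x) * (f₁ x - f₂ x)) (box L) :=
    integrableOn_box_of_continuous ((hR₁.sub hR₂).mul cz.continuous)
  rw [integral_add iQ iz, hQ, hR, e, h₁ z cz pz, h₂ z cz pz]
  ring

end

section

variable {L : Space} {S : ℝ} {T : EReal}

/-! ### The energy of the difference -/

theorem integral_add_add {f g h : Space → ℝ} {ν : Measure Space} (hf : Integrable f ν)
    (hg : Integrable g ν) (hh : Integrable h ν) :
    (∫ x, f x ∂ν) + (∫ x, g x ∂ν) + (∫ x, h x ∂ν) = ∫ x, f x + g x + h x ∂ν := by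
  rw [← integral_add hf hg]
  exact (integral_add (hf.add hg) hh).symm

/-- The time derivative of half the squared `L²` norm of the difference of two solutions is bounded
by that norm, with a factor that is quadratic in a bound `a` for the gradients. -/
theorem exists_energy_bound (κ : ℝ) {m M : ℝ} (hm : 0 < m) (hM : 0 < M) : ∃ C, 0 ≤ C ∧
    ∀ (v₁ v₂ v₁' v₂' : Fin 3 → Space → ℝ) (ω₁ ω₂ b₁ b₂ ω₁' ω₂' b₁' b₂' : Space → ℝ) (a : ℝ),
      SliceEq L κ v₁ ω₁ b₁ v₁' ω₁' b₁' → SliceEq L κ v₂ ω₂ b₂ v₂' ω₂' b₂' →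
      (∀ i x, |v₁ i x| ≤ M) → (∀ i x, |v₂ i x| ≤ M) → (∀ x, m ≤ ω₁ x) → (∀ x, |ω₁ x| ≤ M) →
      (∀ x, m ≤ ω₂ x) → (∀ x, |ω₂ x| ≤ M) → (∀ x, m ≤ b₁ x) → (∀ x, |b₁ x| ≤ M) →
      (∀ x, |b₂ x| ≤ M) → (∀ i j x, |partialDeriv j (v₁ i) x| ≤ a) →
      (∀ i j x, |partialDeriv j (v₂ i) x| ≤ a) → (∀ j x, |partialDeriv j ω₂ x| ≤ a) →
      (∀ j x, |partialDeriv j b₂ x| ≤ a) →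
      (∫ x in box L, ∑ i, (v₁' i x - v₂' i x) * (v₁ i x - v₂ i x))
        + (∫ x in box L, (ω₁' x - ω₂' x) * (ω₁ x - ω₂ x))
        + (∫ x in box L, (b₁' x - b₂' x) * (b₁ x - b₂ x)) ≤
      C * (1 + a ^ 2) * ∫ x in box L,
        ((∑ i, (v₁ i x - v₂ i x) ^ 2) + (ω₁ x - ω₂ x) ^ 2 + (b₁ x - b₂ x) ^ 2) := by
  obtain ⟨C, hC0, hC⟩ := exists_difference_bound κ hm hM
  refine ⟨C, hC0, ?_⟩
  intro v₁ v₂ v₁' v₂' ω₁ ω₂ b₁ b₂ ω₁' ω₂' b₁' b₂' a h₁ h₂ hv₁ hv₂ hω₁ hω₁M hω₂ hω₂M hb₁ hb₁M hb₂M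
    hD₁ hD₂ hp hq
  have pω₁ : ∀ x, 0 < ω₁ x := fun x => hm.trans_le (hω₁ x)
  have pω₂ : ∀ x, 0 < ω₂ x := fun x => hm.trans_le (hω₂ x)
  have cv₁ : ∀ i, Continuous (v₁ i) := fun i => (h₁.v_diff i).continuous
  have cv₂ : ∀ i, Continuous (v₂ i) := fun i => (h₂.v_diff i).continuous
  have cω₁ := h₁.ω_diff.continuous
  have cω₂ := h₂.ω_diff.continuous
  have cb₁ := h₁.b_diff.continuous
  have cb₂ := h₂.b_diff.continuous
  have cμ₁ : Continuous fun x => b₁ x / ω₁ x := cb₁.div cω₁ fun x => (pω₁ x).ne'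
  have cμ₂ : Continuous fun x => b₂ x / ω₂ x := cb₂.div cω₂ fun x => (pω₂ x).ne'
  have cD₁ := continuous_symPartial h₁.v_diff
  have cD₂ := continuous_symPartial h₂.v_diff
  have hsym : ∀ {v : Fin 3 → Space → ℝ}, (∀ i j x, |partialDeriv j (v i) x| ≤ a) →
      ∀ i j x, |symPartial v i j x| ≤ a := fun h i j x => by
    rw [symPartial, abs_div, abs_two, div_le_iff₀ two_pos]
    exact (abs_add_le _ _).trans (by linarith [h i j x, h j i x])
  have eω := difference_scalar cv₁ cv₂ h₁.ω_diff h₂.ω_diff h₁.ω_per h₂.ω_per h₁.ω'_int h₂.ω'_int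
    cμ₁ cμ₂ (by fun_prop) (by fun_prop) h₁.scalar_ω h₂.scalar_ω
  have eb := difference_scalar cv₁ cv₂ h₁.b_diff h₂.b_diff h₁.b_per h₂.b_per h₁.b'_int h₂.b'_int
    cμ₁ cμ₂ ((cb₁.mul cω₁).neg.add (h₁.continuous_source pω₁))
    ((cb₂.mul cω₂).neg.add (h₂.continuous_source pω₂)) (h₁.scalar_b pω₁) (h₂.scalar_b pω₂)
  rw [h₁.difference_v h₂ pω₁ pω₂, eω, eb]
  set Fv : Space → ℝ := fun x => ∑ i, ∑ j,
    ((v₁ i x * v₁ j x - v₂ i x * v₂ j x) * (symPartial v₁ i j x - symPartial v₂ i j x)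
      - (b₁ x / ω₁ x * symPartial v₁ i j x - b₂ x / ω₂ x * symPartial v₂ i j x) *
        (symPartial v₁ i j x - symPartial v₂ i j x)) with hFv
  have iv : IntegrableOn Fv (box L) := by
    refine integrableOn_box_of_continuous (continuous_finsetSum _ fun i _ =>
      continuous_finsetSum _ fun j _ => ?_)
    exact ((((cv₁ i).mul (cv₁ j)).sub ((cv₂ i).mul (cv₂ j))).mul ((cD₁ i j).sub (cD₂ i j))).sub
      (((cμ₁.mul (cD₁ i j)).sub (cμ₂.mul (cD₂ i j))).mul ((cD₁ i j).sub (cD₂ i j)))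
  have is : ∀ {f₁ f₂ R₁ R₂ : Space → ℝ}, ContDiff ℝ 1 f₁ → ContDiff ℝ 1 f₂ → Continuous R₁ →
      Continuous R₂ → IntegrableOn (fun x => (∑ j,
        ((f₁ x * v₁ j x - f₂ x * v₂ j x) * (partialDeriv j f₁ x - partialDeriv j f₂ x)
        - (b₁ x / ω₁ x * partialDeriv j f₁ x - b₂ x / ω₂ x * partialDeriv j f₂ x) *
          (partialDeriv j f₁ x - partialDeriv j f₂ x))) + (R₁ x - R₂ x) * (f₁ x - f₂ x))
        (box L) := by
    intro f₁ f₂ R₁ R₂ hf₁ hf₂ hR₁ hR₂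
    have c₁ := hf₁.continuous
    have c₂ := hf₂.continuous
    refine integrableOn_box_of_continuous ((continuous_finsetSum _ fun j _ => ?_).add
      ((hR₁.sub hR₂).mul (c₁.sub c₂)))
    have d₁ := continuous_partialDeriv j hf₁
    have d₂ := continuous_partialDeriv j hf₂
    exact (((c₁.mul (cv₁ j)).sub (c₂.mul (cv₂ j))).mul (d₁.sub d₂)).sub
      (((cμ₁.mul d₁).sub (cμ₂.mul d₂)).mul (d₁.sub d₂))
  have iω := is (R₁ := fun x => -(κ * ω₁ x ^ 2)) (R₂ := fun x => -(κ * ω₂ x ^ 2)) h₁.ω_diff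
    h₂.ω_diff (by fun_prop) (by fun_prop)
  have ib := is h₁.b_diff h₂.b_diff ((cb₁.mul cω₁).neg.add (h₁.continuous_source pω₁))
    ((cb₂.mul cω₂).neg.add (h₂.continuous_source pω₂))
  rw [integral_add_add iv iω ib, ← integral_const_mul]
  refine integral_mono ((iv.add iω).add ib) ?_ fun x => ?_
  · refine integrableOn_box_of_continuous (continuous_const.mul (((continuous_finsetSum _
      fun i _ => ((cv₁ i).sub (cv₂ i)).pow 2).add ?_).add ?_)) <;> fun_prop
  · refine le_trans (le_of_eq ?_) (hC (fun i => v₁ i x) (fun i => v₂ i x) (ω₁ x) (ω₂ x) (b₁ x)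
      (b₂ x) (fun i j => symPartial v₁ i j x) (fun i j => symPartial v₂ i j x)
      (fun j => partialDeriv j ω₁ x) (fun j => partialDeriv j ω₂ x) (fun j => partialDeriv j b₁ x)
      (fun j => partialDeriv j b₂ x) a (fun i => hv₁ i x) (fun i => hv₂ i x) (hω₁ x) (hω₁M x)
      (hω₂ x) (hω₂M x) (hb₁ x) (hb₁M x) (hb₂M x) (fun i j => hsym hD₁ i j x)
      (fun i j => hsym hD₂ i j x) (fun j => hp j x) (fun j => hq j x))
    simp only [hFv, Pi.add_apply, Pi.neg_apply, Pi.mul_apply]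
    ring

theorem TimeReg.integral_sq (hL : ∀ i, 0 < L i) {f f' : ℝ → Space → ℝ} (h : TimeReg L S f f')
    {t : ℝ} (ht : t ∈ Icc 0 S) :
    (∫ x in box L, f t x ^ 2) - ∫ x in box L, f 0 x ^ 2 =
      ∫ s in (0 : ℝ)..t, 2 * ∫ x in box L, f' s x * f s x := by
  have e := h.integral_comp hL (contDiff_id.pow 2)
    (fun y => ((hasDerivAt_id y).pow 2).congr_deriv (by simp)) (G' := fun y => 2 * y)
    (by fun_prop) 0 ht
  simp only [zero_mul, Real.exp_zero, one_mul, zero_add, id] at e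
  rw [e]
  refine intervalIntegral.integral_congr fun s _ => ?_
  rw [← integral_const_mul]
  congr 1; ext x
  ring

theorem TimeReg.integrableOn_integral_mul (hL : ∀ i, 0 < L i) {f f' : ℝ → Space → ℝ}
    (h : TimeReg L S f f') : IntegrableOn (fun s => ∫ x in box L, f' s x * f s x) (Ioo 0 S) := by
  have e := h.integrableOn_integral_chain hL (G' := fun y => y) continuous_id 0
  simp only [zero_mul, Real.exp_zero, one_mul, zero_add] at e
  simpa only [mul_comm] using e

variable {κ : ℝ} {v₁ v₂ v₁' v₂' V₁ V₂ : ℝ → Fin 3 → Space → ℝ}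
  {ω₁ ω₂ b₁ b₂ ω₁' ω₂' b₁' b₂' W₁ W₂ B₁ B₂ : ℝ → Space → ℝ} {A₁ A₂ : ℝ → ℝ}

/-- Two regular solutions with positive `ω` and `b` and the same initial values coincide, by
Gronwall's inequality for the squared `L²` norm of the difference. -/
theorem RegularSolution.unique (hL : ∀ i, 0 < L i) (hS : 0 < S)
    (h₁ : RegularSolution L κ S v₁ ω₁ b₁ v₁' ω₁' b₁' V₁ W₁ B₁ A₁)
    (h₂ : RegularSolution L κ S v₂ ω₂ b₂ v₂' ω₂' b₂' V₂ W₂ B₂ A₂) {m : ℝ} (hm : 0 < m)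
    (hm₁ : ∀ t ∈ Icc 0 S, ∀ x, m ≤ W₁ t x ∧ m ≤ B₁ t x) (hm₂ : ∀ t ∈ Icc 0 S, ∀ x, m ≤ W₂ t x)
    (h0 : ∀ᵐ x ∂volume.restrict (box L),
      (∀ i, V₁ 0 i x = V₂ 0 i x) ∧ W₁ 0 x = W₂ 0 x ∧ B₁ 0 x = B₂ 0 x) :
    ∀ t ∈ Icc 0 S, ∀ᵐ x ∂volume.restrict (box L),
      (∀ i, V₁ t i x = V₂ t i x) ∧ W₁ t x = W₂ t x ∧ B₁ t x = B₂ t x := by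
  choose N₁ hN₁0 hN₁ using fun i => (h₁.rep_v i).exists_bound hL
  choose N₂ hN₂0 hN₂ using fun i => (h₂.rep_v i).exists_bound hL
  obtain ⟨N₃, hN₃0, hN₃⟩ := h₁.rep_ω.exists_bound hL
  obtain ⟨N₄, hN₄0, hN₄⟩ := h₂.rep_ω.exists_bound hL
  obtain ⟨N₅, hN₅0, hN₅⟩ := h₁.rep_b.exists_bound hL
  obtain ⟨N₆, hN₆0, hN₆⟩ := h₂.rep_b.exists_bound hL
  set M := 1 + (∑ i, N₁ i) + (∑ i, N₂ i) + N₃ + N₄ + N₅ + N₆ with hM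
  have s₁ : 0 ≤ ∑ i, N₁ i := Finset.sum_nonneg fun i _ => hN₁0 i
  have s₂ : 0 ≤ ∑ i, N₂ i := Finset.sum_nonneg fun i _ => hN₂0 i
  have l₁ : ∀ i, N₁ i ≤ ∑ i, N₁ i := fun i =>
    Finset.single_le_sum (fun i _ => hN₁0 i) (Finset.mem_univ i)
  have l₂ : ∀ i, N₂ i ≤ ∑ i, N₂ i := fun i =>
    Finset.single_le_sum (fun i _ => hN₂0 i) (Finset.mem_univ i)
  obtain ⟨C, hC0, hC⟩ := exists_energy_bound (L := L) κ hm (show 0 < M by linarith)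
  have dv := fun i => (h₁.rep_v i).timeReg.sub (h₂.rep_v i).timeReg
  have dω := h₁.rep_ω.timeReg.sub h₂.rep_ω.timeReg
  have db := h₁.rep_b.timeReg.sub h₂.rep_b.timeReg
  set e : ℝ → Space → ℝ := fun t x =>
    (∑ i, (V₁ t i x - V₂ t i x) ^ 2) + (W₁ t x - W₂ t x) ^ 2 + (B₁ t x - B₂ t x) ^ 2 with he
  have he0 : ∀ t x, 0 ≤ e t x := fun t x => by
    have : 0 ≤ ∑ i, (V₁ t i x - V₂ t i x) ^ 2 := Finset.sum_nonneg fun _ _ => sq_nonneg _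
    positivity
  set E : ℝ → ℝ := fun t => ∫ x in box L, e t x with hE
  have iv : ∀ t ∈ Icc 0 S, ∀ i, IntegrableOn (fun x => (V₁ t i x - V₂ t i x) ^ 2) (box L) :=
    fun t ht i => integrableOn_box_of_continuous (((dv i).continuous ht).pow 2)
  have iω : ∀ t ∈ Icc 0 S, IntegrableOn (fun x => (W₁ t x - W₂ t x) ^ 2) (box L) :=
    fun t ht => integrableOn_box_of_continuous ((dω.continuous ht).pow 2)
  have ib : ∀ t ∈ Icc 0 S, IntegrableOn (fun x => (B₁ t x - B₂ t x) ^ 2) (box L) :=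
    fun t ht => integrableOn_box_of_continuous ((db.continuous ht).pow 2)
  have isum : ∀ t ∈ Icc 0 S, IntegrableOn (fun x => ∑ i, (V₁ t i x - V₂ t i x) ^ 2) (box L) :=
    fun t ht => integrable_finsetSum _ fun i _ => iv t ht i
  have ie : ∀ t ∈ Icc 0 S, IntegrableOn (e t) (box L) := fun t ht =>
    ((isum t ht).add (iω t ht)).add (ib t ht)
  have hEsum : ∀ t ∈ Icc 0 S, E t = (∑ i, ∫ x in box L, (V₁ t i x - V₂ t i x) ^ 2)
      + (∫ x in box L, (W₁ t x - W₂ t x) ^ 2) + ∫ x in box L, (B₁ t x - B₂ t x) ^ 2 := by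
    intro t ht
    rw [← integral_finsetSum _ fun i _ => iv t ht i, ← integral_add (isum t ht) (iω t ht)]
    exact integral_add ((isum t ht).add (iω t ht)) (ib t ht)
  have hS0 : (0 : ℝ) ∈ Icc 0 S := ⟨le_rfl, hS.le⟩
  have hE0 : E 0 = 0 := by
    rw [hE]
    refine integral_eq_zero_of_ae ?_
    filter_upwards [h0] with x hx
    simp [he, hx.1, hx.2.1, hx.2.2]
  set Jv : Fin 3 → ℝ → ℝ := fun i s =>
    ∫ x in box L, (v₁' s i x - v₂' s i x) * (V₁ s i x - V₂ s i x) with hJv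
  set Jω : ℝ → ℝ := fun s => ∫ x in box L, (ω₁' s x - ω₂' s x) * (W₁ s x - W₂ s x) with hJω
  set Jb : ℝ → ℝ := fun s => ∫ x in box L, (b₁' s x - b₂' s x) * (B₁ s x - B₂ s x) with hJb
  have jv : ∀ i, IntegrableOn (Jv i) (Ioo 0 S) := fun i => (dv i).integrableOn_integral_mul hL
  have jω : IntegrableOn Jω (Ioo 0 S) := dω.integrableOn_integral_mul hL
  have jb : IntegrableOn Jb (Ioo 0 S) := db.integrableOn_integral_mul hL
  have jsum : IntegrableOn (fun s => ∑ i, 2 * Jv i s) (Ioo 0 S) :=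
    integrable_finsetSum _ fun i _ => (jv i).const_mul 2
  have jJ : IntegrableOn (fun s => (∑ i, 2 * Jv i s) + 2 * Jω s + 2 * Jb s) (Ioo 0 S) :=
    (jsum.add (jω.const_mul 2)).add (jb.const_mul 2)
  have hprim : ∀ t ∈ Icc 0 S,
      E t = E 0 + ∫ s in (0 : ℝ)..t, ((∑ i, 2 * Jv i s) + 2 * Jω s + 2 * Jb s) := by
    intro t ht
    have tv := fun i => (dv i).integral_sq hL ht
    have tω := dω.integral_sq hL ht
    have tb := db.integral_sq hL ht
    have e1 := Finset.sum_congr rfl fun i (_ : i ∈ Finset.univ) => tv i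
    rw [Finset.sum_sub_distrib] at e1
    have k : ∀ {a : ℝ → ℝ}, IntegrableOn a (Ioo 0 S) → IntervalIntegrable a volume 0 t :=
      intervalIntegrable_of_integrableOn_Ioo ht
    have j12 : IntegrableOn (fun s => (∑ i, 2 * Jv i s) + 2 * Jω s) (Ioo 0 S) :=
      jsum.add (jω.const_mul 2)
    rw [intervalIntegral.integral_add (k j12) (k (jb.const_mul 2)),
      intervalIntegral.integral_add (k jsum) (k (jω.const_mul 2)),
      intervalIntegral.integral_finsetSum fun i _ => k ((jv i).const_mul 2), hEsum t ht,
      hEsum 0 hS0]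
    linarith
  have hint : IntervalIntegrable (fun s => (∑ i, 2 * Jv i s) + 2 * Jω s + 2 * Jb s) volume 0 S :=
    intervalIntegrable_of_integrableOn_Ioo ⟨hS.le, le_rfl⟩ jJ
  have hEc : ContinuousOn E (Icc 0 S) := continuousOn_of_primitive hS.le hint hprim
  set a : ℝ → ℝ := fun s => 2 * (C * (1 + (A₁ s ^ 2 + A₂ s ^ 2))) with ha
  have ha0 : ∀ s, 0 ≤ a s := fun s => by positivity
  have hai : IntegrableOn a (Ioo 0 S) := by
    have hc : IntegrableOn (fun _ : ℝ => (1 : ℝ)) (Ioo 0 S) := by simp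
    exact ((hc.add (h₁.rep_ω.bound_sq.add h₂.rep_ω.bound_sq)).const_mul C).const_mul 2
  have hbound : ∀ᵐ s ∂volume.restrict (Ioo 0 S),
      (∑ i, 2 * Jv i s) + 2 * Jω s + 2 * Jb s ≤ a s * E s := by
    filter_upwards [ae_restrict_mem measurableSet_Ioo, h₁.slice, h₂.slice,
      ae_all_iff.2 fun i => (h₁.rep_v i).ae_time, ae_all_iff.2 fun i => (h₂.rep_v i).ae_time,
      h₂.rep_ω.ae_time, h₂.rep_b.ae_time] with s hs e₁ e₂ gv₁ gv₂ gω gb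
    have hs' : s ∈ Icc 0 S := Ioo_subset_Icc_self hs
    -- the two gradient bounds combine such that the square of the combination is integrable
    set α := √(A₁ s ^ 2 + A₂ s ^ 2) with hα
    have hα2 : α ^ 2 = A₁ s ^ 2 + A₂ s ^ 2 := Real.sq_sqrt (by positivity)
    have hA₁ : A₁ s ≤ α := Real.le_sqrt_of_sq_le (by linarith [sq_nonneg (A₂ s)])
    have hA₂ : A₂ s ≤ α := Real.le_sqrt_of_sq_le (by linarith [sq_nonneg (A₁ s)])
    have key := hC (V₁ s) (V₂ s) (v₁' s) (v₂' s) (W₁ s) (W₂ s) (B₁ s) (B₂ s) (ω₁' s) (ω₂' s)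
      (b₁' s) (b₂' s) α e₁ e₂ (fun i x => (hN₁ i s hs' x).trans (by linarith [l₁ i]))
      (fun i x => (hN₂ i s hs' x).trans (by linarith [l₂ i])) (fun x => (hm₁ s hs' x).1)
      (fun x => (hN₃ s hs' x).trans (by linarith)) (hm₂ s hs')
      (fun x => (hN₄ s hs' x).trans (by linarith)) (fun x => (hm₁ s hs' x).2)
      (fun x => (hN₅ s hs' x).trans (by linarith)) (fun x => (hN₆ s hs' x).trans (by linarith))
      (fun i j x => ((gv₁ i).2.2 j x).trans hA₁) (fun i j x => ((gv₂ i).2.2 j x).trans hA₂)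
      (fun j x => (gω.2.2 j x).trans hA₂) (fun j x => (gb.2.2 j x).trans hA₂)
    have iJ : ∀ i, IntegrableOn (fun x => (v₁' s i x - v₂' s i x) * (V₁ s i x - V₂ s i x)) (box L) :=
      fun i => integrableOn_mul_continuous ((e₁.v'_int i).sub (e₂.v'_int i)) ((dv i).continuous hs')
    rw [integral_finsetSum _ fun i _ => iJ i, hα2] at key
    have key' : (∑ i, Jv i s) + Jω s + Jb s ≤ C * (1 + (A₁ s ^ 2 + A₂ s ^ 2)) * E s := key
    rw [← Finset.mul_sum, ha]
    linarith
  have hgron : ∀ t ∈ Icc 0 S, E t ≤ ∫ s in (0 : ℝ)..t, a s * E s := by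
    intro t ht
    rw [hprim t ht, hE0, zero_add]
    have k : IntervalIntegrable a volume 0 t := intervalIntegrable_of_integrableOn_Ioo ht hai
    have k2 : IntervalIntegrable (fun s => a s * E s) volume 0 t := by
      refine k.mul_continuousOn (hEc.mono ?_)
      rw [uIcc_of_le ht.1]
      exact Icc_subset_Icc_right ht.2
    rw [intervalIntegral.integral_of_le ht.1, intervalIntegral.integral_of_le ht.1,
      integral_Ioc_eq_integral_Ioo, integral_Ioc_eq_integral_Ioo]
    exact setIntegral_mono_ae_restrict (jJ.mono_set (Ioo_subset_Ioo_right ht.2))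
      ((intervalIntegrable_iff_integrableOn_Ioo_of_le ht.1).1 k2)
      (ae_mono (Measure.restrict_mono (Ioo_subset_Ioo_right ht.2) le_rfl) hbound)
  have hzero := gronwall_zero hS.le hEc
    (intervalIntegrable_of_integrableOn_Ioo ⟨hS.le, le_rfl⟩ hai) ha0 hgron
  intro t ht
  have hz := (integral_eq_zero_iff_of_nonneg (he0 t) (ie t ht)).1
    (le_antisymm (hzero t ht) (integral_nonneg (he0 t)))
  filter_upwards [hz] with x hx
  have hx' : (∑ i, (V₁ t i x - V₂ t i x) ^ 2) + (W₁ t x - W₂ t x) ^ 2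
      + (B₁ t x - B₂ t x) ^ 2 = 0 := hx
  have n1 : 0 ≤ ∑ i, (V₁ t i x - V₂ t i x) ^ 2 := Finset.sum_nonneg fun _ _ => sq_nonneg _
  have n2 := sq_nonneg (W₁ t x - W₂ t x)
  have n3 := sq_nonneg (B₁ t x - B₂ t x)
  have z1 : ∑ i, (V₁ t i x - V₂ t i x) ^ 2 = 0 := by linarith
  rw [Finset.sum_eq_zero_iff_of_nonneg fun _ _ => sq_nonneg _] at z1
  refine ⟨fun i => ?_, ?_, ?_⟩
  · exact sub_eq_zero.1 (pow_eq_zero_iff two_ne_zero |>.1 (z1 i (Finset.mem_univ i)))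
  · exact sub_eq_zero.1 (pow_eq_zero_iff two_ne_zero |>.1 (by linarith))
  · exact sub_eq_zero.1 (pow_eq_zero_iff two_ne_zero |>.1 (by linarith))

/-! ### Uniqueness -/

/-- The regular representative of a solution with initial values bounded below by a positive
constant has positive lower bounds for `ω` and `b` on `[0, S]`. -/
theorem exists_positive_regularSolution (hL : ∀ i, 0 < L i) (hS : 0 < S) (hST : (S : EReal) < T)
    {v₀ : Fin 3 → Space → ℝ} {ω₀ b₀ : Space → ℝ} (hv₀ : MemVdiv L 2 v₀) (hω₀ : MemV L 2 ω₀)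
    (hb₀ : MemV L 2 b₀) {m : ℝ} (hm : 0 < m) (hω : ∀ᵐ x ∂volume.restrict (box L), m ≤ ω₀ x)
    (hb : ∀ᵐ x ∂volume.restrict (box L), m ≤ b₀ x) {v : ℝ → Fin 3 → Space → ℝ}
    {ω b : ℝ → Space → ℝ} (h : IsSolution L κ T v₀ ω₀ b₀ v ω b) :
    ∃ V W B A, RegularSolution L κ S v ω b (fun t i => timeDeriv L T (fun s => v s i) t)
      (timeDeriv L T ω) (timeDeriv L T b) V W B A ∧
      (∀ᵐ x ∂volume.restrict (box L),
        (∀ i, V 0 i x = v₀ i x) ∧ W 0 x = ω₀ x ∧ B 0 x = b₀ x) ∧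
      ∃ m₀ > 0, ∀ t ∈ Icc 0 S, ∀ x, m₀ ≤ W t x ∧ m₀ ≤ B t x := by
  obtain ⟨V, W, B, A, hr⟩ := exists_regularSolution hL hS hST h
  have iv := fun i => (hr.rep_v i).initial_value hL hS (hv₀.1 i).aestronglyMeasurable_box (h.init_v i)
  have iω := hr.rep_ω.initial_value hL hS hω₀.aestronglyMeasurable_box h.init_ω
  have ib := hr.rep_b.initial_value hL hS hb₀.aestronglyMeasurable_box h.init_b
  have h0 : (0 : ℝ) ∈ Icc 0 S := ⟨le_rfl, hS.le⟩
  refine ⟨V, W, B, A, hr, ?_, hr.exists_lower_bound hL hm fun x => ⟨?_, ?_⟩⟩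
  · filter_upwards [ae_all_iff.2 iv, iω, ib] with x h1 h2 h3 using ⟨h1, h2, h3⟩
  · refine forall_of_ae_box hL (hr.rep_ω.periodicFun 0) (hr.rep_ω.continuous h0) isClosed_Ici ?_ x
    filter_upwards [iω, hω] with y h1 h2
    rw [h1]; exact h2
  · refine forall_of_ae_box hL (hr.rep_b.periodicFun 0) (hr.rep_b.continuous h0) isClosed_Ici ?_ x
    filter_upwards [ib, hb] with y h1 h2
    rw [h1]; exact h2

theorem ae_timeInterval_of_forall {p : ℝ → Prop}
    (h : ∀ S : ℝ, 0 < S → (S : EReal) < T → ∀ᵐ t ∂volume.restrict (Ioo 0 S), p t) :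
    ∀ᵐ t ∂volume.restrict (timeInterval T), p t := by
  have hcov : timeInterval T ⊆ ⋃ q : {q : ℚ // (0 : ℝ) < q ∧ ((q : ℝ) : EReal) < T},
      Ioo 0 ((q : ℚ) : ℝ) := by
    intro t ht
    obtain ⟨q, hq1, hq2⟩ := EReal.lt_iff_exists_rat_btwn.1 ht.2
    have hq : t < q := EReal.coe_lt_coe_iff.1 hq1
    exact mem_iUnion.2 ⟨⟨q, ht.1.trans hq, hq2⟩, ht.1, hq⟩
  refine ae_restrict_of_ae_restrict_of_subset hcov ?_
  rw [ae_restrict_iUnion_iff]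
  exact fun q => h _ q.2.1 q.2.2

end

end Kolmogorov

end

theorem proposition2
    (L : Space) (hL : ∀ i, 0 < L i)
    (κ₂ : ℝ) (hκ₂ : 0 < κ₂)
    (v₀ : Fin 3 → Space → ℝ) (ω₀ b₀ : Space → ℝ)
    (hv₀ : MemVdiv L 2 v₀) (hω₀ : MemV L 2 ω₀) (hb₀ : MemV L 2 b₀)
    (b_min ω_min ω_max : ℝ) (hb_min : 0 < b_min) (hω_min : 0 < ω_min)
    (hb₀_lower : ∀ᵐ x ∂volume.restrict (box L), b_min ≤ b₀ x)
    (hω₀_bounds : ∀ᵐ x ∂volume.restrict (box L), ω_min ≤ ω₀ x ∧ ω₀ x ≤ ω_max)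
    (T : EReal) (hT : 0 < T)
    (v v' : ℝ → Fin 3 → Space → ℝ) (ω ω' b b' : ℝ → Space → ℝ)
    (hsol : IsSolution L κ₂ T v₀ ω₀ b₀ v ω b)
    (hsol' : IsSolution L κ₂ T v₀ ω₀ b₀ v' ω' b') :
    ∀ᵐ t ∂volume.restrict (timeInterval T),
      (∀ i, v t i =ᵐ[volume.restrict (box L)] v' t i) ∧
      ω t =ᵐ[volume.restrict (box L)] ω' t ∧
      b t =ᵐ[volume.restrict (box L)] b' t := by
  refine ae_timeInterval_of_forall fun S hS hST => ?_
  have hm : 0 < min ω_min b_min := lt_min hω_min hb_min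
  have hω : ∀ᵐ x ∂volume.restrict (box L), min ω_min b_min ≤ ω₀ x :=
    hω₀_bounds.mono fun x hx => (min_le_left _ _).trans hx.1
  have hb : ∀ᵐ x ∂volume.restrict (box L), min ω_min b_min ≤ b₀ x :=
    hb₀_lower.mono fun x hx => (min_le_right _ _).trans hx
  obtain ⟨V₁, W₁, B₁, A₁, h₁, i₁, m₁, hm₁, l₁⟩ :=
    exists_positive_regularSolution hL hS hST hv₀ hω₀ hb₀ hm hω hb hsol
  obtain ⟨V₂, W₂, B₂, A₂, h₂, i₂, m₂, hm₂, l₂⟩ :=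
    exists_positive_regularSolution hL hS hST hv₀ hω₀ hb₀ hm hω hb hsol'
  have hU := h₁.unique hL hS h₂ (lt_min hm₁ hm₂)
    (fun t ht x => ⟨(min_le_left _ _).trans (l₁ t ht x).1, (min_le_left _ _).trans (l₁ t ht x).2⟩)
    (fun t ht x => (min_le_right _ _).trans (l₂ t ht x).1) (by
      filter_upwards [i₁, i₂] with x h1 h2
      exact ⟨fun i => (h1.1 i).trans (h2.1 i).symm, h1.2.1.trans h2.2.1.symm,
        h1.2.2.trans h2.2.2.symm⟩)
  filter_upwards [ae_restrict_mem measurableSet_Ioo, ae_all_iff.2 fun i => (h₁.rep_v i).ae_time,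
    ae_all_iff.2 fun i => (h₂.rep_v i).ae_time, h₁.rep_ω.ae_time, h₂.rep_ω.ae_time,
    h₁.rep_b.ae_time, h₂.rep_b.ae_time] with t ht gv₁ gv₂ gω₁ gω₂ gb₁ gb₂
  have e := hU t (Ioo_subset_Icc_self ht)
  refine ⟨fun i => ?_, ?_, ?_⟩
  · filter_upwards [e, ae_restrict_of_ae (gv₁ i).1, ae_restrict_of_ae (gv₂ i).1] with x h1 h2 h3
    exact h2.trans ((h1.1 i).trans h3.symm)
  · filter_upwards [e, ae_restrict_of_ae gω₁.1, ae_restrict_of_ae gω₂.1] with x h1 h2 h3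
    exact h2.trans (h1.2.1.trans h3.symm)
  · filter_upwards [e, ae_restrict_of_ae gb₁.1, ae_restrict_of_ae gb₂.1] with x h1 h2 h3
    exact h2.trans (h1.2.2.trans h3.symm)
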